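/- \textbf{Problem.} An instance of $\delta$-Multi Strings consists of a finite alphabet $\Sigma$; $k$ strings $s_1,\dots,s_k\in(\Sigma\cup\{\star\})^L$, where $\star\notin\Sigma$ is a wildcard; lower bounds $d_1,\dots,d_k\in\mathbb N$ and upper bounds $D_1,\dots,D_k\in\mathbb N$; a distance function $\delta$ on strings over $\Sigma\cup\{\star\}$ with values in $\mathbb N$; and $\beta\in\{0,1\}$. A string $y\in\Sigma^L$ is feasible if $d_h\le\delta(y,s_h)\le D_h$ for all $h\in\{1,\dots,k\}$. The task is to find a feasible $y$ that minimizes $\beta\cdot\sum_{h=1}^k\delta(y,s_h)$ among all feasible strings, or to report that no feasible string exists. The function $\delta$ is \emph{character-wise wildcard-compatible} if $\delta(x,y)=\sum_{j=1}^L\delta(x[j],y[j])$ for all $x,y\in(\Sigma\cup\{\star\})^L$ and $\delta(c,\star)=0$ for all $c\in\Sigma$; it is then given in the input by the table of its values on $\Sigma\times\Sigma$. \textbf{Theorem.} $\delta$-Multi Strings with a character-wise wildcard-compatible $\delta$ can be solved in time $$(\Delta k)^{O(k)}\cdot|\Sigma|^{O(k^2)}\cdot L^{O(1)},\qquad \Delta=\max_{c_1,c_2\in\Sigma}\delta(c_1,c_2).$$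 Precisely: there are one algorithm (a program for a random access machine on natural numbers on which addition, truncated subtraction, comparison with zero and indirectly addressed memory access each take one step) and one constant $C\in\mathbb N$ such that on every such instance the algorithm halts with a correct answer after at most $$C\cdot\bigl(\max(1,\Delta)\cdot k\bigr)^{Ck}\cdot\max(1,|\Sigma|)^{Ck^2}\cdot\max(1,L)^{C}$$ steps (with $0^0=1$, and $\Delta=0$ if $\Sigma=\emptyset$). -/

import Mathlib

/-! ## A unit-cost random access machine

The memory consists of banks of cells, each cell holding a natural number. A program names banks by
literals (so it uses finitely many of them), while cells inside a bank are addressed indirectly.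
The arithmetic operations are addition and truncated subtraction. There is no unit-cost
multiplication or division, so one step lengthens the stored numbers by at most a constant number
of bits, and the model is polynomially equivalent to Turing machines. -/

namespace RAM

/-- `m b a` is the content of cell `a` of bank `b`. -/
abbrev Mem := ℕ → ℕ → ℕ

/-- Expressions: literals, memory access with a computed address, `+` and truncated `-`. -/
inductive Expr : Type
  | lit (n : ℕ) : Expr
  | load (bank : ℕ) (addr : Expr) : Expr
  | add (e₁ e₂ : Expr) : Expr
  | sub (e₁ e₂ : Expr) : Expr

/-- The value of an expression in a memory state. -/
def Expr.eval (m : Mem) : Expr → ℕ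
  | .lit n => n
  | .load b e => m b (e.eval m)
  | .add e₁ e₂ => e₁.eval m + e₂.eval m
  | .sub e₁ e₂ => e₁.eval m - e₂.eval m

/-- The time needed to evaluate an expression: one step for every operation in it. -/
def Expr.cost : Expr → ℕ
  | .lit _ => 1
  | .load _ e => e.cost + 1
  | .add e₁ e₂ => e₁.cost + e₂.cost + 1
  | .sub e₁ e₂ => e₁.cost + e₂.cost + 1

/-- Programs. A test succeeds when its expression is nonzero. -/
inductive Prog : Type
  | skip : Prog
  | store (bank : ℕ) (addr val : Expr) : Prog
  | seq (p q : Prog) : Prog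
  | ite (e : Expr) (p q : Prog) : Prog
  | loop (e : Expr) (p : Prog) : Prog

/-- The memory `m` after writing `v` into cell `a` of bank `b`. -/
def Mem.write (m : Mem) (b a v : ℕ) : Mem :=
  fun b' a' => if b' = b ∧ a' = a then v else m b' a'

/-- `Exec p m t m'`: started in memory `m`, the program `p` halts after exactly `t` steps, in
memory `m'`. `loop e p` is the while loop with test `e` and body `p`. -/
inductive Exec : Prog → Mem → ℕ → Mem → Prop
  | skip (m : Mem) : Exec .skip m 1 m
  | store (m : Mem) (b : ℕ) (a v : Expr) :
      Exec (.store b a v) m (a.cost + v.cost + 1) (m.write b (a.eval m) (v.eval m))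
  | seq {p q : Prog} {m m₁ m₂ : Mem} {t₁ t₂ : ℕ} :
      Exec p m t₁ m₁ → Exec q m₁ t₂ m₂ → Exec (.seq p q) m (t₁ + t₂) m₂
  | ite_true {e : Expr} {p q : Prog} {m m' : Mem} {t : ℕ} :
      e.eval m ≠ 0 → Exec p m t m' → Exec (.ite e p q) m (e.cost + 1 + t) m'
  | ite_false {e : Expr} {p q : Prog} {m m' : Mem} {t : ℕ} :
      e.eval m = 0 → Exec q m t m' → Exec (.ite e p q) m (e.cost + 1 + t) m'
  | loop_stop {e : Expr} {p : Prog} {m : Mem} :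
      e.eval m = 0 → Exec (.loop e p) m (e.cost + 1) m
  | loop_step {e : Expr} {p : Prog} {m m₁ m₂ : Mem} {t₁ t₂ : ℕ} :
      e.eval m ≠ 0 → Exec p m t₁ m₁ → Exec (.loop e p) m₁ t₂ m₂ →
      Exec (.loop e p) m (e.cost + 1 + t₁ + t₂) m₂

/-- Programs are deterministic: running time and final memory are determined by the input. -/
theorem Exec.deterministic {p : Prog} {m m₁ m₂ : Mem} {t₁ t₂ : ℕ}
    (h₁ : Exec p m t₁ m₁) (h₂ : Exec p m t₂ m₂) : t₁ = t₂ ∧ m₁ = m₂ := by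
  induction h₁ generalizing t₂ m₂ with
  | skip m => cases h₂; exact ⟨rfl, rfl⟩
  | store m b a v => cases h₂; exact ⟨rfl, rfl⟩
  | seq _ _ ih₁ ih₂ =>
    cases h₂ with
    | seq k₁ k₂ =>
      obtain ⟨rfl, rfl⟩ := ih₁ k₁
      obtain ⟨rfl, rfl⟩ := ih₂ k₂
      exact ⟨rfl, rfl⟩
  | ite_true he _ ih =>
    cases h₂ with
    | ite_true _ k => obtain ⟨rfl, rfl⟩ := ih k; exact ⟨rfl, rfl⟩
    | ite_false he' _ => exact absurd he' he
  | ite_false he _ ih =>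
    cases h₂ with
    | ite_true he' _ => exact absurd he he'
    | ite_false _ k => obtain ⟨rfl, rfl⟩ := ih k; exact ⟨rfl, rfl⟩
  | loop_stop he =>
    cases h₂ with
    | loop_stop _ => exact ⟨rfl, rfl⟩
    | loop_step he' _ _ => exact absurd he he'
  | loop_step he _ _ ih₁ ih₂ =>
    cases h₂ with
    | loop_stop he' => exact absurd he' he
    | loop_step _ k₁ k₂ =>
      obtain ⟨rfl, rfl⟩ := ih₁ k₁
      obtain ⟨rfl, rfl⟩ := ih₂ k₂
      exact ⟨rfl, rfl⟩

/-- A bank holding the finite sequence `f` in its first cells and `0` in all others. -/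
def bankOf {n : ℕ} (f : Fin n → ℕ) : ℕ → ℕ :=
  fun i => if h : i < n then f ⟨i, h⟩ else 0

end RAM

/-! ## The problem `δ`-Multi Strings -/

/-- An instance of `δ`-Multi Strings. The alphabet `Σ` is `Fin σ`; the wildcard is `none`. -/
structure MultiStrings where
  /-- the size of the alphabet -/
  σ : ℕ
  /-- the number of input strings -/
  k : ℕ
  /-- the common length of the strings -/
  L : ℕ
  /-- the input strings `s₁, …, s_k` -/
  s : Fin k → Fin L → Option (Fin σ)
  /-- the distance lower bounds -/
  d : Fin k → ℕ
  /-- the distance upper bounds -/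
  D : Fin k → ℕ
  /-- the distance function on strings that may contain wildcards -/
  δ : List (Option (Fin σ)) → List (Option (Fin σ)) → ℕ
  /-- the binary parameter -/
  β : Fin 2

namespace MultiStrings

variable (I : MultiStrings)

/-- `δ` is character-wise wildcard-compatible: on strings of length `L` it is the sum of the
distances of the characters, and every letter has distance `0` to the wildcard. -/
def CharwiseWildcardCompatible : Prop :=
  (∀ x y : Fin I.L → Option (Fin I.σ),
    I.δ (List.ofFn x) (List.ofFn y) = ∑ j, I.δ [x j] [y j]) ∧
  ∀ c : Fin I.σ, I.δ [some c] [none] = 0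

/-- The largest distance `Δ = max δ(c₁, c₂)` of two letters of the alphabet. -/
def maxDist : ℕ :=
  Finset.univ.sup fun c : Fin I.σ × Fin I.σ => I.δ [some c.1] [some c.2]

/-- The distance `δ(y, s_h)`. -/
def dist (y : Fin I.L → Fin I.σ) (h : Fin I.k) : ℕ :=
  I.δ (List.ofFn fun j => some (y j)) (List.ofFn (I.s h))

/-- `y` satisfies all the distance bounds. -/
def Feasible (y : Fin I.L → Fin I.σ) : Prop :=
  ∀ h, I.d h ≤ I.dist y h ∧ I.dist y h ≤ I.D h

/-- The objective `β · ∑ₕ δ(y, s_h)`. -/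
def objective (y : Fin I.L → Fin I.σ) : ℕ :=
  (I.β : ℕ) * ∑ h, I.dist y h

/-- `y` is a solution: it is feasible and minimizes the objective among the feasible strings. -/
def IsSolution (y : Fin I.L → Fin I.σ) : Prop :=
  I.Feasible y ∧ ∀ z, I.Feasible z → I.objective y ≤ I.objective z

/-- The number coding a character: `0` for the wildcard and `a + 1` for the letter `a`. -/
def charCode : Option (Fin I.σ) → ℕ
  | none => 0
  | some a => a + 1

/-- The initial memory. Bank `0` holds `k, L, |Σ|, β`; banks `1` and `2` hold the lower and the
upper bounds; bank `3` holds the `|Σ| × |Σ|` table of the distances of the letters, row by row;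
bank `4` holds the `k × L` matrix of the input strings, row by row. All other cells are `0`. -/
def encode : RAM.Mem
  | 0 => RAM.bankOf ![I.k, I.L, I.σ, (I.β : ℕ)]
  | 1 => RAM.bankOf I.d
  | 2 => RAM.bankOf I.D
  | 3 => RAM.bankOf fun p : Fin (I.σ * I.σ) => I.δ [some p.divNat] [some p.modNat]
  | 4 => RAM.bankOf fun p : Fin (I.k * I.L) => I.charCode (I.s p.divNat p.modNat)
  | _ => fun _ => 0

/-- The answer found in the final memory is right: either cell `0` of bank `5` holds `1` and bank
`6` starts with a solution `y`, or that cell holds `0` and no string is feasible. -/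
def CorrectOutput (m : RAM.Mem) : Prop :=
  (m 5 0 = 1 ∧ ∃ y, I.IsSolution y ∧ ∀ j : Fin I.L, m 6 j = y j) ∨
  (m 5 0 = 0 ∧ ¬ ∃ y, I.Feasible y)

/-- Started on the encoding of `I`, the program `p` halts within `T` steps with a right answer. -/
def SolvedWithin (p : RAM.Prog) (T : ℕ) : Prop :=
  ∃ t m, RAM.Exec p I.encode t m ∧ t ≤ T ∧ I.CorrectOutput m

end MultiStrings

/-! ## Programs with bounded loops

A small language of structured programs whose only loops run a number of times that is known when
the loop is entered. Its running time is bounded statically as soon as all loop limits are. -/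

namespace RAM

/-! Only the multiset of columns of the input matrix matters. There are (σ+1)^k possible columns,
called types, and giving the letter q to a column of type p contributes a vector `v p q` of k+1
numbers: the distances to the k strings and their sum. A feasible string of total distance o is a
choice of one vector per column whose sum meets the bounds and has last coordinate o. The two-sided
bounds become equations by slack types, whose letters contribute the zero vector or a unit vector.
The question is then whether a given target is a sum of exactly c p vectors of each type p (`Reach`,
`reach_iff_solvable`).

This is decided by doubling on the binary expansions of the counts. The chosen letters split, apart
from one letter for each type of odd count, into two halves whose sums differ by at most the sum S
of all vectors: equal letters are divided in pairs, and the rest contains each letter at most once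
(`exists_balanced_halves`, `Reach.halve`). The halves therefore lie near half the target, those of
the halves near a quarter, and so on, with an error 1+2S that does not grow (`levelSet_complete`).
Conversely, two sums for the halved counts and the odd letters always add up to a sum for the full
counts (`levelSet_sound`). It thus suffices to keep, on each level, the sums in a cube of side 2M+1
about the scaled target, where M = 1+3S. There are at most (2M+1)^(k+1) of them, and M is polynomial
in Δ, k and σ^k, which gives the factor (Δk)^{O(k)} σ^{O(k²)}.

Vectors are coded by numbers in a base B exceeding all coordinates that occur in a reachable vector.
The code is linear, so sums of vectors are sums of codes, and only the last comparison needs its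
injectivity (`code_mem_levelSet_iff`).

Trying o = 0, 1, 2, … yields the least total distance. A string attaining it is found by
self-reduction: further types stand for columns with a prescribed letter, and the columns are fixed
one after the other (`Solvable.fix`). If k = 0, L = 0 or σ ≤ 1, testing the string of zeros is
enough.

The algorithm is a fixed program with loops of known length. Its time is at most a constant times N
to the power of its nesting depth, where N bounds all loop limits (`bound_le`); so the running time
follows from the estimate of N in `loopLimit_le`. -/

theorem Mem.write_apply (m : Mem) (b a v b' : ℕ) :
    m.write b a v b' = if b' = b then Function.update (m b) a v else m b' := by
  funext a'
  unfold Mem.write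
  by_cases hb : b' = b
  · subst hb
    by_cases ha : a' = a <;> simp [ha]
  · simp [hb]

instance : Add Expr := ⟨Expr.add⟩
instance : Sub Expr := ⟨Expr.sub⟩
instance (n : ℕ) : OfNat Expr n := ⟨Expr.lit n⟩

/-- The register of a bank is its cell `0`. -/
def reg (b : ℕ) : Expr := .load b 0

/-- The cell with address `e` of bank `b`. -/
def cell (b : ℕ) (e : Expr) : Expr := .load b e

theorem eval_add (m : Mem) (e f : Expr) : (e + f).eval m = e.eval m + f.eval m := rfl
theorem eval_sub (m : Mem) (e f : Expr) : (e - f).eval m = e.eval m - f.eval m := rfl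
theorem eval_zero (m : Mem) : (0 : Expr).eval m = 0 := rfl
theorem eval_one (m : Mem) : (1 : Expr).eval m = 1 := rfl
theorem eval_reg (m : Mem) (b : ℕ) : (reg b).eval m = m b 0 := rfl
theorem eval_cell (m : Mem) (b : ℕ) (e : Expr) : (cell b e).eval m = m b (e.eval m) := rfl

attribute [simp] eval_add eval_sub eval_zero eval_one eval_reg eval_cell Mem.write_apply

/-- Structured programs. `rep r e p` runs `p` as often as the value of `e` says; bank `r` holds the
number of completed rounds in cell `0` and the limit in cell `1`. -/
inductive Cmd : Type
  | skip : Cmd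
  | store (bank : ℕ) (addr val : Expr) : Cmd
  | seq (p q : Cmd) : Cmd
  | ite (e : Expr) (p q : Cmd) : Cmd
  | rep (r : ℕ) (e : Expr) (p : Cmd) : Cmd

infixr:60 " ;; " => Cmd.seq

/-- Assignment to a register. -/
def set (b : ℕ) (e : Expr) : Cmd := .store b 0 e

namespace Cmd

/-- The program of the random access machine. -/
def compile : Cmd → Prog
  | skip => .skip
  | store b a v => .store b a v
  | seq p q => .seq p.compile q.compile
  | ite e p q => .ite e p.compile q.compile
  | rep r e p => .seq (.store r 1 e) (.seq (.store r 0 0)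
      (.loop (cell r 1 - cell r 0) (.seq p.compile (.store r 0 (cell r 0 + 1)))))

/-- A bound for the running time if no loop limit exceeds `N`. -/
def bound (N : ℕ) : Cmd → ℕ
  | skip => 1
  | store _ a v => a.cost + v.cost + 1
  | seq p q => p.bound N + q.bound N
  | ite e p q => e.cost + 1 + (p.bound N + q.bound N)
  | rep _ e p => e.cost + 12 + N * (p.bound N + 12)

/-- The bound with all loop limits equal to one. -/
def size (p : Cmd) : ℕ := p.bound 1

/-- The nesting depth of loops. -/
def depth : Cmd → ℕ
  | skip => 0
  | store _ _ _ => 0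
  | seq p q => max p.depth q.depth
  | ite _ p q => max p.depth q.depth
  | rep _ _ p => p.depth + 1

/-- The nesting depth is the largest number of loop factors that multiply each other. For a fixed
program both constants on the right are fixed, so the time is polynomial in the largest loop limit.
-/
theorem bound_le {N : ℕ} (hN : 1 ≤ N) (p : Cmd) : p.bound N ≤ p.size * N ^ p.depth := by
  unfold size
  induction p with
  | skip => simp [bound, depth]
  | store b a v => simp [bound, depth]
  | seq p q ihp ihq =>
    simp only [bound, depth, add_mul]
    exact add_le_add
      (ihp.trans (Nat.mul_le_mul_left _ (Nat.pow_le_pow_right hN (le_max_left _ _))))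
      (ihq.trans (Nat.mul_le_mul_left _ (Nat.pow_le_pow_right hN (le_max_right _ _))))
  | ite e p q ihp ihq =>
    simp only [bound, depth, add_mul]
    have h1 := ihp.trans (Nat.mul_le_mul_left (p.bound 1)
      (Nat.pow_le_pow_right hN (le_max_left p.depth q.depth)))
    have h2 := ihq.trans (Nat.mul_le_mul_left (q.bound 1)
      (Nat.pow_le_pow_right hN (le_max_right p.depth q.depth)))
    have h3 : 1 ≤ N ^ max p.depth q.depth := Nat.one_le_pow _ _ hN
    have h4 : e.cost ≤ e.cost * N ^ max p.depth q.depth := Nat.le_mul_of_pos_right _ h3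
    omega
  | rep r e p ih =>
    simp only [bound, depth, one_mul]
    have h3 : 1 ≤ N ^ p.depth := Nat.one_le_pow _ _ hN
    have h4 : 1 ≤ N ^ (p.depth + 1) := Nat.one_le_pow _ _ hN
    have h5 : N * (p.bound N + 12) ≤ N * ((p.bound 1 + 12) * N ^ p.depth) := by
      refine Nat.mul_le_mul_left _ ?_
      rw [add_mul]
      exact add_le_add ih (Nat.le_mul_of_pos_right _ h3)
    have h6 : e.cost + 12 ≤ (e.cost + 12) * N ^ (p.depth + 1) := Nat.le_mul_of_pos_right _ h4
    calc _ ≤ (e.cost + 12) * N ^ (p.depth + 1) + N * ((p.bound 1 + 12) * N ^ p.depth) :=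
          add_le_add h6 h5
      _ = _ := by ring

/-! ### Program logic: correctness and running time together -/

/-- Started in memory `m`, the program halts within the time bound for loop limits up to `N`, in a
memory that satisfies `Q`. -/
def Ensures (N : ℕ) (p : Cmd) (m : Mem) (Q : Mem → Prop) : Prop :=
  ∃ t m', Exec p.compile m t m' ∧ t ≤ p.bound N ∧ Q m'

variable {N : ℕ} {m : Mem} {Q : Mem → Prop}

theorem Ensures.mono {p : Cmd} {Q' : Mem → Prop} (h : Ensures N p m Q) (hQ : ∀ m', Q m' → Q' m') :
    Ensures N p m Q' := by
  obtain ⟨t, m', h1, h2, h3⟩ := h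
  exact ⟨t, m', h1, h2, hQ _ h3⟩

theorem ensures_skip (h : Q m) : Ensures N skip m Q := ⟨1, m, .skip m, le_rfl, h⟩

theorem ensures_store {b : ℕ} {a v : Expr} (h : Q (m.write b (a.eval m) (v.eval m))) :
    Ensures N (store b a v) m Q :=
  ⟨_, _, .store m b a v, le_rfl, h⟩

theorem ensures_set {b : ℕ} {v : Expr} (h : Q (m.write b 0 (v.eval m))) :
    Ensures N (set b v) m Q :=
  ensures_store h

theorem ensures_seq {p q : Cmd} (h : Ensures N p m fun m' => Ensures N q m' Q) :
    Ensures N (p ;; q) m Q := by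
  obtain ⟨t, m', h1, h2, t', m'', h3, h4, h5⟩ := h
  exact ⟨_, _, .seq h1 h3, add_le_add h2 h4, h5⟩

theorem Ensures.seq {p q : Cmd} {R : Mem → Prop} (h : Ensures N p m R)
    (h' : ∀ m', R m' → Ensures N q m' Q) : Ensures N (p ;; q) m Q :=
  ensures_seq (h.mono h')

theorem ensures_set_seq {b : ℕ} {v : Expr} {q : Cmd}
    (h : Ensures N q (m.write b 0 (v.eval m)) Q) : Ensures N (set b v ;; q) m Q :=
  ensures_seq (ensures_set h)

theorem ensures_store_seq {b : ℕ} {a v : Expr} {q : Cmd}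
    (h : Ensures N q (m.write b (a.eval m) (v.eval m)) Q) :
    Ensures N (store b a v ;; q) m Q :=
  ensures_seq (ensures_store h)

theorem ensures_ite {e : Expr} {p q : Cmd} (h : e.eval m ≠ 0 → Ensures N p m Q)
    (h' : e.eval m = 0 → Ensures N q m Q) : Ensures N (ite e p q) m Q := by
  by_cases he : e.eval m = 0
  · obtain ⟨t, m', h1, h2, h3⟩ := h' he
    exact ⟨_, m', .ite_false he h1, by simp only [bound]; omega, h3⟩
  · obtain ⟨t, m', h1, h2, h3⟩ := h he
    exact ⟨_, m', .ite_true he h1, by simp only [bound]; omega, h3⟩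

/-- The invariant rule. The limit is evaluated once and kept in cell 1 of bank r, so the body may
change whatever `e` reads as long as it restores cells 0 and 1 of that bank. The invariant is
required after the counter has been raised. -/
theorem ensures_rep {r : ℕ} {e : Expr} {p : Cmd} (n : ℕ) (Inv : ℕ → Mem → Prop)
    (hn : e.eval m = n) (hN : n ≤ N) (h0 : Inv 0 ((m.write r 1 n).write r 0 0))
    (hs : ∀ i < n, ∀ m, Inv i m → m r 0 = i → m r 1 = n →
      Ensures N p m fun m' => m' r 0 = i ∧ m' r 1 = n ∧ Inv (i + 1) (m'.write r 0 (i + 1)))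
    (hQ : ∀ m, Inv n m → m r 0 = n → Q m) : Ensures N (rep r e p) m Q := by
  -- Induction on the number j of rounds left. The last, failing test costs 6; a round costs 6 for
  -- its test and 6 for raising the counter, besides its body.
  have key : ∀ j, ∀ i m, i + j = n → Inv i m → m r 0 = i → m r 1 = n →
      ∃ t m', Exec (.loop (cell r 1 - cell r 0) (.seq p.compile (.store r 0 (cell r 0 + 1)))) m t m'
        ∧ t ≤ 6 + j * (p.bound N + 12) ∧ Q m' := by
    intro j
    induction j with
    | zero =>
      intro i m hi hI h1 h2
      have : i = n := by omega
      subst this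
      exact ⟨_, m, Exec.loop_stop (by simp [h1, h2]),
        by simp [Expr.cost, cell, HSub.hSub, Sub.sub, OfNat.ofNat], hQ m hI h1⟩
    | succ j ih =>
      intro i m hi hI h1 h2
      obtain ⟨t, m', a1, a2, a3, a4, a5⟩ := hs i (by omega) m hI h1 h2
      obtain ⟨t', m'', b1, b2, b3⟩ := ih (i + 1) (m'.write r 0 (i + 1)) (by omega) a5 (by simp)
        (by simp [a4])
      have hst : Exec (.store r 0 (cell r 0 + 1)) m' 6 (m'.write r 0 (i + 1)) := by
        have := Exec.store m' r 0 (cell r 0 + 1)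
        rwa [show (cell r 0 + 1 : Expr).eval m' = i + 1 by
          show m' r 0 + 1 = i + 1
          rw [a3]] at this
      refine ⟨_, m'', .loop_step ?_ (.seq a1 hst) b1, ?_, b3⟩
      · show m r 1 - m r 0 ≠ 0
        omega
      · have : (cell r 1 - cell r 0 : Expr).cost = 5 := rfl
        rw [this, Nat.add_mul, one_mul]
        omega
  obtain ⟨t, m', h1, h2, h3⟩ := key n 0 ((m.write r 1 n).write r 0 0) (by omega) h0 (by simp)
    (by simp)
  have e1 : Exec (.store r 1 e) m (1 + e.cost + 1) (m.write r 1 n) := by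
    have := Exec.store m r 1 e
    rwa [hn] at this
  have e2 : Exec (.store r 0 0) (m.write r 1 n) 3 ((m.write r 1 n).write r 0 0) :=
    Exec.store (m.write r 1 n) r 0 0
  refine ⟨_, m', .seq e1 (.seq e2 h1), ?_, h3⟩
  simp only [bound]
  have : n * (p.bound N + 12) ≤ N * (p.bound N + 12) := Nat.mul_le_mul_right _ hN
  omega

end Cmd

/-- The memories `m` and `m'` differ only in banks from `S`. -/
def Frame (S : List ℕ) (m m' : Mem) : Prop := ∀ b, b ∉ S → m' b = m b

theorem Frame.refl (S : List ℕ) (m : Mem) : Frame S m m := fun _ _ => rfl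

theorem Frame.trans {S S' : List ℕ} {m m' m'' : Mem} (h : Frame S m m') (h' : Frame S' m' m'')
    (hS : S' ⊆ S) : Frame S m m'' :=
  fun b hb => (h' b fun hb' => hb (hS hb')).trans (h b hb)

theorem Frame.mono {S S' : List ℕ} {m m' : Mem} (h : Frame S' m m') (hS : S' ⊆ S) :
    Frame S m m' :=
  (Frame.refl S m).trans h hS

theorem Frame.write {S : List ℕ} {m m' : Mem} (h : Frame S m m') {b a v : ℕ} (hb : b ∈ S) :
    Frame S m (m'.write b a v) := by
  intro b' hb'
  have : b' ≠ b := fun e => hb' (e ▸ hb)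
  rw [Mem.write_apply, if_neg this, h b' hb']

end RAM


/-! ## Sums of letters with multiplicities

For each type `p < P` and each letter `q < σ` there is a vector `v p q`. We study the vectors that
are sums of `c p` vectors of every type `p`. -/

namespace LetterSum

/-- A multiset of even size splits into two halves whose sums differ by at most the sum over all
letters. -/
theorem exists_balanced_halves (f : ℕ → ℕ → ℕ) (σ n : ℕ) (μ : Multiset ℕ)
    (hc : μ.card = 2 * n) (hμ : ∀ q ∈ μ, q < σ) :
    ∃ μ₁ μ₂ : Multiset ℕ, μ = μ₁ + μ₂ ∧ μ₁.card = n ∧ μ₂.card = n ∧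
      ∀ h, (μ₁.map (f · h)).sum ≤ (μ₂.map (f · h)).sum + ∑ q ∈ Finset.range σ, f q h ∧
        (μ₂.map (f · h)).sum ≤ (μ₁.map (f · h)).sum + ∑ q ∈ Finset.range σ, f q h := by
  induction n generalizing μ with
  | zero =>
    have : μ = 0 := by simpa using hc
    subst this
    exact ⟨0, 0, by simp⟩
  | succ n ih =>
    -- If no letter is repeated, any split works: both halves together are part of the alphabet, so
    -- each sum is at most the sum over all letters. If a letter occurs twice, one copy goes to each
    -- half and the differences do not change.
    by_cases hn : μ.Nodup
    · obtain ⟨μ₁, μ₂, rfl, h1⟩ : ∃ μ₁ μ₂ : Multiset ℕ, μ = μ₁ + μ₂ ∧ μ₁.card = n + 1 := by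
        induction μ using Quotient.inductionOn with
        | h l =>
          refine ⟨(l.take (n + 1) : Multiset ℕ), (l.drop (n + 1) : Multiset ℕ), ?_, ?_⟩
          · simp [Multiset.coe_add]
          · simp only [Multiset.quot_mk_to_coe, Multiset.coe_card] at hc
            simp only [Multiset.coe_card, List.length_take]
            omega
      rw [Multiset.card_add] at hc
      have hall : μ₁ + μ₂ ≤ (Finset.range σ).val :=
        (Multiset.le_iff_subset hn).2 fun q hq => by simpa using hμ q hq
      obtain ⟨ρ, hρ⟩ := Multiset.le_iff_exists_add.1 hall
      refine ⟨μ₁, μ₂, rfl, h1, by omega, fun h => ?_⟩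
      have e : ∑ q ∈ Finset.range σ, f q h = (Multiset.map (f · h) (Finset.range σ).val).sum := rfl
      rw [e, hρ, Multiset.map_add, Multiset.sum_add, Multiset.map_add, Multiset.sum_add]
      omega
    · obtain ⟨a, t, rfl⟩ : ∃ a t, μ = a ::ₘ a ::ₘ t := by
        by_contra hne
        push Not at hne
        exact hn (Multiset.nodup_iff_ne_cons_cons.2 hne)
      obtain ⟨μ₁, μ₂, rfl, h1, h2, h3⟩ := ih t (by simp at hc; omega)
        fun q hq => hμ q (by simp [hq])
      refine ⟨a ::ₘ μ₁, a ::ₘ μ₂, by simp, by simp [h1], by simp [h2], ?_⟩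
      intro h
      have := h3 h
      simp only [Multiset.map_cons, Multiset.sum_cons]
      omega

/-! ### Reachable vectors and their halving -/

/-- The vector `w` is a sum of `c p` vectors `v p q` for every `p < P`. -/
def Reach (P σ : ℕ) (v : ℕ → ℕ → ℕ → ℕ) (c : ℕ → ℕ) (w : ℕ → ℕ) : Prop :=
  ∃ μ : ℕ → Multiset ℕ, (∀ p < P, (μ p).card = c p ∧ ∀ q ∈ μ p, q < σ) ∧
    ∀ h, w h = ∑ p ∈ Finset.range P, ((μ p).map (v p · h)).sum

variable {P σ : ℕ} {v : ℕ → ℕ → ℕ → ℕ}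

/-- The sum of one letter `l p` for each type `p < n` with `c p` odd. -/
def oddSum (v : ℕ → ℕ → ℕ → ℕ) (c l : ℕ → ℕ) (n h : ℕ) : ℕ :=
  ∑ p ∈ Finset.range n, if c p % 2 = 1 then v p (l p) h else 0

theorem Reach.combine {c l w₁ w₂ w : ℕ → ℕ} (h₁ : Reach P σ v (fun p => c p / 2) w₁)
    (h₂ : Reach P σ v (fun p => c p / 2) w₂) (hl : ∀ p < P, c p % 2 = 1 → l p < σ)
    (hw : ∀ h, w h = w₁ h + w₂ h + oddSum v c l P h) : Reach P σ v c w := by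
  obtain ⟨μ₁, a₁, b₁⟩ := h₁
  obtain ⟨μ₂, a₂, b₂⟩ := h₂
  refine ⟨fun p => μ₁ p + μ₂ p + if c p % 2 = 1 then {l p} else 0, fun p hp => ⟨?_, ?_⟩, ?_⟩
  · dsimp only
    split_ifs <;> simp [(a₁ p hp).1, (a₂ p hp).1] <;> omega
  · intro q hq
    simp only [Multiset.mem_add] at hq
    rcases hq with (hq | hq) | hq
    · exact (a₁ p hp).2 q hq
    · exact (a₂ p hp).2 q hq
    · split_ifs at hq with hodd
      · rw [Multiset.mem_singleton.1 hq]
        exact hl p hp hodd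
      · simp at hq
  · intro h
    rw [hw h, b₁ h, b₂ h, oddSum, ← Finset.sum_add_distrib, ← Finset.sum_add_distrib]
    refine Finset.sum_congr rfl fun p _ => ?_
    by_cases hp : c p % 2 = 1 <;> simp [hp]

/-- One letter is set aside for each odd count, and the remaining letters are balanced type by type.
The differences add up over the types to a bound that does not depend on the counts, which is why
the windows stay small. -/
theorem Reach.halve {c w : ℕ → ℕ} (hr : Reach P σ v c w) :
    ∃ w₁ w₂ l : ℕ → ℕ, Reach P σ v (fun p => c p / 2) w₁ ∧ Reach P σ v (fun p => c p / 2) w₂ ∧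
      (∀ p < P, c p % 2 = 1 → l p < σ) ∧ (∀ h, w h = w₁ h + w₂ h + oddSum v c l P h) ∧
      ∀ h, w₁ h ≤ w₂ h + ∑ p ∈ Finset.range P, ∑ q ∈ Finset.range σ, v p q h ∧
        w₂ h ≤ w₁ h + ∑ p ∈ Finset.range P, ∑ q ∈ Finset.range σ, v p q h := by
  obtain ⟨μ, a, b⟩ := hr
  have key : ∀ p, ∃ (μ₁ μ₂ : Multiset ℕ) (l : ℕ), p < P →
      μ p = μ₁ + μ₂ + (if c p % 2 = 1 then {l} else 0) ∧ μ₁.card = c p / 2 ∧ μ₂.card = c p / 2 ∧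
      ∀ h, (μ₁.map (v p · h)).sum ≤ (μ₂.map (v p · h)).sum + ∑ q ∈ Finset.range σ, v p q h ∧
        (μ₂.map (v p · h)).sum ≤ (μ₁.map (v p · h)).sum + ∑ q ∈ Finset.range σ, v p q h := by
    intro p
    by_cases hp : p < P
    · obtain ⟨a1, a2⟩ := a p hp
      by_cases hodd : c p % 2 = 1
      · obtain ⟨l, hl⟩ := Multiset.card_pos_iff_exists_mem.1 (show 0 < (μ p).card by omega)
        obtain ⟨t, ht⟩ := Multiset.exists_cons_of_mem hl
        obtain ⟨μ₁, μ₂, h1, h2, h3, h4⟩ := exists_balanced_halves (v p) σ (c p / 2) t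
          (by rw [ht] at a1; simp at a1; omega) (fun q hq => a2 q (by simp [ht, hq]))
        refine ⟨μ₁, μ₂, l, fun _ => ⟨?_, h2, h3, h4⟩⟩
        rw [if_pos hodd, ht, h1, ← Multiset.singleton_add, add_comm]
      · obtain ⟨μ₁, μ₂, h1, h2, h3, h4⟩ := exists_balanced_halves (v p) σ (c p / 2) (μ p)
          (by omega) a2
        exact ⟨μ₁, μ₂, 0, fun _ => ⟨by simp [hodd, h1], h2, h3, h4⟩⟩
    · exact ⟨0, 0, 0, fun h => absurd h hp⟩
  choose μ₁ μ₂ l key using key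
  refine ⟨_, _, l, ⟨μ₁, fun p hp => ⟨(key p hp).2.1, fun q hq => ?_⟩, fun h => rfl⟩,
    ⟨μ₂, fun p hp => ⟨(key p hp).2.2.1, fun q hq => ?_⟩, fun h => rfl⟩, fun p hp hodd => ?_,
    fun h => ?_, fun h => ⟨?_, ?_⟩⟩
  · exact (a p hp).2 q (by rw [(key p hp).1]; simp [hq])
  · exact (a p hp).2 q (by rw [(key p hp).1]; simp [hq])
  · exact (a p hp).2 _ (by rw [(key p hp).1]; simp [hodd])
  · rw [b h, oddSum, ← Finset.sum_add_distrib, ← Finset.sum_add_distrib]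
    refine Finset.sum_congr rfl fun p hp => ?_
    rw [(key p (Finset.mem_range.1 hp)).1]
    split_ifs <;> simp
  · rw [← Finset.sum_add_distrib]
    exact Finset.sum_le_sum fun p hp => ((key p (Finset.mem_range.1 hp)).2.2.2 h).1
  · rw [← Finset.sum_add_distrib]
    exact Finset.sum_le_sum fun p hp => ((key p (Finset.mem_range.1 hp)).2.2.2 h).2

/-! ### Coding vectors by numbers -/

/-- The number with the digits `w 0, …, w (K - 1)` in base `B`. -/
def code (B K : ℕ) (w : ℕ → ℕ) : ℕ := ∑ h ∈ Finset.range K, w h * B ^ h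

theorem code_succ (B K : ℕ) (w : ℕ → ℕ) : code B (K + 1) w = code B K w + w K * B ^ K :=
  Finset.sum_range_succ _ _

theorem code_congr {B K : ℕ} {w w' : ℕ → ℕ} (h : ∀ i < K, w i = w' i) : code B K w = code B K w' :=
  Finset.sum_congr rfl fun i hi => by rw [h i (Finset.mem_range.1 hi)]

/-- The code is a linear form, so no bound on the digits is needed. One machine addition adds
vectors, and carries are harmless until a code has to be decoded. -/
theorem code_add (B K : ℕ) (w w' : ℕ → ℕ) :
    code B K (fun h => w h + w' h) = code B K w + code B K w' := by
  simp only [code, add_mul, Finset.sum_add_distrib]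

theorem code_lt {B K : ℕ} {w : ℕ → ℕ} (h : ∀ i < K, w i < B) : code B K w < B ^ K := by
  induction K with
  | zero => simp [code]
  | succ K ih =>
    rw [code_succ, pow_succ]
    have h1 := ih fun i hi => h i (by omega)
    have h2 : (w K + 1) * B ^ K ≤ B * B ^ K := Nat.mul_le_mul_right _ (h K (by omega))
    nlinarith

theorem code_injective {B K : ℕ} {w w' : ℕ → ℕ} (h : ∀ i < K, w i < B) (h' : ∀ i < K, w' i < B)
    (he : code B K w = code B K w') : ∀ i < K, w i = w' i := by
  induction K with
  | zero => intro i hi; omega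
  | succ K ih =>
    rw [code_succ, code_succ] at he
    have h1 := code_lt (w := w) fun i (hi : i < K) => h i (by omega)
    have h2 := code_lt (w := w') fun i (hi : i < K) => h' i (by omega)
    have hB : 0 < B ^ K := by omega
    have hK : w K = w' K := by
      have e1 : (code B K w + w K * B ^ K) / B ^ K = w K := by
        rw [Nat.add_mul_div_right _ _ hB, Nat.div_eq_of_lt h1, zero_add]
      have e2 : (code B K w' + w' K * B ^ K) / B ^ K = w' K := by
        rw [Nat.add_mul_div_right _ _ hB, Nat.div_eq_of_lt h2, zero_add]
      rw [← e1, he, e2]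
    intro i hi
    rcases Nat.lt_succ_iff_lt_or_eq.1 hi with hi | rfl
    · exact ih (fun i hi => h i (by omega)) (fun i hi => h' i (by omega)) (by rw [hK] at he; omega)
        i hi
    · exact hK

/-! ### Sets of codes -/

open Classical in
/-- The sums of an element of `A` and an element of `A'` that satisfy `f`. -/
noncomputable def sumFilter (f : ℕ → Prop) (A A' : Finset ℕ) : Finset ℕ :=
  (Finset.image₂ (· + ·) A A').filter f

theorem mem_sumFilter {f : ℕ → Prop} {A A' : Finset ℕ} {x : ℕ} :
    x ∈ sumFilter f A A' ↔ (∃ a ∈ A, ∃ b ∈ A', a + b = x) ∧ f x := by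
  simp [sumFilter, Finset.mem_image₂]

open Classical in
/-- Two copies of `A`, and then one element of `row p` for every `p` with `odd p`, are added up; all
partial sums have to satisfy `f`. -/
noncomputable def levelFold (f : ℕ → Prop) (row : ℕ → Finset ℕ) (odd : ℕ → Prop) (A : Finset ℕ) :
    ℕ → Finset ℕ
  | 0 => sumFilter f A A
  | p + 1 => if odd p then sumFilter f (levelFold f row odd A p) (row p)
    else levelFold f row odd A p

/-- The set of codes computed after `t` of `l` levels. -/
noncomputable def levelSet (f : ℕ → ℕ → Prop) (row : ℕ → Finset ℕ) (c : ℕ → ℕ) (P l : ℕ) :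
    ℕ → Finset ℕ
  | 0 => {0}
  | t + 1 => levelFold (f (l - 1 - t)) row (fun p => c p / 2 ^ (l - 1 - t) % 2 = 1)
      (levelSet f row c P l t) P

theorem levelFold_filter {f : ℕ → Prop} {row : ℕ → Finset ℕ} {odd : ℕ → Prop} {A : Finset ℕ}
    (n : ℕ) : ∀ x ∈ levelFold f row odd A n, f x := by
  induction n with
  | zero => intro x hx; exact (mem_sumFilter.1 hx).2
  | succ n ih =>
    intro x hx
    rw [levelFold] at hx
    split_ifs at hx
    · exact (mem_sumFilter.1 hx).2
    · exact ih x hx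

/-- The codes of the vectors `v p q`. -/
def rowCode (B K σ : ℕ) (v : ℕ → ℕ → ℕ → ℕ) (p : ℕ) : Finset ℕ :=
  (Finset.range σ).image fun q => code B K (v p q)

theorem oddSum_succ (c l : ℕ → ℕ) (n h : ℕ) :
    oddSum v c l (n + 1) h = oddSum v c l n h + if c n % 2 = 1 then v n (l n) h else 0 :=
  Finset.sum_range_succ _ _

/-- The filter only discards sums. Whatever `f` is, a surviving number is built from two members of
`A` and one letter for every odd type treated so far. -/
theorem levelFold_sound {B K : ℕ} {f : ℕ → Prop} {c : ℕ → ℕ} {A : Finset ℕ} {R : (ℕ → ℕ) → Prop}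
    (hA : ∀ x ∈ A, ∃ w, R w ∧ x = code B K w) (n : ℕ) :
    ∀ x ∈ levelFold f (rowCode B K σ v) (fun p => c p % 2 = 1) A n, ∃ w₁ w₂ l : ℕ → ℕ,
      R w₁ ∧ R w₂ ∧ (∀ p < n, c p % 2 = 1 → l p < σ) ∧
      x = code B K fun h => w₁ h + w₂ h + oddSum v c l n h := by
  induction n with
  | zero =>
    intro x hx
    obtain ⟨⟨a, ha, b, hb, rfl⟩, -⟩ := mem_sumFilter.1 hx
    obtain ⟨w₁, h1, rfl⟩ := hA a ha
    obtain ⟨w₂, h2, rfl⟩ := hA b hb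
    exact ⟨w₁, w₂, 0, h1, h2, by simp, by simp [oddSum, code_add]⟩
  | succ n ih =>
    intro x hx
    rw [levelFold] at hx
    split_ifs at hx with hodd
    · obtain ⟨⟨a, ha, b, hb, rfl⟩, -⟩ := mem_sumFilter.1 hx
      obtain ⟨w₁, w₂, l, h1, h2, h3, rfl⟩ := ih a ha
      obtain ⟨q, hq, rfl⟩ := Finset.mem_image.1 hb
      refine ⟨w₁, w₂, Function.update l n q, h1, h2, fun p hp hp' => ?_, ?_⟩
      · rcases Nat.lt_succ_iff_lt_or_eq.1 hp with hp | rfl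
        · rw [Function.update_of_ne (by omega)]
          exact h3 p hp hp'
        · simpa using hq
      · rw [← code_add]
        refine code_congr fun h _ => ?_
        rw [oddSum_succ, if_pos hodd, Function.update_self, ← add_assoc]
        congr 2
        refine Finset.sum_congr rfl fun p hp => ?_
        rw [Function.update_of_ne (Finset.mem_range.1 hp).ne]
    · obtain ⟨w₁, w₂, l, h1, h2, h3, rfl⟩ := ih x hx
      refine ⟨w₁, w₂, l, h1, h2, fun p hp hp' => ?_, code_congr fun h _ => ?_⟩
      · rcases Nat.lt_succ_iff_lt_or_eq.1 hp with hp | rfl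
        · exact h3 p hp hp'
        · exact absurd hp' hodd
      · rw [oddSum_succ, if_neg hodd, add_zero]

/-- Since the filter acts after every addition, `f` has to hold for all partial sums and not just
for the final one. -/
theorem levelFold_complete {B K : ℕ} {f : ℕ → Prop} {c : ℕ → ℕ} {A : Finset ℕ} {w₁ w₂ l : ℕ → ℕ}
    (h₁ : code B K w₁ ∈ A) (h₂ : code B K w₂ ∈ A) (n : ℕ) (hl : ∀ p < n, c p % 2 = 1 → l p < σ)
    (hf : ∀ i ≤ n, f (code B K fun h => w₁ h + w₂ h + oddSum v c l i h)) :
    (code B K fun h => w₁ h + w₂ h + oddSum v c l n h) ∈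
      levelFold f (rowCode B K σ v) (fun p => c p % 2 = 1) A n := by
  induction n with
  | zero =>
    refine mem_sumFilter.2 ⟨⟨_, h₁, _, h₂, ?_⟩, hf 0 le_rfl⟩
    simp [oddSum, code_add]
  | succ n ih =>
    have ih := ih (fun p hp => hl p (by omega)) fun i hi => hf i (by omega)
    rw [levelFold]
    split_ifs with hodd
    · refine mem_sumFilter.2 ⟨⟨_, ih, _, Finset.mem_image.2
        ⟨l n, Finset.mem_range.2 (hl n (by omega) hodd), rfl⟩, ?_⟩, hf _ le_rfl⟩
      rw [← code_add]
      refine code_congr fun h _ => ?_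
      rw [oddSum_succ, if_pos hodd, ← add_assoc]
    · convert ih using 3
      rw [oddSum_succ, if_neg hodd, add_zero]

/-- A level restores one binary digit of every count: c / 2^(l-t-1) is twice c / 2^(l-t) plus a
parity. At the start all counts are 0, being below 2^l before the shift, and the only sum is 0.
Nothing is assumed about `f`, so numbers that pass the window test by accident do no harm. -/
theorem levelSet_sound {B K l : ℕ} {f : ℕ → ℕ → Prop} {c : ℕ → ℕ} (hc : ∀ p < P, c p < 2 ^ l)
    (t : ℕ) (ht : t ≤ l) : ∀ x ∈ levelSet f (rowCode B K σ v) c P l t,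
      ∃ w, Reach P σ v (fun p => c p / 2 ^ (l - t)) w ∧ x = code B K w := by
  induction t with
  | zero =>
    intro x hx
    have : x = 0 := by simpa [levelSet] using hx
    refine ⟨0, ⟨0, fun p hp => ⟨?_, by simp⟩, by simp⟩, by simp [this, code]⟩
    simp [Nat.div_eq_of_lt (hc p hp)]
  | succ t ih =>
    intro x hx
    obtain ⟨w₁, w₂, a, h1, h2, h3, rfl⟩ := levelFold_sound
      (c := fun p => c p / 2 ^ (l - 1 - t)) (ih (by omega)) P x hx
    refine ⟨_, ?_, rfl⟩
    rw [show l - (t + 1) = l - 1 - t by omega]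
    have e : ∀ p, c p / 2 ^ (l - t) = c p / 2 ^ (l - 1 - t) / 2 := fun p => by
      rw [Nat.div_div_eq_div_mul, ← pow_succ, show l - 1 - t + 1 = l - t by omega]
    simp only [e] at h1 h2
    exact Reach.combine h1 h2 h3 fun h => rfl

/-! ### Completeness: the halves stay near the halved target -/

/-- `w` is within distance `M` of `t` in the first `K` coordinates. -/
def Near (K M : ℕ) (w t : ℕ → ℕ) : Prop := ∀ h < K, w h ≤ t h + M ∧ t h ≤ w h + M

theorem oddSum_mono {c l : ℕ → ℕ} {i n : ℕ} (hi : i ≤ n) (h : ℕ) :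
    oddSum v c l i h ≤ oddSum v c l n h :=
  Finset.sum_le_sum_of_subset (Finset.range_mono hi)

theorem oddSum_le {c l : ℕ → ℕ} {n : ℕ} (hl : ∀ p < n, c p % 2 = 1 → l p < σ) (h : ℕ) :
    oddSum v c l n h ≤ ∑ p ∈ Finset.range n, ∑ q ∈ Finset.range σ, v p q h := by
  refine Finset.sum_le_sum fun p hp => ?_
  split_ifs with hodd
  · exact Finset.single_le_sum (f := fun q => v p q h) (fun _ _ => Nat.zero_le _)
      (Finset.mem_range.2 (hl p (Finset.mem_range.1 hp) hodd))
  · exact Nat.zero_le _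

/-- The error 1+2S reproduces itself. Twice a half differs from `w` by at most 2S, for the imbalance
and the odd letters, and halving the target rounds by at most one half; altogether the half is off
by at most ((1+2S) + 2S + 1)/2 = 1+2S. A partial sum lacks at most S of `w`, so it is off by at most
1+3S, whence the condition on `M`. -/
theorem levelSet_complete {B K l S M : ℕ} {f : ℕ → ℕ → Prop} {c tgt : ℕ → ℕ}
    (hc : ∀ p < P, c p < 2 ^ l)
    (hS : ∀ h < K, ∑ p ∈ Finset.range P, ∑ q ∈ Finset.range σ, v p q h ≤ S)
    (hM : 1 + 3 * S ≤ M)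
    (hf : ∀ i w, Near K M w (fun h => tgt h / 2 ^ i) → f i (code B K w))
    (t : ℕ) (ht : t ≤ l) (w : ℕ → ℕ) (hw : Reach P σ v (fun p => c p / 2 ^ (l - t)) w)
    (hn : Near K (1 + 2 * S) w fun h => tgt h / 2 ^ (l - t)) :
    code B K w ∈ levelSet f (rowCode B K σ v) c P l t := by
  induction t generalizing w with
  | zero =>
    obtain ⟨μ, h1, h2⟩ := hw
    have : ∀ h, w h = 0 := fun h => by
      rw [h2 h]
      refine Finset.sum_eq_zero fun p hp => ?_
      have := (h1 p (Finset.mem_range.1 hp)).1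
      simp only [Nat.sub_zero, Nat.div_eq_of_lt (hc p (Finset.mem_range.1 hp)),
        Multiset.card_eq_zero] at this
      simp [this]
    simp [levelSet, code, this]
  | succ t ih =>
    rw [show l - (t + 1) = l - 1 - t by omega] at hw hn
    obtain ⟨w₁, w₂, a, h1, h2, h3, h4, h5⟩ := hw.halve
    have e : ∀ x, x / 2 ^ (l - t) = x / 2 ^ (l - 1 - t) / 2 := fun x => by
      rw [Nat.div_div_eq_div_mul, ← pow_succ, show l - 1 - t + 1 = l - t by omega]
    have hodd : ∀ h < K, oddSum v (fun p => c p / 2 ^ (l - 1 - t)) a P h ≤ S := fun h hh =>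
      (oddSum_le h3 h).trans (hS h hh)
    have hw : code B K w = code B K fun h => w₁ h + w₂ h +
        oddSum v (fun p => c p / 2 ^ (l - 1 - t)) a P h := code_congr fun h _ => h4 h
    rw [hw]
    simp only [e] at ih
    refine levelFold_complete (ih (by omega) w₁ h1 fun h hh => ?_)
      (ih (by omega) w₂ h2 fun h hh => ?_) P h3 fun i hi => hf _ _ fun h hh => ?_
    · have a1 := hn h hh
      have a2 := h5 h
      have a3 := hS h hh
      have a4 := h4 h
      have a5 := hodd h hh
      dsimp only at a1 ⊢
      omega
    · have a1 := hn h hh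
      have a2 := h5 h
      have a3 := hS h hh
      have a4 := h4 h
      have a5 := hodd h hh
      dsimp only at a1 ⊢
      omega
    · have a1 := hn h hh
      have a4 := h4 h
      have a5 := hodd h hh
      have a6 := oddSum_mono (v := v) (c := fun p => c p / 2 ^ (l - 1 - t)) (l := a) hi h
      dsimp only at a1 ⊢
      omega

/-! ### The window -/

/-- The codes of the vectors with all coordinates at most `2 * M`. -/
def windowCodes (B M : ℕ) : ℕ → Finset ℕ
  | 0 => {0}
  | h + 1 => Finset.image₂ (· + ·) (windowCodes B M h)
      ((Finset.range (2 * M + 1)).image fun e => B ^ h * e)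

theorem card_windowCodes (B M K : ℕ) : (windowCodes B M K).card ≤ (2 * M + 1) ^ K := by
  induction K with
  | zero => simp [windowCodes]
  | succ K ih =>
    refine (Finset.card_image₂_le _ _ _).trans ?_
    rw [pow_succ]
    exact Nat.mul_le_mul ih (Finset.card_image_le.trans (by simp))

theorem code_mem_windowCodes {B M K : ℕ} {e : ℕ → ℕ} (he : ∀ h < K, e h ≤ 2 * M) :
    code B K e ∈ windowCodes B M K := by
  induction K with
  | zero => simp [windowCodes, code]
  | succ K ih =>
    rw [code_succ]
    refine Finset.mem_image₂.2 ⟨_, ih fun h hh => he h (by omega), _, Finset.mem_image.2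
      ⟨e K, ?_, rfl⟩, by simp [mul_comm]⟩
    have := he K (by omega)
    simp only [Finset.mem_range]
    omega

/-- The number `x` lies in the window with centre `cen`. -/
def InWindow (B K M cen x : ℕ) : Prop :=
  ∃ e ∈ windowCodes B M K, x + code B K (fun _ => M) = cen + e

/-- The differences `w - t` are shifted by `M` in every coordinate to become digits between 0 and
2M. The converse is not needed and may fail, since different vectors can share a code. -/
theorem inWindow_of_near {B K M : ℕ} {w t : ℕ → ℕ} (h : Near K M w t) :
    InWindow B K M (code B K t) (code B K w) := by
  refine ⟨code B K fun h => w h + M - t h, code_mem_windowCodes fun i hi => ?_, ?_⟩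
  · have := h i hi
    omega
  · rw [← code_add, ← code_add]
    refine code_congr fun i hi => ?_
    have := h i hi
    omega

/-- A number in the window is determined by its offset `e`. The bound thus covers all numbers that
pass the test, whether or not they code a vector near the centre. -/
theorem card_le_of_inWindow {B K M cen : ℕ} {A : Finset ℕ} (h : ∀ x ∈ A, InWindow B K M cen x) :
    A.card ≤ (2 * M + 1) ^ K := by
  refine le_trans ?_ (card_windowCodes B M K)
  refine Finset.card_le_card_of_injOn (fun x => x + code B K (fun _ => M) - cen) ?_ ?_
  · intro x hx
    obtain ⟨e, he, h'⟩ := h x hx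
    have : x + code B K (fun _ => M) - cen = e := by omega
    simpa [this] using he
  · intro x hx y hy hxy
    obtain ⟨e, -, h1⟩ := h x hx
    obtain ⟨e', -, h2⟩ := h y hy
    simp only at hxy
    omega

/-- The test carried out by the algorithm decides membership in `Reach`. -/
theorem code_mem_levelSet_iff {B K l S M : ℕ} {c tgt : ℕ → ℕ} (hc : ∀ p < P, c p < 2 ^ l)
    (hS : ∀ h < K, ∑ p ∈ Finset.range P, ∑ q ∈ Finset.range σ, v p q h ≤ S)
    (hM : 1 + 3 * S ≤ M) (ht : ∀ h < K, tgt h < B)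
    (hB : ∀ w, Reach P σ v c w → ∀ h < K, w h < B) :
    code B K tgt ∈ levelSet (fun i => InWindow B K M (code B K fun h => tgt h / 2 ^ i))
      (rowCode B K σ v) c P l l ↔ ∃ w, Reach P σ v c w ∧ ∀ h < K, w h = tgt h := by
  constructor
  · intro hx
    obtain ⟨w, h1, h2⟩ := levelSet_sound hc l le_rfl _ hx
    simp only [Nat.sub_self, pow_zero, Nat.div_one] at h1
    -- After all levels the counts are the full ones, whose sums have coordinates below `B`. This is
    -- the only place where a code has to determine its vector.
    exact ⟨w, h1, code_injective (hB w h1) ht h2.symm⟩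
  · rintro ⟨w, h1, h2⟩
    rw [← code_congr h2]
    refine levelSet_complete hc hS hM (fun i w hw => inWindow_of_near hw) l le_rfl w
      (by simpa using h1) fun h hh => ?_
    simp [h2 h hh]

theorem card_levelFold_le {B K M : ℕ} {cen : ℕ} {row : ℕ → Finset ℕ} {odd : ℕ → Prop}
    {A : Finset ℕ} (n : ℕ) :
    (levelFold (InWindow B K M cen) row odd A n).card ≤ (2 * M + 1) ^ K :=
  card_le_of_inWindow (levelFold_filter n)

theorem card_levelSet_le {B K M l : ℕ} {cen : ℕ → ℕ} {row : ℕ → Finset ℕ} {c : ℕ → ℕ} (t : ℕ) :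
    (levelSet (fun i => InWindow B K M (cen i)) row c P l t).card ≤ (2 * M + 1) ^ K := by
  cases t with
  | zero => simpa [levelSet] using Nat.one_le_pow _ _ (by omega)
  | succ t => exact card_levelFold_le P

/-! ### Items with types -/

/-- The letters in the multiset of a type are handed out to the items of that type, one item at a
time. With `g` quantified last, a single assignment serves all coordinates. -/
theorem exists_letters (T : ℕ) (ty : ℕ → ℕ) (L : ℕ) (hty : ∀ j < L, ty j < T)
    (μ : ℕ → Multiset ℕ)
    (hμ : ∀ p < T, (μ p).card = ((Finset.range L).filter (ty · = p)).card ∧ ∀ q ∈ μ p, q < σ) :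
    ∃ y : ℕ → ℕ, (∀ j < L, y j < σ) ∧ ∀ g : ℕ → ℕ → ℕ,
      ∑ p ∈ Finset.range T, ((μ p).map (g p)).sum = ∑ j ∈ Finset.range L, g (ty j) (y j) := by
  induction L generalizing μ with
  | zero =>
    refine ⟨0, by simp, fun g => ?_⟩
    simp only [Finset.range_zero, Finset.sum_empty]
    refine Finset.sum_eq_zero fun p hp => ?_
    have : μ p = 0 := by simpa using (hμ p (Finset.mem_range.1 hp)).1
    simp [this]
  | succ L ih =>
    have hT := hty L (by omega)
    have hcard : ∀ p, ((Finset.range (L + 1)).filter (ty · = p)).card =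
        ((Finset.range L).filter (ty · = p)).card + if ty L = p then 1 else 0 := by
      intro p
      rw [Finset.range_add_one, Finset.filter_insert]
      split_ifs with h
      · rw [Finset.card_insert_of_notMem (by simp)]
      · simp
    obtain ⟨q, hq⟩ := Multiset.card_pos_iff_exists_mem.1
      (show 0 < (μ (ty L)).card by rw [(hμ _ hT).1, hcard, if_pos rfl]; omega)
    obtain ⟨t, ht⟩ := Multiset.exists_cons_of_mem hq
    obtain ⟨y, h1, h2⟩ := ih (fun j hj => hty j (by omega)) (Function.update μ (ty L) t) (by
      intro p hp
      by_cases hpL : p = ty L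
      · subst hpL
        have := hμ _ hp
        rw [hcard, if_pos rfl, ht, Multiset.card_cons] at this
        simp only [Function.update_self]
        exact ⟨by omega, fun q hq => this.2 q (by simp [hq])⟩
      · have := hμ p hp
        rw [hcard, if_neg (Ne.symm hpL)] at this
        rw [Function.update_of_ne hpL]
        simpa using this)
    refine ⟨Function.update y L q, fun j hj => ?_, fun g => ?_⟩
    · rcases Nat.lt_succ_iff_lt_or_eq.1 hj with hj | rfl
      · rw [Function.update_of_ne (by omega)]
        exact h1 j hj
      · simpa using (hμ _ hT).2 q hq
    · rw [Finset.sum_range_succ, Function.update_self]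
      have e : ∑ j ∈ Finset.range L, g (ty j) (Function.update y L q j) =
          ∑ j ∈ Finset.range L, g (ty j) (y j) := Finset.sum_congr rfl fun j hj => by
        rw [Function.update_of_ne (Finset.mem_range.1 hj).ne]
      rw [e, ← h2 g, ← Finset.add_sum_erase _ _ (Finset.mem_range.2 hT),
        ← Finset.add_sum_erase (Finset.range T)
          (fun p => (Multiset.map (g p) (Function.update μ (ty L) t p)).sum)
          (Finset.mem_range.2 hT)]
      have e2 : ∑ p ∈ (Finset.range T).erase (ty L),
          (Multiset.map (g p) (Function.update μ (ty L) t p)).sum =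
          ∑ p ∈ (Finset.range T).erase (ty L), (Multiset.map (g p) (μ p)).sum :=
        Finset.sum_congr rfl fun p hp => by
          rw [Function.update_of_ne (Finset.ne_of_mem_erase hp)]
      rw [e2, Function.update_self, ht, Multiset.map_cons, Multiset.sum_cons]
      omega

theorem exists_multisets (T : ℕ) (ty : ℕ → ℕ) (L : ℕ) (hty : ∀ j < L, ty j < T) (y : ℕ → ℕ)
    (hy : ∀ j < L, y j < σ) : ∃ μ : ℕ → Multiset ℕ,
    (∀ p < T, (μ p).card = ((Finset.range L).filter (ty · = p)).card ∧ ∀ q ∈ μ p, q < σ) ∧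
    ∀ g : ℕ → ℕ → ℕ,
      ∑ p ∈ Finset.range T, ((μ p).map (g p)).sum = ∑ j ∈ Finset.range L, g (ty j) (y j) := by
  refine ⟨fun p => ((Finset.range L).filter (ty · = p)).val.map y, fun p _ => ⟨Multiset.card_map _ _, ?_⟩,
    fun g => ?_⟩
  · intro q hq
    obtain ⟨j, hj, rfl⟩ := Multiset.mem_map.1 hq
    simp at hj
    exact hy j hj.1
  · rw [← Finset.sum_fiberwise_of_maps_to (s := Finset.range L) (t := Finset.range T) (g := ty)
      (by simpa using hty)]
    refine Finset.sum_congr rfl fun p _ => ?_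
    rw [Multiset.map_map]
    refine Finset.sum_congr rfl fun j hj => ?_
    simp [(Finset.mem_filter.1 hj).2]

/-- Reachable vectors in terms of items `j < L` of type `ty j` and of slacks: the type `T + i` has
the letter `0`, coding the zero vector, and letters coding the unit vector `i`. -/
theorem reach_iff_items {T k L : ℕ} {ty U w : ℕ → ℕ} {c : ℕ → ℕ} (hσ : 2 ≤ σ)
    (hty : ∀ j < L, ty j < T) (hc : ∀ p < T, c p = ((Finset.range L).filter (ty · = p)).card)
    (hU : ∀ i < k, c (T + i) = U i)
    (hv : ∀ i < k, ∀ q h, v (T + i) q h = if q ≠ 0 ∧ h = i then 1 else 0) :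
    Reach (T + k) σ v c w ↔ ∃ y u : ℕ → ℕ, (∀ j < L, y j < σ) ∧ (∀ i < k, u i ≤ U i) ∧
      ∀ h, w h = ∑ j ∈ Finset.range L, v (ty j) (y j) h + if h < k then u h else 0 := by
  have hslack : ∀ (u : ℕ → ℕ) h, (∑ i ∈ Finset.range k, if h = i then u i else 0) =
      if h < k then u h else 0 := fun u h => by simp
  constructor
  · rintro ⟨μ, h1, h2⟩
    obtain ⟨y, hy, hg⟩ := exists_letters (σ := σ) T ty L hty μ fun p hp => by
      rw [← hc p hp]; exact h1 p (by omega)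
    -- All letters other than 0 give the same unit vector, so the slack is the number of nonzero
    -- letters.
    refine ⟨y, fun i => (μ (T + i)).countP (· ≠ 0), hy, fun i hi => ?_, fun h => ?_⟩
    · rw [← hU i hi, ← (h1 (T + i) (by omega)).1]
      exact Multiset.countP_le_card _ _
    · rw [h2 h, Finset.sum_range_add, hg fun p q => v p q h]
      refine Eq.trans ?_ (congrArg _ (hslack (fun i => (μ (T + i)).countP (· ≠ 0)) h))
      congr 1
      refine Finset.sum_congr rfl fun i hi => ?_
      have : ∀ q, v (T + i) q h = if q ≠ 0 ∧ h = i then 1 else 0 := fun q =>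
        hv i (Finset.mem_range.1 hi) q h
      simp only [this]
      by_cases hh : h = i
      · simp only [hh, and_true, if_true]
        generalize μ (T + i) = ν
        induction ν using Multiset.induction_on with
        | empty => simp
        | cons a s ih =>
          rw [Multiset.map_cons, Multiset.sum_cons, ih, Multiset.countP_cons, add_comm]
      · simp [hh]
  · rintro ⟨y, u, hy, hu, hw⟩
    obtain ⟨μ, h1, h2⟩ := exists_multisets (σ := σ) T ty L hty y hy
    -- A slack u out of U is realized by u letters 1 and U - u letters 0; both letters exist because
    -- σ is at least 2.
    refine ⟨fun p => if p < T then μ p else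
      Multiset.replicate (u (p - T)) 1 + Multiset.replicate (U (p - T) - u (p - T)) 0,
      fun p hp => ?_, fun h => ?_⟩
    · by_cases hpT : p < T
      · simp only [if_pos hpT, hc p hpT]
        exact h1 p hpT
      · obtain ⟨i, rfl⟩ : ∃ i, p = T + i := ⟨p - T, by omega⟩
        have := hu i (by omega)
        simp only [if_neg hpT, Nat.add_sub_cancel_left, hU i (by omega), Multiset.card_add,
          Multiset.card_replicate, Multiset.mem_add, Multiset.mem_replicate]
        exact ⟨by omega, fun q hq => by omega⟩
    · rw [hw h, Finset.sum_range_add, ← h2 fun p q => v p q h, ← hslack]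
      congr 1
      · exact Finset.sum_congr rfl fun p hp => by simp only [if_pos (Finset.mem_range.1 hp)]
      · refine Finset.sum_congr rfl fun i hi => ?_
        have : ∀ q, v (T + i) q h = if q ≠ 0 ∧ h = i then 1 else 0 := fun q =>
          hv i (Finset.mem_range.1 hi) q h
        simp [this]

end LetterSum


/-! ## Subprograms -/

namespace RAM

open Cmd LetterSum

/-- Multiplication: register `30` becomes the product of registers `31` and `32`. -/
def mulCmd : Cmd := set 30 0 ;; rep 33 (reg 32) (set 30 (reg 30 + reg 31))

theorem ensures_mulCmd {N : ℕ} {m : Mem} {Q : Mem → Prop} (hN : m 32 0 ≤ N)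
    (h : ∀ m', Frame [30, 33] m m' → m' 30 0 = m 31 0 * m 32 0 → Q m') :
    Ensures N mulCmd m Q := by
  refine ensures_set_seq ?_
  refine ensures_rep (m 32 0) (fun i m' => Frame [30, 33] m m' ∧ m' 30 0 = m 31 0 * i) (by simp)
    hN ?_ ?_ ?_
  · refine ⟨?_, by simp⟩
    exact (((Frame.refl _ m).write (by decide)).write (by decide)).write (by decide)
  · rintro i hi m' ⟨hF, h1⟩ h2 h3
    refine ensures_set ⟨by simpa using h2, by simpa using h3, ?_, ?_⟩
    · exact (hF.write (by decide)).write (by decide)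
    · simp [h1, hF 31 (by decide), Nat.mul_succ]
  · rintro m' ⟨hF, h1⟩ -
    exact h m' hF h1

/-! ### Lists without repetitions and filtered sumsets -/

/-- The finite set `A` is listed without repetitions in bank `b`, its size is in register `r`. -/
def Listed (b r : ℕ) (A : Finset ℕ) (m : Mem) : Prop :=
  m r 0 = A.card ∧ (Finset.range A.card).image (m b) = A

/-- Append the value of register `86` to the list in bank `80` unless it is already there. -/
def appendCmd : Cmd :=
  ite (reg 83 - cell 82 (reg 86))
    (store 82 (reg 86) (reg 83) ;; store 80 (reg 81) (reg 86) ;; set 81 (reg 81 + 1)) skip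

/-- The list in bank `80` holds the set `X`, and bank `82` marks its members with the current
stamp `s`, which is kept in register `83`. -/
def Stamped (s : ℕ) (X : Finset ℕ) (m : Mem) : Prop :=
  m 83 0 = s ∧ (∀ x, m 82 x ≤ s) ∧ (∀ x, m 82 x = s ↔ x ∈ X) ∧ Listed 80 81 X m

/-- No mark exceeds the stamp, so the truncated difference of stamp and mark vanishes exactly for
members of the list. -/
theorem ensures_appendCmd {N s : ℕ} {X : Finset ℕ} {m : Mem} (h : Stamped s X m) :
    Ensures N appendCmd m fun m' =>
      Frame [80, 81, 82] m m' ∧ Stamped s (insert (m 86 0) X) m' := by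
  obtain ⟨h1, h2, h3, h4, h5⟩ := h
  refine ensures_ite (fun he => ?_) fun he => ?_
  · have hx : m 86 0 ∉ X := fun hx => by
      have := (h3 (m 86 0)).2 hx
      simp [this, h1] at he
    refine ensures_store_seq (ensures_store_seq (ensures_set ⟨?_, ?_⟩))
    · exact (((Frame.refl _ m).write (by decide)).write (by decide)).write (by decide)
    · refine ⟨by simpa using h1, fun x => ?_, fun x => ?_, ?_, ?_⟩
      · simp only [Mem.write_apply]
        by_cases hxx : x = m 86 0 <;> simp [hxx, h1, h2]
      · simp only [Mem.write_apply]
        by_cases hxx : x = m 86 0 <;> simp [hxx, h1, h3]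
      · simp [h4, hx]
      · rw [Finset.card_insert_of_notMem hx, Finset.range_add_one, Finset.image_insert]
        have e : (Finset.range X.card).image (Function.update (m 80) X.card (m 86 0)) = X := by
          refine Eq.trans (Finset.image_congr fun i hi => ?_) h5
          rw [Function.update_of_ne]
          simp at hi
          omega
        simp [h4, e]
  · have hx : m 86 0 ∈ X := by
      refine (h3 _).1 (le_antisymm (h2 _) ?_)
      simp only [eval_sub, eval_reg, eval_cell] at he
      omega
    refine ensures_skip ⟨Frame.refl _ _, ?_⟩
    rw [Finset.insert_eq_of_mem hx]
    exact ⟨h1, h2, h3, h4, h5⟩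

/-- Replace the list in bank `70` by the list of its sums with the numbers in bank `73` that pass
the test of the window. -/
def sumsetCmd : Cmd :=
  set 83 (reg 83 + 1) ;; set 81 0 ;;
  rep 84 (reg 71) (rep 85 (reg 74) (
    set 86 (cell 70 (reg 84) + cell 73 (reg 85)) ;;
    ite (cell 76 (reg 86 + reg 77 - reg 78) + reg 79) appendCmd skip)) ;;
  rep 84 (reg 81) (store 70 (reg 84) (cell 80 (reg 84))) ;; set 71 (reg 81)

theorem sumFilter_insert_left {f : ℕ → Prop} (a : ℕ) (A A' : Finset ℕ) :
    sumFilter f (insert a A) A' = sumFilter f A A' ∪ sumFilter f {a} A' := by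
  ext x
  simp only [mem_sumFilter, Finset.mem_union, Finset.mem_insert, Finset.mem_singleton]
  constructor
  · rintro ⟨⟨c, rfl | hc, b, hb, rfl⟩, hx⟩
    · exact Or.inr ⟨⟨c, rfl, b, hb, rfl⟩, hx⟩
    · exact Or.inl ⟨⟨c, hc, b, hb, rfl⟩, hx⟩
  · rintro (⟨⟨c, hc, b, hb, rfl⟩, hx⟩ | ⟨⟨c, rfl, b, hb, rfl⟩, hx⟩)
    · exact ⟨⟨c, Or.inr hc, b, hb, rfl⟩, hx⟩
    · exact ⟨⟨c, Or.inl rfl, b, hb, rfl⟩, hx⟩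

theorem sumFilter_singleton_insert_of_pos {f : ℕ → Prop} {a b : ℕ} (A' : Finset ℕ)
    (h : f (a + b)) : sumFilter f {a} (insert b A') = insert (a + b) (sumFilter f {a} A') := by
  ext x
  simp only [mem_sumFilter, Finset.mem_insert, Finset.mem_singleton]
  constructor
  · rintro ⟨⟨c, rfl, d, rfl | hd, rfl⟩, hx⟩
    · exact Or.inl rfl
    · exact Or.inr ⟨⟨c, rfl, d, hd, rfl⟩, hx⟩
  · rintro (rfl | ⟨⟨c, rfl, d, hd, rfl⟩, hx⟩)
    · exact ⟨⟨a, rfl, b, Or.inl rfl, rfl⟩, h⟩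
    · exact ⟨⟨c, rfl, d, Or.inr hd, rfl⟩, hx⟩

theorem sumFilter_singleton_insert_of_neg {f : ℕ → Prop} {a b : ℕ} (A' : Finset ℕ)
    (h : ¬ f (a + b)) : sumFilter f {a} (insert b A') = sumFilter f {a} A' := by
  ext x
  simp only [mem_sumFilter, Finset.mem_insert, Finset.mem_singleton]
  constructor
  · rintro ⟨⟨c, rfl, d, rfl | hd, rfl⟩, hx⟩
    · exact absurd hx h
    · exact ⟨⟨c, rfl, d, hd, rfl⟩, hx⟩
  · rintro ⟨⟨c, rfl, d, hd, rfl⟩, hx⟩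
    exact ⟨⟨c, rfl, d, Or.inr hd, rfl⟩, hx⟩

/-- The banks changed by `sumsetCmd`. -/
abbrev sumsetBanks : List ℕ := [70, 71, 80, 81, 82, 83, 84, 85, 86]

theorem image_range_succ (g : ℕ → ℕ) (n : ℕ) :
    (Finset.range (n + 1)).image g = insert (g n) ((Finset.range n).image g) := by
  rw [Finset.range_add_one, Finset.image_insert]

/-- Raising the stamp by one makes all earlier marks invalid, so bank 82, which is addressed by
whole codes, never has to be cleared. The second summand is only the image of a list, because
different letters may contribute the same vector. -/
theorem ensures_sumsetCmd {N : ℕ} {m : Mem} {Q : Mem → Prop} {f : ℕ → Prop} {A A' : Finset ℕ}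
    (hf : ∀ x, f x ↔ m 76 (x + m 77 0 - m 78 0) + m 79 0 ≠ 0)
    (hA : Listed 70 71 A m) (hA' : (Finset.range (m 74 0)).image (m 73) = A')
    (hs : ∀ x, m 82 x ≤ m 83 0) (hN : A.card ≤ N) (hN' : m 74 0 ≤ N)
    (hN'' : (sumFilter f A A').card ≤ N)
    (h : ∀ m', Frame sumsetBanks m m' → Listed 70 71 (sumFilter f A A') m' →
      (∀ x, m' 82 x ≤ m' 83 0) → Q m') :
    Ensures N sumsetCmd m Q := by
  obtain ⟨hA1, hA2⟩ := hA
  set s := m 83 0 + 1 with hsdef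
  refine ensures_set_seq (ensures_set_seq ?_)
  refine Ensures.seq (R := fun m' => Frame [80, 81, 82, 83, 84, 85, 86] m m' ∧
    Stamped s (sumFilter f A A') m') ?_ ?_
  · refine ensures_rep A.card (fun i m' => Frame [80, 81, 82, 83, 84, 85, 86] m m' ∧
      Stamped s (sumFilter f ((Finset.range i).image (m 70)) A') m') (by simp [hA1]) hN ?_ ?_ ?_
    · refine ⟨((((Frame.refl _ m).write (by decide)).write (by decide)).write (by decide)).write
        (by decide), by simp [hsdef], fun x => ?_, fun x => ?_, ?_⟩
      · have := hs x
        simp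
        omega
      · have := hs x
        simp [mem_sumFilter]
        omega
      · simp [Listed, sumFilter]
    · rintro i hi m₁ ⟨hF, hS⟩ h84 h84'
      refine ensures_rep (m 74 0) (fun j m' => Frame [80, 81, 82, 83, 84, 85, 86] m m' ∧
        m' 84 = m₁ 84 ∧ Stamped s (sumFilter f ((Finset.range i).image (m 70)) A' ∪
          sumFilter f {m 70 i} ((Finset.range j).image (m 73))) m')
        (by simp [hF 74 (by decide)]) hN' ?_ ?_ ?_
      · refine ⟨(hF.write (by decide)).write (by decide), by simp, ?_⟩
        simpa [Stamped, Listed, sumFilter] using hS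
      · rintro j hj m₂ ⟨hF₂, h84₂, hS₂⟩ h85 h85'
        refine ensures_set_seq ?_
        set m₃ := m₂.write 86 0 ((cell 70 (reg 84) + cell 73 (reg 85)).eval m₂) with hm₃
        have hF₃ : Frame [80, 81, 82, 83, 84, 85, 86] m m₃ := hF₂.write (by decide)
        have h86 : m₃ 86 0 = m 70 i + m 73 j := by
          simp [hm₃, h84₂, h84, h85, hF₂ 70 (by decide), hF₂ 73 (by decide)]
        have hS₃ : Stamped s (sumFilter f ((Finset.range i).image (m 70)) A' ∪
            sumFilter f {m 70 i} ((Finset.range j).image (m 73))) m₃ := by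
          simpa [Stamped, Listed, hm₃] using hS₂
        have hev : (cell 76 (reg 86 + reg 77 - reg 78) + reg 79).eval m₃ ≠ 0 ↔
            f (m 70 i + m 73 j) := by
          rw [hf, eval_add, eval_cell, eval_sub, eval_add, eval_reg, eval_reg, eval_reg, eval_reg,
            h86, hF₃ 76 (by decide), hF₃ 77 (by decide), hF₃ 78 (by decide), hF₃ 79 (by decide)]
        refine ensures_ite (fun he => ?_) fun he => ?_
        · refine (ensures_appendCmd hS₃).mono ?_
          rintro m₄ ⟨hF₄, hS₄⟩
          refine ⟨?_, ?_, ?_, ?_, ?_⟩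
          · rw [hF₄ 85 (by decide)]; simpa [hm₃] using h85
          · rw [hF₄ 85 (by decide)]; simpa [hm₃] using h85'
          · exact (hF₃.trans hF₄ (by decide)).write (by decide)
          · simp [hF₄ 84 (by decide), hm₃, h84₂]
          · rw [h86] at hS₄
            rw [image_range_succ, sumFilter_singleton_insert_of_pos _ (hev.1 he),
              Finset.union_insert]
            simpa [Stamped, Listed] using hS₄
        · refine ensures_skip ⟨?_, ?_, ?_, ?_, ?_⟩
          · simpa [hm₃] using h85
          · simpa [hm₃] using h85'
          · exact hF₃.write (by decide)
          · simp [hm₃, h84₂]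
          · rw [image_range_succ, sumFilter_singleton_insert_of_neg _ fun h => hev.2 h he]
            simpa [Stamped, Listed] using hS₃
      · rintro m₂ ⟨hF₂, h84₂, hS₂⟩ -
        rw [hA', ← sumFilter_insert_left, ← image_range_succ] at hS₂
        refine ⟨by rw [h84₂, h84], by rw [h84₂, h84'], hF₂.write (by decide), ?_⟩
        simpa [Stamped, Listed] using hS₂
    · rintro m₁ ⟨hF, hS⟩ -
      rw [hA2] at hS
      exact ⟨hF, hS⟩
  · rintro m₁ ⟨hF, hS1, hS2, -, hS3, hS4⟩
    refine Ensures.seq (R := fun m' => Frame [70, 84] m₁ m' ∧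
      ∀ i < (sumFilter f A A').card, m' 70 i = m₁ 80 i) ?_ ?_
    · refine ensures_rep (sumFilter f A A').card (fun i m' => Frame [70, 84] m₁ m' ∧
        ∀ i' < i, m' 70 i' = m₁ 80 i') (by simp [hS3]) hN'' ?_ ?_ ?_
      · exact ⟨((Frame.refl _ m₁).write (by decide)).write (by decide), by simp⟩
      · rintro i hi m₂ ⟨hF₂, h₂⟩ h84 h84'
        refine ensures_store ⟨by simp [h84], by simp [h84'],
          (hF₂.write (by decide)).write (by decide), fun i' hi' => ?_⟩
        rcases Nat.lt_succ_iff_lt_or_eq.1 hi' with hi' | rfl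
        · have : i' ≠ m₂ 84 0 := by omega
          simp [this, h₂ i' hi']
        · simp [h84, hF₂ 80 (by decide)]
      · rintro m₂ h₂ -
        exact h₂
    · rintro m₂ ⟨hF₂, h₂⟩
      refine ensures_set (h _ ?_ ⟨?_, ?_⟩ ?_)
      · exact ((hF.mono (by decide)).trans hF₂ (by decide)).write (by decide)
      · simp [hF₂ 81 (by decide), hS3]
      · have : ∀ B : Finset ℕ, (Finset.range B.card).image (m₁ 80) = B →
            (∀ i < B.card, m₂ 70 i = m₁ 80 i) → (Finset.range B.card).image (m₂ 70) = B := by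
          intro B hB hB'
          refine Eq.trans (Finset.image_congr fun i hi => hB' i ?_) hB
          simpa using hi
        simpa using this _ hS4 h₂
      · simpa [hF₂ 82 (by decide), hF₂ 83 (by decide), hS1] using hS2

end RAM


/-! ## The decision procedure -/

namespace RAM

open Cmd LetterSum

theorem eval_lit (m : Mem) (n : ℕ) : (Expr.lit n).eval m = n := rfl

attribute [simp] eval_lit

/-- The number of strings. -/
abbrev kE : Expr := reg 0

/-- The length of the strings. -/
abbrev lenE : Expr := cell 0 1

/-- The size of the alphabet. -/
abbrev sigE : Expr := cell 0 (.lit 2)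

/-- Limits for the loops. -/
structure Limits (N k L σ B T M : ℕ) : Prop where
  k_le : k + 1 ≤ N
  L_le : L ≤ N
  σ_le : σ ≤ N
  B_le : B ≤ N
  T_le : T + k ≤ N
  W_le : (2 * M + 1) ^ (k + 1) ≤ N

/-- The tables used by the decision procedure: powers of `B` in bank `44`, halves in bank `48`, the
codes of the vectors `v p q` in bank `62`, and the window in banks `76` and `77`. -/
structure Env (k L σ B T M : ℕ) (v : ℕ → ℕ → ℕ → ℕ) (m : Mem) : Prop where
  k_eq : m 0 0 = k
  L_eq : m 0 1 = L
  σ_eq : m 0 2 = σ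
  B_eq : m 43 0 = B
  P_eq : m 68 0 = T + k
  T_eq : m 92 0 = T
  pow : ∀ h ≤ k, m 44 h = B ^ h
  half : ∀ a ≤ B, m 48 a = a / 2
  row : ∀ p < T + k, ∀ q < σ, m 62 (p * σ + q) = code B (k + 1) (v p q)
  win : ∀ a, m 76 a ≠ 0 ↔ ∃ e ∈ windowCodes B M (k + 1), a = e + 1
  off : m 77 0 = code B (k + 1) (fun _ => M) + 1
  flt : m 79 0 = 0

theorem Env.frame {k L σ B T M : ℕ} {v : ℕ → ℕ → ℕ → ℕ} {m m' : Mem} (h : Env k L σ B T M v m)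
    {S : List ℕ} (hF : Frame S m m')
    (hS : ∀ b ∈ [0, 43, 68, 92, 44, 48, 62, 76, 77, 79], b ∉ S) : Env k L σ B T M v m' := by
  have e : ∀ b ∈ [0, 43, 68, 92, 44, 48, 62, 76, 77, 79], m' b = m b := fun b hb => hF b (hS b hb)
  constructor
  · rw [e 0 (by decide)]; exact h.k_eq
  · rw [e 0 (by decide)]; exact h.L_eq
  · rw [e 0 (by decide)]; exact h.σ_eq
  · rw [e 43 (by decide)]; exact h.B_eq
  · rw [e 68 (by decide)]; exact h.P_eq
  · rw [e 92 (by decide)]; exact h.T_eq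
  · rw [e 44 (by decide)]; exact h.pow
  · rw [e 48 (by decide)]; exact h.half
  · rw [e 62 (by decide)]; exact h.row
  · rw [e 76 (by decide)]; exact h.win
  · rw [e 77 (by decide)]; exact h.off
  · rw [e 79 (by decide)]; exact h.flt

/-- Halve register `95` as often as register `93` says. -/
def shiftCmd : Cmd := rep 96 (reg 93) (set 95 (cell 48 (reg 95)))

variable {N k L σ B T M : ℕ} {v : ℕ → ℕ → ℕ → ℕ} {m : Mem} {Q : Mem → Prop}

theorem ensures_shiftCmd (hh : ∀ a ≤ B, m 48 a = a / 2) (hB : m 95 0 ≤ B) (hN : m 93 0 ≤ N)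
    (h : ∀ m', Frame [95, 96] m m' → m' 95 0 = m 95 0 / 2 ^ m 93 0 → Q m') :
    Ensures N shiftCmd m Q := by
  refine ensures_rep (m 93 0) (fun i m' => Frame [95, 96] m m' ∧ m' 95 0 = m 95 0 / 2 ^ i)
    (by simp) hN ?_ ?_ ?_
  · exact ⟨((Frame.refl _ m).write (by decide)).write (by decide), by simp⟩
  · rintro i hi m' ⟨hF, h1⟩ h2 h3
    refine ensures_set ⟨by simpa using h2, by simpa using h3,
      (hF.write (by decide)).write (by decide), ?_⟩
    have : m 95 0 / 2 ^ i ≤ B := (Nat.div_le_self _ _).trans hB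
    simp [h1, hF 48 (by decide), hh _ this, Nat.div_div_eq_div_mul, pow_succ]
  · rintro m' ⟨hF, h1⟩ -
    exact h m' hF h1

/-- Compute the centre of the window. -/
def centreCmd : Cmd :=
  set 78 0 ;; rep 45 (kE + 1) (
    set 95 (cell 50 (reg 45)) ;; shiftCmd ;; set 31 (cell 44 (reg 45)) ;; set 32 (reg 95) ;;
    mulCmd ;; set 78 (reg 78 + reg 30))

/-- The centre is assembled anew from the shifted digits: the code of the halved target is in
general not half of the code. -/
theorem ensures_centreCmd (hE : Env k L σ B T M v m) (hL : Limits N k L σ B T M)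
    {tgt : ℕ → ℕ} (ht : ∀ h ≤ k, m 50 h = tgt h) (htB : ∀ h ≤ k, tgt h < B) (hi : m 93 0 ≤ N)
    (h : ∀ m', Frame [30, 31, 32, 33, 45, 78, 95, 96] m m' →
      m' 78 0 = code B (k + 1) (fun h => tgt h / 2 ^ m 93 0) → Q m') :
    Ensures N centreCmd m Q := by
  refine ensures_set_seq ?_
  refine ensures_rep (k + 1) (fun i m' => Frame [30, 31, 32, 33, 45, 78, 95, 96] m m' ∧
    m' 78 0 = code B i (fun h => tgt h / 2 ^ m 93 0)) (by simp [hE.k_eq]) hL.k_le ?_ ?_ ?_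
  · exact ⟨(((Frame.refl _ m).write (by decide)).write (by decide)).write (by decide),
      by simp [code]⟩
  · rintro i hi' m₁ ⟨hF, h1⟩ h2 h3
    refine ensures_set_seq ?_
    have hev : (cell 50 (reg 45)).eval m₁ = tgt i := by
      simp [h2, hF 50 (by decide), ht i (by omega)]
    rw [hev]
    refine ensures_seq (ensures_shiftCmd (B := B) ?_ ?_ ?_ ?_)
    · simpa [hF 48 (by decide)] using hE.half
    · simpa using (htB i (by omega)).le
    · simpa [hF 93 (by decide)] using hi
    · intro m₂ hF₂ h4
      refine ensures_set_seq (ensures_set_seq (ensures_seq (ensures_mulCmd ?_ ?_)))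
      · have := htB i (by omega)
        have h5 := hL.B_le
        have h6 := Nat.div_le_self (tgt i) (2 ^ m₁ 93 0)
        simp [h4]
        omega
      · intro m₃ hF₃ h5
        have hF' : Frame [30, 31, 32, 33, 45, 78, 95, 96] m m₃ :=
          ((((hF.write (by decide)).trans hF₂ (by decide)).write (by decide)).write
            (by decide)).trans hF₃ (by decide)
        refine ensures_set ⟨?_, ?_, (hF'.write (by decide)).write (by decide), ?_⟩
        · simp [hF₃ 45 (by decide), hF₂ 45 (by decide), h2]
        · simp [hF₃ 45 (by decide), hF₂ 45 (by decide), h3]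
        · simp [hF₃ 78 (by decide), hF₂ 78 (by decide), h5, h4, h1, code_succ,
            hF₂ 45 (by decide), hF₂ 44 (by decide), h2, hF 44 (by decide), hF 93 (by decide),
            hE.pow i (by omega), mul_comm]
  · rintro m' ⟨hF, h1⟩ -
    exact h m' hF h1

/-- Add the numbers in bank `62` from the address in register `97` on to the listed numbers. -/
def addRowCmd : Cmd :=
  set 74 sigE ;; rep 45 sigE (store 73 (reg 45) (cell 62 (reg 97 + reg 45))) ;; sumsetCmd

/-- Add the listed numbers to themselves. -/
def doubleCmd : Cmd :=
  set 74 (reg 71) ;; rep 45 (reg 71) (store 73 (reg 45) (cell 70 (reg 45))) ;; sumsetCmd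

/-- The banks changed by `addRowCmd` and `doubleCmd`. -/
abbrev rowBanks : List ℕ := [45, 70, 71, 73, 74, 80, 81, 82, 83, 84, 85, 86]

/-- Marks sit at `e + 1` and the offset in bank 77 contains the same 1. A subtraction that is
truncated to 0 therefore meets cell 0, which is never marked. -/
theorem Env.test (hE : Env k L σ B T M v m) (x : ℕ) :
    InWindow B (k + 1) M (m 78 0) x ↔ m 76 (x + m 77 0 - m 78 0) + m 79 0 ≠ 0 := by
  rw [hE.flt, add_zero, hE.win, hE.off]
  constructor
  · rintro ⟨e, he, h⟩
    exact ⟨e, he, by omega⟩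
  · rintro ⟨e, he, h⟩
    exact ⟨e, he, by omega⟩

/-- Copy values into bank `73`. -/
theorem ensures_fill {e e' : Expr} (n : ℕ) (g : ℕ → ℕ) (hn : e.eval m = n) (hN : n ≤ N)
    (hg : ∀ i < n, ∀ m', Frame [45, 73] m m' → m' 45 0 = i → e'.eval m' = g i)
    (h : ∀ m', Frame [45, 73] m m' → (∀ i < n, m' 73 i = g i) → Q m') :
    Ensures N (rep 45 e (store 73 (reg 45) e')) m Q := by
  refine ensures_rep n (fun i m' => Frame [45, 73] m m' ∧ ∀ i' < i, m' 73 i' = g i') hn hN ?_ ?_ ?_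
  · exact ⟨((Frame.refl _ m).write (by decide)).write (by decide), by simp⟩
  · rintro i hi m₂ ⟨hF₂, h₂⟩ h45 h45'
    refine ensures_store ⟨by simp [h45], by simp [h45'],
      (hF₂.write (by decide)).write (by decide), fun i' hi' => ?_⟩
    rcases Nat.lt_succ_iff_lt_or_eq.1 hi' with hi' | rfl
    · have : i' ≠ m₂ 45 0 := by omega
      simp [this, h₂ i' hi']
    · simp [h45, hg _ hi _ hF₂ h45]
  · rintro m' ⟨hF, h1⟩ -
    exact h m' hF h1

theorem ensures_addRowCmd (hE : Env k L σ B T M v m) (hL : Limits N k L σ B T M)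
    {A : Finset ℕ} (hA : Listed 70 71 A m) (hs : ∀ x, m 82 x ≤ m 83 0)
    (hN : A.card ≤ (2 * M + 1) ^ (k + 1)) {p : ℕ} (hp : p < T + k) (h97 : m 97 0 = p * σ)
    (h : ∀ m', Frame rowBanks m m' →
      Listed 70 71 (sumFilter (InWindow B (k + 1) M (m 78 0)) A (rowCode B (k + 1) σ v p)) m' →
      (∀ x, m' 82 x ≤ m' 83 0) → Q m') : Ensures N addRowCmd m Q := by
  refine ensures_set_seq (ensures_seq (ensures_fill σ (fun q => code B (k + 1) (v p q))
    (by simp [hE.σ_eq]) hL.σ_le ?_ ?_))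
  · intro i hi m' hF h45
    simp [h45, hF 97 (by decide), hF 62 (by decide), h97, hE.row p hp i hi]
  · intro m₁ hF h1
    have hF' : Frame rowBanks m m₁ := ((Frame.refl _ m).write (by decide)).trans hF (by decide)
    have hE' := hE.frame hF' (by decide)
    refine ensures_sumsetCmd (f := InWindow B (k + 1) M (m 78 0)) (A := A)
      (A' := rowCode B (k + 1) σ v p) ?_ ?_ ?_ ?_ ?_ ?_ ?_ ?_
    · have := hE'.test
      rwa [show m₁ 78 = m 78 from hF' 78 (by decide)] at this ⊢
    · simpa [Listed, hF 71 (by decide), hF 70 (by decide)] using hA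
    · rw [rowCode]
      have : m₁ 74 0 = σ := by simp [hF 74 (by decide), hE.σ_eq]
      rw [this]
      exact Finset.image_congr fun i hi => h1 i (by simpa using hi)
    · simpa [hF 82 (by decide), hF 83 (by decide)] using hs
    · exact hN.trans hL.W_le
    · simpa [hF 74 (by decide), hE.σ_eq] using hL.σ_le
    · exact (card_le_of_inWindow fun x hx => (mem_sumFilter.1 hx).2).trans hL.W_le
    · intro m₂ hF₂
      exact h m₂ (hF'.trans hF₂ (by decide))

theorem ensures_doubleCmd (hE : Env k L σ B T M v m) (hL : Limits N k L σ B T M)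
    {A : Finset ℕ} (hA : Listed 70 71 A m) (hs : ∀ x, m 82 x ≤ m 83 0)
    (hN : A.card ≤ (2 * M + 1) ^ (k + 1))
    (h : ∀ m', Frame rowBanks m m' →
      Listed 70 71 (sumFilter (InWindow B (k + 1) M (m 78 0)) A A) m' →
      (∀ x, m' 82 x ≤ m' 83 0) → Q m') : Ensures N doubleCmd m Q := by
  refine ensures_set_seq (ensures_seq (ensures_fill A.card (m 70)
    (by simp [hA.1]) (hN.trans hL.W_le) ?_ ?_))
  · intro i hi m' hF h45
    simp [h45, hF 70 (by decide)]
  · intro m₁ hF h1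
    have hF' : Frame rowBanks m m₁ := ((Frame.refl _ m).write (by decide)).trans hF (by decide)
    have hE' := hE.frame hF' (by decide)
    have h74 : m₁ 74 0 = A.card := by simp [hF 74 (by decide), hA.1]
    refine ensures_sumsetCmd (f := InWindow B (k + 1) M (m 78 0)) (A := A)
      (A' := A) ?_ ?_ ?_ ?_ ?_ ?_ ?_ ?_
    · have := hE'.test
      rwa [show m₁ 78 = m 78 from hF' 78 (by decide)] at this ⊢
    · simpa [Listed, hF 71 (by decide), hF 70 (by decide)] using hA
    · rw [h74]
      exact (Finset.image_congr fun i hi => h1 i (by simpa using hi)).trans hA.2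
    · simpa [hF 82 (by decide), hF 83 (by decide)] using hs
    · exact hN.trans hL.W_le
    · rw [h74]
      exact hN.trans hL.W_le
    · exact (card_le_of_inWindow fun x hx => (mem_sumFilter.1 hx).2).trans hL.W_le
    · intro m₂ hF₂
      exact h m₂ (hF'.trans hF₂ (by decide))

/-- One level of the computation. -/
def levelCmd : Cmd :=
  set 93 (reg 93 - 1) ;; centreCmd ;; doubleCmd ;; set 97 0 ;;
  rep 98 (reg 68) (
    set 95 (cell 91 (reg 98)) ;; shiftCmd ;;
    ite (reg 95 - cell 48 (reg 95) - cell 48 (reg 95)) addRowCmd skip ;;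
    set 97 (reg 97 + sigE))

/-- The banks changed by `levelCmd`. -/
abbrev levelBanks : List ℕ :=
  [30, 31, 32, 33, 45, 70, 71, 73, 74, 78, 80, 81, 82, 83, 84, 85, 86, 93, 95, 96, 97, 98]

theorem ensures_levelCmd (hE : Env k L σ B T M v m) (hL : Limits N k L σ B T M)
    {tgt c : ℕ → ℕ} (ht : ∀ h ≤ k, m 50 h = tgt h) (htB : ∀ h ≤ k, tgt h < B)
    (hc : ∀ p < T + k, m 91 p = c p) (hcB : ∀ p < T + k, c p < B)
    {A : Finset ℕ} (hA : Listed 70 71 A m) (hs : ∀ x, m 82 x ≤ m 83 0)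
    (hN : A.card ≤ (2 * M + 1) ^ (k + 1)) {i : ℕ} (hi : m 93 0 = i + 1) (hiN : i ≤ N)
    (h : ∀ m', Frame levelBanks m m' → m' 93 0 = i →
      m' 78 0 = code B (k + 1) (fun h => tgt h / 2 ^ i) →
      Listed 70 71 (levelFold (InWindow B (k + 1) M (code B (k + 1) (fun h => tgt h / 2 ^ i)))
        (rowCode B (k + 1) σ v) (fun p => c p / 2 ^ i % 2 = 1) A (T + k)) m' →
      (∀ x, m' 82 x ≤ m' 83 0) → Q m') : Ensures N levelCmd m Q := by
  refine ensures_set_seq ?_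
  have hev : (reg 93 - 1).eval m = i := by simp [hi]
  rw [hev]
  set m₀ := m.write 93 0 i with hm₀
  have hF₀ : Frame levelBanks m m₀ := (Frame.refl _ m).write (by decide)
  have h93 : m₀ 93 0 = i := by simp [hm₀]
  refine ensures_seq (ensures_centreCmd (hE.frame hF₀ (by decide)) hL (tgt := tgt) ?_ htB ?_ ?_)
  · simpa [hm₀] using ht
  · simpa [h93] using hiN
  intro m₁ hF h78
  rw [h93] at h78
  have hF₁ : Frame levelBanks m m₁ := hF₀.trans hF (by decide)
  refine ensures_seq (ensures_doubleCmd (hE.frame hF₁ (by decide)) hL (A := A) ?_ ?_ hN ?_)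
  · simpa [Listed, hF 71 (by decide), hF 70 (by decide), hm₀] using hA
  · simpa [hF 82 (by decide), hF 83 (by decide), hm₀] using hs
  intro m₂ hF' hA₂ hs₂
  have hF₂ : Frame levelBanks m m₂ := hF₁.trans hF' (by decide)
  have h93₂ : m₂ 93 0 = i := by rw [hF' 93 (by decide), hF 93 (by decide), h93]
  have h78₂ : m₂ 78 0 = code B (k + 1) (fun h => tgt h / 2 ^ i) := by
    rw [hF' 78 (by decide), h78]
  rw [h78] at hA₂
  set f := InWindow B (k + 1) M (code B (k + 1) (fun h => tgt h / 2 ^ i)) with hf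
  refine ensures_set_seq (ensures_rep (T + k) (fun p m' => Frame levelBanks m m' ∧
    m' 93 0 = i ∧ m' 78 0 = code B (k + 1) (fun h => tgt h / 2 ^ i) ∧ m' 97 0 = p * σ ∧
    Listed 70 71 (levelFold f (rowCode B (k + 1) σ v) (fun p => c p / 2 ^ i % 2 = 1) A p) m' ∧
    ∀ x, m' 82 x ≤ m' 83 0) ?_ hL.T_le ?_ ?_ ?_)
  · simp [hF₂ 68 (by decide), hE.P_eq]
  · refine ⟨((hF₂.write (by decide)).write (by decide)).write (by decide), by simpa using h93₂,
      by simpa using h78₂, by simp, ?_, by simpa using hs₂⟩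
    simpa [Listed, levelFold] using hA₂
  · rintro p hp m₃ ⟨hF₃, b1, b2, b3, b4, b5⟩ h98 h98'
    have hE₃ := hE.frame hF₃ (by decide)
    refine ensures_set_seq ?_
    have hev : (cell 91 (reg 98)).eval m₃ = c p := by
      simp [h98, hF₃ 91 (by decide), hc p hp]
    rw [hev]
    refine ensures_seq (ensures_shiftCmd (B := B) ?_ ?_ ?_ ?_)
    · simpa using hE₃.half
    · simpa using (hcB p hp).le
    · simpa [b1] using hiN
    intro m₄ hF₄ h95
    have h95 : m₄ 95 0 = c p / 2 ^ i := by simpa [b1] using h95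
    have hF₄' : Frame levelBanks m m₄ := (hF₃.write (by decide)).trans hF₄ (by decide)
    have hE₄ := hE.frame hF₄' (by decide)
    -- Subtracting the half twice leaves the parity; the halves come from a table, as the machine
    -- cannot divide.
    have hodd : (reg 95 - cell 48 (reg 95) - cell 48 (reg 95)).eval m₄ ≠ 0 ↔
        c p / 2 ^ i % 2 = 1 := by
      have : c p / 2 ^ i ≤ B := (Nat.div_le_self _ _).trans (hcB p hp).le
      simp only [eval_sub, eval_reg, eval_cell, h95, hE₄.half _ this]
      omega
    have d97 : m₄ 97 0 = p * σ := by simp [hF₄ 97 (by decide), b3]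
    have d98 : m₄ 98 = m₃ 98 := by simp [hF₄ 98 (by decide)]
    have d93 : m₄ 93 0 = i := by simp [hF₄ 93 (by decide), b1]
    have d78 : m₄ 78 0 = code B (k + 1) (fun h => tgt h / 2 ^ i) := by
      simp [hF₄ 78 (by decide), b2]
    have dA : Listed 70 71 (levelFold f (rowCode B (k + 1) σ v) (fun p => c p / 2 ^ i % 2 = 1)
        A p) m₄ := by
      simpa [Listed, hF₄ 70 (by decide), hF₄ 71 (by decide)] using b4
    have ds : ∀ x, m₄ 82 x ≤ m₄ 83 0 := by
      simpa [hF₄ 82 (by decide), hF₄ 83 (by decide)] using b5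
    refine ensures_seq (ensures_ite (fun he => ?_) fun he => ?_)
    · refine ensures_addRowCmd hE₄ hL dA ds (card_levelFold_le p) hp d97 fun m₅ hF₅ hA₅ hs₅ => ?_
      have hF₅' : Frame levelBanks m m₅ := hF₄'.trans hF₅ (by decide)
      refine ensures_set ⟨?_, ?_, (hF₅'.write (by decide)).write (by decide), ?_, ?_, ?_, ?_, ?_⟩
      · simp [hF₅ 98 (by decide), d98, h98]
      · simp [hF₅ 98 (by decide), d98, h98']
      · simp [hF₅ 93 (by decide), d93]
      · simp [hF₅ 78 (by decide), d78]
      · simp [hF₅ 97 (by decide), d97, hF₅' 0 (by decide), hE.σ_eq, add_mul]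
      · rw [levelFold, if_pos (hodd.1 he)]
        rw [d78] at hA₅
        simpa [Listed] using hA₅
      · simpa using hs₅
    · refine ensures_skip (ensures_set
        ⟨?_, ?_, (hF₄'.write (by decide)).write (by decide), ?_, ?_, ?_, ?_, ?_⟩)
      · simp [d98, h98]
      · simp [d98, h98']
      · simp [d93]
      · simp [d78]
      · simp [d97, hE₄.σ_eq, add_mul]
      · rw [levelFold, if_neg fun h => hodd.2 h he]
        simpa [Listed] using dA
      · simpa using ds
  · rintro m' ⟨c1, c2, c3, -, c4, c5⟩ -
    exact h m' c1 c2 c3 c4 c5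

/-! ### Counts of the types, and the decision for one target -/

/-- Count the columns of every type in bank `91`, and copy the slacks there. -/
def countCmd : Cmd :=
  rep 45 (reg 68) (store 91 (reg 45) 0) ;;
  rep 45 lenE (store 91 (cell 55 (reg 45)) (cell 91 (cell 55 (reg 45)) + 1)) ;;
  rep 45 kE (store 91 (reg 92 + reg 45) (cell 51 (reg 45)))

/-- The number of columns of type `p`, or the slack for the types from `T` on. -/
def typeCount (L T : ℕ) (ty U : ℕ → ℕ) (p : ℕ) : ℕ :=
  if p < T then ((Finset.range L).filter (ty · = p)).card else U (p - T)

theorem ensures_countCmd (hE : Env k L σ B T M v m) (hL : Limits N k L σ B T M)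
    (h : ∀ m', Frame [45, 91] m m' →
      (∀ p < T + k, m' 91 p = typeCount L T (m 55) (m 51) p) → Q m') :
    Ensures N countCmd m Q := by
  refine Ensures.seq (R := fun m' => Frame [45, 91] m m' ∧ ∀ p < T + k, m' 91 p = 0) ?_ ?_
  · refine ensures_rep (T + k) (fun i m' => Frame [45, 91] m m' ∧ ∀ p < i, m' 91 p = 0)
      (by simp [hE.P_eq]) hL.T_le ?_ ?_ fun m' h _ => h
    · exact ⟨((Frame.refl _ m).write (by decide)).write (by decide), by simp⟩
    · rintro i hi m₂ ⟨hF₂, h₂⟩ h45 h45'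
      refine ensures_store ⟨by simp [h45], by simp [h45'],
        (hF₂.write (by decide)).write (by decide), fun i' hi' => ?_⟩
      rcases Nat.lt_succ_iff_lt_or_eq.1 hi' with hi' | rfl
      · have : i' ≠ m₂ 45 0 := by omega
        simp [this, h₂ i' hi']
      · simp [h45]
  rintro m₁ ⟨hF₁, h₁⟩
  refine Ensures.seq (R := fun m' => Frame [45, 91] m m' ∧ ∀ p < T + k, m' 91 p =
    ((Finset.range L).filter (m 55 · = p)).card) ?_ ?_
  · refine ensures_rep L (fun i m' => Frame [45, 91] m m' ∧ ∀ p < T + k, m' 91 p =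
      ((Finset.range i).filter (m 55 · = p)).card)
      (by simp [hF₁ 0 (by decide), hE.L_eq]) hL.L_le ?_ ?_ fun m' h _ => h
    · exact ⟨(hF₁.write (by decide)).write (by decide), by simpa using h₁⟩
    · rintro i hi m₂ ⟨hF₂, h₂⟩ h45 h45'
      refine ensures_store ⟨by simp [h45], by simp [h45'],
        (hF₂.write (by decide)).write (by decide), fun p hp => ?_⟩
      rw [Finset.range_add_one, Finset.filter_insert]
      by_cases hpi : m 55 i = p
      · rw [if_pos hpi, Finset.card_insert_of_notMem (by simp)]
        simp [h45, hF₂ 55 (by decide), hpi, h₂ p hp]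
      · rw [if_neg hpi]
        simp [h45, hF₂ 55 (by decide), Function.update_of_ne (Ne.symm hpi), h₂ p hp]
  rintro m₂ ⟨hF₂, h₂⟩
  refine ensures_rep k (fun i m' => Frame [45, 91] m m' ∧
      (∀ p < T, m' 91 p = ((Finset.range L).filter (m 55 · = p)).card) ∧
      ∀ i' < i, m' 91 (T + i') = m 51 i')
      (by simp [hF₂ 0 (by decide), hE.k_eq]) (by have := hL.k_le; omega) ?_ ?_ ?_
  · refine ⟨(hF₂.write (by decide)).write (by decide), fun p hp => ?_, by simp⟩
    simpa using h₂ p (by omega)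
  · rintro i hi m₃ ⟨hF₃, h₃, h₃'⟩ h45 h45'
    have hT : m₃ 92 0 = T := by rw [hF₃ 92 (by decide), hE.T_eq]
    refine ensures_store ⟨by simp [h45], by simp [h45'],
      (hF₃.write (by decide)).write (by decide), fun p hp => ?_, fun i' hi' => ?_⟩
    · have : p ≠ T + i := by omega
      simp [hT, h45, this, h₃ p hp]
    · rcases Nat.lt_succ_iff_lt_or_eq.1 hi' with hi' | rfl
      · have : i' ≠ i := by omega
        simp [hT, h45, this, h₃' i' hi']
      · simp [hT, h45, hF₃ 51 (by decide)]
  · rintro m' ⟨hF, h1, h2⟩ -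
    refine h m' hF fun p hp => ?_
    unfold typeCount
    split_ifs with hpT
    · exact h1 p hpT
    · rw [← h2 (p - T) (by omega)]
      congr 1
      omega

/-- Decide whether the target with digits in bank `50` and last digit in register `90` is
reachable; the answer is written to register `99`. -/
def decideCmd : Cmd :=
  store 50 kE (reg 90) ;; countCmd ;; store 70 0 0 ;; set 71 1 ;; set 93 (reg 43) ;;
  rep 94 (reg 43) levelCmd ;; set 99 0 ;;
  rep 45 (reg 71)
    (ite ((cell 70 (reg 45) - reg 78) + (reg 78 - cell 70 (reg 45))) skip (set 99 1))

/-- The banks changed by `decideCmd`. -/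
abbrev decideBanks : List ℕ :=
  [30, 31, 32, 33, 45, 50, 70, 71, 73, 74, 78, 80, 81, 82, 83, 84, 85, 86, 91, 93, 94, 95, 96, 97,
    98, 99]

/-- The base also serves as the number of levels: all counts are below B, hence below 2^B. Far fewer
levels would do, but B respects the loop limit anyway. On the last level the centre is the code of
the target itself, and the final list is searched for it. -/
theorem ensures_decideCmd (hE : Env k L σ B T M v m) (hL : Limits N k L σ B T M)
    (hs : ∀ x, m 82 x ≤ m 83 0) (hLB : L < B)
    (hU : ∀ i < k, m 51 i < B) {tgt : ℕ → ℕ} (ht : ∀ h < k, m 50 h = tgt h)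
    (htk : m 90 0 = tgt k) (htB : ∀ h ≤ k, tgt h < B) {S : ℕ}
    (hS : ∀ h < k + 1, ∑ p ∈ Finset.range (T + k), ∑ q ∈ Finset.range σ, v p q h ≤ S)
    (hM : 1 + 3 * S ≤ M)
    (hB : ∀ w, Reach (T + k) σ v (typeCount L T (m 55) (m 51)) w → ∀ h < k + 1, w h < B)
    (h : ∀ m', Frame decideBanks m m' → (∀ h < k, m' 50 h = m 50 h) →
      (∀ x, m' 82 x ≤ m' 83 0) →
      (m' 99 0 ≠ 0 ↔ ∃ w, Reach (T + k) σ v (typeCount L T (m 55) (m 51)) w ∧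
        ∀ h < k + 1, w h = tgt h) → Q m') : Ensures N decideCmd m Q := by
  refine ensures_store_seq ?_
  set m₀ := m.write 50 (kE.eval m) ((reg 90).eval m) with hm₀
  have hF₀ : Frame decideBanks m m₀ := (Frame.refl _ m).write (by decide)
  set c := typeCount L T (m 55) (m 51) with hc
  have hcB : ∀ p < T + k, c p < B := fun p hp => by
    rw [hc]
    unfold typeCount
    split_ifs
    · exact ((Finset.card_filter_le _ _).trans (by simp)).trans_lt hLB
    · exact hU _ (by omega)
  have h50 : ∀ h ≤ k, m₀ 50 h = tgt h := fun h hh => by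
    rcases hh.lt_or_eq with hh | rfl
    · have : h ≠ k := by omega
      simp [hm₀, hE.k_eq, this, ht h hh]
    · simp [hm₀, hE.k_eq, htk]
  have h50' : ∀ h < k, m₀ 50 h = m 50 h := fun h hh => by rw [h50 h hh.le, ht h hh]
  refine ensures_seq (ensures_countCmd (hE.frame hF₀ (by decide)) hL ?_)
  intro m₁ hF hcnt
  have hF₁ : Frame decideBanks m m₁ := hF₀.trans hF (by decide)
  refine ensures_store_seq (ensures_set_seq (ensures_set_seq ?_))
  set cen := fun i => code B (k + 1) (fun h => tgt h / 2 ^ i) with hcen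
  set lev := levelSet (fun i => InWindow B (k + 1) M (cen i)) (rowCode B (k + 1) σ v) c (T + k) B
    with hlev
  -- At least one level is carried out, so register 78 really holds the code of the target
  -- afterwards.
  have hBpos : 0 < B := by omega
  refine Ensures.seq (R := fun m' => Frame decideBanks m m' ∧ (∀ h < k, m' 50 h = m 50 h) ∧
    (∀ x, m' 82 x ≤ m' 83 0) ∧ Listed 70 71 (lev B) m' ∧ m' 78 0 = cen 0) ?_ ?_
  · refine ensures_rep B (fun t m' => Frame decideBanks m m' ∧ (∀ h ≤ k, m' 50 h = tgt h) ∧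
      (∀ p < T + k, m' 91 p = c p) ∧
      (∀ x, m' 82 x ≤ m' 83 0) ∧ Listed 70 71 (lev t) m' ∧ m' 93 0 = B - t ∧
      (0 < t → m' 78 0 = cen (B - t))) (by simp [hF₁ 43 (by decide), hE.B_eq]) hL.B_le ?_ ?_ ?_
    · refine ⟨?_, ?_, ?_, ?_, ?_, ?_, ?_⟩
      · exact ((((hF₁.write (by decide)).write (by decide)).write (by decide)).write
          (by decide)).write (by decide)
      · simpa [hF 50 (by decide)] using h50
      · simpa [hm₀] using hcnt
      · simpa [hF 82 (by decide), hF 83 (by decide), hm₀] using hs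
      · simp [Listed, hlev, levelSet]
      · simp [hF₁ 43 (by decide), hE.B_eq]
      · simp
    · rintro t ht' m₂ ⟨hF₂, b1, b2, b3, b4, b5, -⟩ h94 h94'
      have hB' := hL.B_le
      refine ensures_levelCmd (i := B - 1 - t) (hE.frame hF₂ (by decide)) hL b1 htB b2 hcB b4 b3
        (card_levelSet_le t) (by omega) (by omega) ?_
      intro m₃ hF₃ d1 d2 d3 d4
      have e : B - (t + 1) = B - 1 - t := by omega
      refine ⟨?_, ?_, ((hF₂.trans hF₃ (by decide)).write (by decide)), ?_, ?_, ?_, ?_, ?_, ?_⟩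
      · rw [hF₃ 94 (by decide), h94]
      · rw [hF₃ 94 (by decide), h94']
      · simpa [hF₃ 50 (by decide)] using b1
      · simpa [hF₃ 91 (by decide)] using b2
      · simpa using d4
      · have hl : lev (t + 1) = levelFold (InWindow B (k + 1) M (cen (B - 1 - t)))
            (rowCode B (k + 1) σ v) (fun p => c p / 2 ^ (B - 1 - t) % 2 = 1) (lev t) (T + k) := rfl
        rw [hl]
        simpa [Listed] using d3
      · simp [d1, e]
      · intro _
        simp [d2, e, hcen]
    · rintro m' ⟨c1, c2, c3, c4, c5, c6, c7⟩ -
      refine ⟨c1, fun h hh => by rw [c2 h hh.le, ht h hh], c4, c5, ?_⟩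
      simpa using c7 hBpos
  · rintro m₂ ⟨hF₂, b1, b2, b3, b4⟩
    refine ensures_set_seq ?_
    have hcard : (lev B).card ≤ N := (card_levelSet_le B).trans hL.W_le
    refine ensures_rep (lev B).card (fun i m' => Frame [45, 99] m₂ m' ∧
      (m' 99 0 ≠ 0 ↔ ∃ i' < i, m₂ 70 i' = cen 0)) (by simp [b3.1]) hcard ?_ ?_ ?_
    · exact ⟨(((Frame.refl _ m₂).write (by decide)).write (by decide)).write (by decide), by simp⟩
    · rintro i hi m₃ ⟨hF₃, d1⟩ h45 h45'
      have hev : ((cell 70 (reg 45) - reg 78) + (reg 78 - cell 70 (reg 45))).eval m₃ = 0 ↔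
          m₂ 70 i = cen 0 := by
        simp only [eval_add, eval_sub, eval_cell, eval_reg, h45, hF₃ 70 (by decide),
          hF₃ 78 (by decide), b4]
        omega
      refine ensures_ite (fun he => ensures_skip ⟨h45, h45', hF₃.write (by decide), ?_⟩)
        fun he => ensures_set ⟨by simpa using h45, by simpa using h45',
          (hF₃.write (by decide)).write (by decide), ?_⟩
      · have he : m₂ 70 i ≠ cen 0 := fun h => he (hev.2 h)
        simp only [Mem.write_apply]
        rw [if_neg (by decide), d1]
        constructor
        · rintro ⟨i', h1, h2⟩
          exact ⟨i', by omega, h2⟩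
        · rintro ⟨i', h1, h2⟩
          refine ⟨i', ?_, h2⟩
          rcases Nat.lt_succ_iff_lt_or_eq.1 h1 with h1 | rfl
          · exact h1
          · exact absurd h2 he
      · simp only [Mem.write_apply]
        simp only [Nat.reduceEqDiff, if_false, if_true, Function.update_self, eval_one, ne_eq,
          one_ne_zero, not_false_eq_true, true_iff]
        exact ⟨i, by omega, hev.1 he⟩
    · rintro m₃ ⟨hF₃, d1⟩ -
      refine h m₃ (hF₂.trans hF₃ (by decide)) ?_ ?_ ?_
      · simpa [hF₃ 50 (by decide)] using b1
      · simpa [hF₃ 82 (by decide), hF₃ 83 (by decide)] using b2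
      · have hmem : (∃ i' < (lev B).card, m₂ 70 i' = cen 0) ↔ cen 0 ∈ lev B := by
          have hl := b3.2
          generalize lev B = X at hl
          constructor
          · rintro ⟨i', h1, h2⟩
            rw [← hl, ← h2]
            exact Finset.mem_image_of_mem _ (Finset.mem_range.2 h1)
          · intro hx
            rw [← hl] at hx
            obtain ⟨i', h1, h2⟩ := Finset.mem_image.1 hx
            exact ⟨i', Finset.mem_range.1 h1, h2⟩
        rw [d1, hmem, hlev, hcen]
        simp only [pow_zero, Nat.div_one]
        refine code_mem_levelSet_iff (fun p hp => (hcB p hp).trans Nat.lt_two_pow_self) hS hM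
          (fun h hh => htB h (by omega)) hB

end RAM


/-! ## Preparation of the tables -/

namespace RAM

open Cmd LetterSum

/-- The product of two numbers is written to register `b`. -/
def mulTo (b : ℕ) (e₁ e₂ : Expr) : Cmd :=
  set 31 e₁ ;; set 32 e₂ ;; mulCmd ;; set b (reg 30)

/-- The tables `1, e, …, e ^ k` of powers. -/
def powersCmd (b : ℕ) (e : Expr) : Cmd :=
  store b 0 1 ;; rep 45 kE (mulTo 29 (cell b (reg 45)) e ;; store b (reg 45 + 1) (reg 29))

/-- The table of halves. -/
def halfCmd : Cmd := rep 45 (reg 43) (store 48 (reg 45 + 1 + 1) (cell 48 (reg 45) + 1))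

variable {N : ℕ} {m : Mem} {Q : Mem → Prop}

/-- Multiplication is repeated addition, so its time depends on the second factor alone. Powers of
the base, which exceed every loop limit, are always passed as the first factor. -/
theorem ensures_mulTo {b : ℕ} {e₁ e₂ : Expr} (x y : ℕ) (h₁ : e₁.eval m = x)
    (h₂ : e₂.eval (m.write 31 0 x) = y) (hy : y ≤ N)
    (h : ∀ m', Frame [29, 30, 31, 32, 33, b] m m' → m' b 0 = x * y → Q m') :
    Ensures N (mulTo b e₁ e₂) m Q := by
  refine ensures_set_seq ?_
  rw [h₁]
  refine ensures_set_seq ?_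
  rw [h₂]
  refine ensures_seq (ensures_mulCmd (by simpa using hy) fun m' hF h30 =>
    ensures_set (h _ ?_ (by simpa using h30)))
  refine Frame.write (((((Frame.refl _ m).write ?_).write ?_).trans hF ?_)) ?_ <;> simp

theorem ensures_powersCmd {b : ℕ} {e : Expr} {k x : ℕ} (hk : m 0 0 = k) (hkN : k ≤ N)
    (hx : x ≤ N) (hb : b ∉ [0, 29, 30, 31, 32, 33, 45])
    (he : ∀ m', Frame [29, 30, 31, 32, 33, 45, b] m m' → e.eval m' = x)
    (h : ∀ m', Frame [29, 30, 31, 32, 33, 45, b] m m' → (∀ i ≤ k, m' b i = x ^ i) → Q m') :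
    Ensures N (powersCmd b e) m Q := by
  simp only [List.mem_cons, List.not_mem_nil, or_false, not_or] at hb
  obtain ⟨c0, c29, c30, c31, c32, c33, c45⟩ := hb
  refine ensures_store_seq (ensures_rep k (fun i m' => Frame [29, 30, 31, 32, 33, 45, b] m m' ∧
    ∀ i' ≤ i, m' b i' = x ^ i') (by simp [hk, Ne.symm c0]) hkN ?_ ?_ ?_)
  · refine ⟨Frame.write (Frame.write ((Frame.refl _ m).write (by simp)) (by simp)) (by simp), ?_⟩
    simp [c45]
  · rintro i hi m' ⟨hF, h1⟩ h2 h3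
    refine ensures_seq (ensures_mulTo (x ^ i) x ?_ (he _ (hF.write (by simp))) hx ?_)
    · simp [h2, h1]
    · intro m'' hF' h29
      have hF'' : Frame [29, 30, 31, 32, 33, 45, b] m m'' := hF.trans hF' (by simp)
      have e1 : m'' 45 = m' 45 := hF' 45 (by decide)
      refine ensures_store ⟨by simp [Ne.symm c45, e1, h2], by simp [Ne.symm c45, e1, h3],
        (hF''.write (by simp)).write (by simp), fun i' hi' => ?_⟩
      have e2 : m'' b = m' b := hF' b (by simp [c29, c30, c31, c32, c33])
      rcases Nat.lt_succ_iff_lt_or_eq.1 (Nat.lt_succ_of_le hi') with hi' | rfl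
      · have : i' ≠ i + 1 := by omega
        simp [c45, e1, h2, this, e2, h1 i' (by omega)]
      · simp [c45, e1, h2, h29, pow_succ]
  · rintro m' ⟨hF, h1⟩ -
    exact h m' hF h1

/-- The recursion h(a+2) = h(a) + 1 starts from the zeros already present in cells 0 and 1. -/
theorem ensures_halfCmd {B : ℕ} (hB : m 43 0 = B) (hN : B ≤ N) (hz : ∀ a, m 48 a = 0)
    (h : ∀ m', Frame [45, 48] m m' → (∀ a ≤ B, m' 48 a = a / 2) → Q m') :
    Ensures N halfCmd m Q := by
  refine ensures_rep B (fun i m' => Frame [45, 48] m m' ∧ ∀ a < i + 2, m' 48 a = a / 2)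
    (by simp [hB]) hN ?_ ?_ ?_
  · refine ⟨((Frame.refl _ m).write (by decide)).write (by decide), fun a ha => ?_⟩
    simp [hz]
    omega
  · rintro i hi m' ⟨hF, h1⟩ h2 h3
    refine ensures_store ⟨by simp [h2], by simp [h3], (hF.write (by decide)).write (by decide),
      fun a ha => ?_⟩
    rcases Nat.lt_succ_iff_lt_or_eq.1 ha with ha | rfl
    · have : a ≠ i + 1 + 1 := by omega
      simp [h2, this, h1 a (by omega)]
    · simp [h2, h1 i (by omega)]
  · rintro m' ⟨hF, h1⟩ -
    exact h m' hF fun a ha => h1 a (by omega)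

/-! ### Parameters, clipped bounds and slacks -/

/-- The memory holds an instance: bounds `d` and `D`, table `tbl` of distances and matrix `str`. -/
structure Input (k L σ : ℕ) (tbl str d D : ℕ → ℕ) (m : Mem) : Prop where
  k_eq : m 0 0 = k
  L_eq : m 0 1 = L
  σ_eq : m 0 2 = σ
  d_eq : m 1 = d
  D_eq : m 2 = D
  tbl_eq : m 3 = tbl
  str_eq : m 4 = str

variable {k L σ : ℕ} {tbl str d D : ℕ → ℕ}

theorem Input.frame {m' : Mem} (h : Input k L σ tbl str d D m) {S : List ℕ} (hF : Frame S m m')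
    (hS : ∀ b ∈ [0, 1, 2, 3, 4], b ∉ S) : Input k L σ tbl str d D m' := by
  have e : ∀ b ∈ [0, 1, 2, 3, 4], m' b = m b := fun b hb => hF b (hS b hb)
  constructor
  · rw [e 0 (by decide)]; exact h.k_eq
  · rw [e 0 (by decide)]; exact h.L_eq
  · rw [e 0 (by decide)]; exact h.σ_eq
  · rw [e 1 (by decide)]; exact h.d_eq
  · rw [e 2 (by decide)]; exact h.D_eq
  · rw [e 3 (by decide)]; exact h.tbl_eq
  · rw [e 4 (by decide)]; exact h.str_eq

/-- One plus the sum of all table entries. -/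
def tblSum (σ : ℕ) (tbl : ℕ → ℕ) : ℕ := 1 + ∑ i ∈ Finset.range (σ * σ), tbl i

/-- An upper bound for all distances and for their sum. -/
def distBound (k L σ : ℕ) (tbl : ℕ → ℕ) : ℕ := L * k * tblSum σ tbl

/-- The base of the codes. -/
def baseOf (k L σ : ℕ) (tbl : ℕ → ℕ) : ℕ := distBound k L σ tbl + distBound k L σ tbl + 1

/-- The number of types of columns, with or without a prescribed letter. -/
def numTypes (k σ : ℕ) : ℕ := (σ + 1) ^ k * (σ + 1)

/-- The radius of the window. -/
def radius (k σ : ℕ) (tbl : ℕ → ℕ) : ℕ :=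
  1 + 3 * ((numTypes k σ + k) * σ * tblSum σ tbl * k)

/-- Compute the parameters `tblSum`, `distBound`, `baseOf`. -/
def paramsCmd : Cmd :=
  mulTo 29 sigE sigE ;; set 40 1 ;; rep 41 (reg 29) (set 40 (reg 40 + cell 3 (reg 41))) ;;
  mulTo 29 lenE kE ;; mulTo 42 (reg 29) (reg 40) ;; set 43 (reg 42 + reg 42 + 1)

/-- The banks changed by `paramsCmd`. -/
abbrev paramsBanks : List ℕ := [29, 30, 31, 32, 33, 40, 41, 42, 43]

theorem ensures_paramsCmd (hI : Input k L σ tbl str d D m) (hσ : σ * σ ≤ N) (hσ' : σ ≤ N)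
    (hk : k ≤ N) (hS : tblSum σ tbl ≤ N)
    (h : ∀ m', Frame paramsBanks m m' → m' 40 0 = tblSum σ tbl → m' 42 0 = distBound k L σ tbl →
      m' 43 0 = baseOf k L σ tbl → Q m') : Ensures N paramsCmd m Q := by
  refine ensures_seq (ensures_mulTo σ σ (by simp [hI.σ_eq]) (by simp [hI.σ_eq]) hσ' ?_)
  intro m₁ hF₁ h1
  refine ensures_set_seq (Ensures.seq (R := fun m' => Frame paramsBanks m m' ∧
    m' 40 0 = tblSum σ tbl) ?_ ?_)
  · refine ensures_rep (σ * σ) (fun i m' => Frame paramsBanks m m' ∧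
      m' 40 0 = 1 + ∑ i' ∈ Finset.range i, tbl i') (by simp [h1]) hσ ?_ ?_ fun m' h _ => h
    · refine ⟨?_, by simp⟩
      exact ((((Frame.refl _ m).trans hF₁ (by decide)).write (by decide)).write
        (by decide)).write (by decide)
    · rintro i hi m' ⟨hF, h2⟩ h3 h4
      refine ensures_set ⟨by simpa using h3, by simpa using h4,
        (hF.write (by decide)).write (by decide), ?_⟩
      simp [h2, h3, hF 3 (by decide), hI.tbl_eq, Finset.sum_range_succ, add_assoc]
  rintro m₂ ⟨hF₂, h2⟩
  refine ensures_seq (ensures_mulTo L k (by simp [hF₂ 0 (by decide), hI.L_eq])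
    (by simp [hF₂ 0 (by decide), hI.k_eq]) hk ?_)
  intro m₃ hF₃ h3
  refine ensures_seq (ensures_mulTo (L * k) (tblSum σ tbl) (by simp [h3])
    (by simp [hF₃ 40 (by decide), h2]) hS ?_)
  intro m₄ hF₄ h4
  refine ensures_set (h _ ?_ ?_ ?_ ?_)
  · exact ((hF₂.trans hF₃ (by decide)).trans hF₄ (by decide)).write (by decide)
  · simp [hF₄ 40 (by decide), hF₃ 40 (by decide), h2]
  · simp [h4, distBound]
  · simp [h4, baseOf, distBound]

/-- Compute the number of types and the radius. -/
def radiusCmd : Cmd :=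
  mulTo 92 (cell 46 kE) (sigE + 1) ;; set 68 (reg 92 + kE) ;; mulTo 29 (reg 68) sigE ;;
  mulTo 28 (reg 29) (reg 40) ;; mulTo 29 (reg 28) kE ;; set 69 (1 + (reg 29 + reg 29 + reg 29))

/-- The banks changed by `radiusCmd`. -/
abbrev radiusBanks : List ℕ := [28, 29, 30, 31, 32, 33, 68, 69, 92]

theorem ensures_radiusCmd (hI : Input k L σ tbl str d D m) (hσ : σ + 1 ≤ N) (hk : k ≤ N)
    (hS : tblSum σ tbl ≤ N) (h40 : m 40 0 = tblSum σ tbl) (h46 : m 46 k = (σ + 1) ^ k)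
    (h : ∀ m', Frame radiusBanks m m' → m' 92 0 = numTypes k σ → m' 68 0 = numTypes k σ + k →
      m' 69 0 = radius k σ tbl → Q m') : Ensures N radiusCmd m Q := by
  refine ensures_seq (ensures_mulTo ((σ + 1) ^ k) (σ + 1) (by simp [hI.k_eq, h46])
    (by simp [hI.σ_eq]) hσ ?_)
  intro m₁ hF₁ h1
  refine ensures_set_seq ?_
  have hF₁' : Frame radiusBanks m (m₁.write 68 0 ((reg 92 + kE).eval m₁)) :=
    ((Frame.refl _ m).trans hF₁ (by decide)).write (by decide)
  refine ensures_seq (ensures_mulTo (numTypes k σ + k) σ ?_ ?_ (by omega) ?_)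
  · simp [h1, numTypes, hF₁ 0 (by decide), hI.k_eq]
  · simp [hF₁ 0 (by decide), hI.σ_eq]
  intro m₂ hF₂ h2
  have hF₂' : Frame radiusBanks m m₂ := hF₁'.trans hF₂ (by decide)
  refine ensures_seq (ensures_mulTo ((numTypes k σ + k) * σ) (tblSum σ tbl)
    (by simp only [eval_reg, h2])
    (by simp [hF₂' 40 (by decide), h40]) hS ?_)
  intro m₃ hF₃ h3
  have hF₃' : Frame radiusBanks m m₃ := hF₂'.trans hF₃ (by decide)
  refine ensures_seq (ensures_mulTo ((numTypes k σ + k) * σ * tblSum σ tbl) k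
    (by simp only [eval_reg, h3])
    (by simp [hF₃' 0 (by decide), hI.k_eq]) hk ?_)
  intro m₄ hF₄ h4
  have hF₄' : Frame radiusBanks m m₄ := hF₃'.trans hF₄ (by decide)
  refine ensures_set (h _ (hF₄'.write (by decide)) ?_ ?_ ?_)
  · simp [hF₄ 92 (by decide), hF₃ 92 (by decide), hF₂ 92 (by decide), h1, numTypes]
  · simp [hF₄ 68 (by decide), hF₃ 68 (by decide), hF₂ 68 (by decide), h1, numTypes,
      hF₁ 0 (by decide), hI.k_eq]
  · simp only [Mem.write_apply, if_true, Function.update_self, eval_add, eval_one, eval_reg, h4,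
      radius]
    ring

/-- Replace the upper bounds by their minima with `distBound`, compute the slacks, and write to
register `49` whether the lower bounds respect the upper ones. -/
def clipCmd : Cmd :=
  set 49 1 ;; rep 45 kE (
    store 50 (reg 45) (cell 2 (reg 45) - (cell 2 (reg 45) - reg 42)) ;;
    store 51 (reg 45) (cell 50 (reg 45) - cell 1 (reg 45)) ;;
    ite (cell 1 (reg 45) - cell 50 (reg 45)) (set 49 0) skip)

/-- Clipping the upper bounds will lose nothing when `A` bounds all distances, and it keeps the
targets below the base. The slacks are truncated differences, so register 49 records separately
whether they are genuine. -/
theorem ensures_clipCmd (hI : Input k L σ tbl str d D m) {A : ℕ} (hA : m 42 0 = A) (hk : k ≤ N)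
    (h : ∀ m', Frame [45, 49, 50, 51] m m' → (∀ i < k, m' 50 i = min (D i) A) →
      (∀ i < k, m' 51 i = min (D i) A - d i) →
      (m' 49 0 ≠ 0 ↔ ∀ i < k, d i ≤ min (D i) A) → Q m') : Ensures N clipCmd m Q := by
  refine ensures_set_seq (ensures_rep k (fun i m' => Frame [45, 49, 50, 51] m m' ∧
    (∀ i' < i, m' 50 i' = min (D i') A) ∧ (∀ i' < i, m' 51 i' = min (D i') A - d i') ∧
    (m' 49 0 ≠ 0 ↔ ∀ i' < i, d i' ≤ min (D i') A)) (by simp [hI.k_eq]) hk ?_ ?_ ?_)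
  · exact ⟨(((Frame.refl _ m).write (by decide)).write (by decide)).write (by decide), by simp⟩
  · rintro i hi m₁ ⟨hF, h1, h2, h3⟩ h45 h45'
    have e2 : m₁ 2 i = D i := by rw [hF 2 (by decide), hI.D_eq]
    have e1 : m₁ 1 i = d i := by rw [hF 1 (by decide), hI.d_eq]
    have e42 : m₁ 42 0 = A := by rw [hF 42 (by decide), hA]
    refine ensures_store_seq ?_
    have hev : (cell 2 (reg 45) - (cell 2 (reg 45) - reg 42)).eval m₁ = min (D i) A := by
      simp only [eval_sub, eval_cell, eval_reg, h45, e2, e42]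
      omega
    rw [hev, eval_reg, h45]
    refine ensures_store_seq ?_
    have hev' : (cell 50 (reg 45) - cell 1 (reg 45)).eval (m₁.write 50 i (min (D i) A)) =
        min (D i) A - d i := by
      simp [h45, e1]
    rw [hev', eval_reg]
    set m₂ := (m₁.write 50 i (min (D i) A)).write 51 (m₁.write 50 i (min (D i) A) 45 0)
      (min (D i) A - d i) with hm₂
    have hF₂ : Frame [45, 49, 50, 51] m m₂ := (hF.write (by decide)).write (by decide)
    have a50 : ∀ i' < i + 1, m₂ 50 i' = min (D i') A := fun i' hi' => by
      rcases Nat.lt_succ_iff_lt_or_eq.1 hi' with hi' | rfl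
      · have : i' ≠ i := by omega
        simp only [hm₂, Mem.write_apply]
        simp [this, h1 i' hi']
      · simp [hm₂]
    have a51 : ∀ i' < i + 1, m₂ 51 i' = min (D i') A - d i' := fun i' hi' => by
      rcases Nat.lt_succ_iff_lt_or_eq.1 hi' with hi' | rfl
      · have : i' ≠ i := by omega
        simp only [hm₂, Mem.write_apply]
        simp [h45, this, h2 i' hi']
      · simp [hm₂, h45]
    have a45 : m₂ 45 = m₁ 45 := by simp [hm₂]
    have a49 : m₂ 49 = m₁ 49 := by simp [hm₂]
    have hev'' : (cell 1 (reg 45) - cell 50 (reg 45)).eval m₂ = d i - min (D i) A := by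
      rw [eval_sub, eval_cell, eval_cell, eval_reg, a45, h45, a50 i (by omega)]
      simp [hm₂, e1]
    refine ensures_ite (fun he => ensures_set ⟨?_, ?_, ?_, ?_, ?_, ?_⟩)
      fun he => ensures_skip ⟨?_, ?_, ?_, ?_, ?_, ?_⟩
    · simp [a45, h45]
    · simp [a45, h45']
    · exact (hF₂.write (by decide)).write (by decide)
    · simpa using a50
    · simpa using a51
    · rw [hev''] at he
      have : ¬ ∀ i' < i + 1, d i' ≤ min (D i') A := fun h => by
        have := h i (by omega)
        omega
      simp only [this, iff_false]
      simp
    · simp [a45, h45]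
    · simp [a45, h45']
    · exact hF₂.write (by decide)
    · simpa using a50
    · simpa using a51
    · rw [hev''] at he
      rw [Mem.write_apply, if_neg (by decide), a49, h3]
      constructor
      · intro h i' hi'
        rcases Nat.lt_succ_iff_lt_or_eq.1 hi' with hi' | rfl
        · exact h i' hi'
        · omega
      · exact fun h i' hi' => h i' (by omega)
  · rintro m' ⟨hF, h1, h2, h3⟩ -
    exact h m' hF h1 h2 h3

end RAM


/-! ## Tables of columns and types -/

namespace RAM

open Cmd LetterSum

variable {N : ℕ} {m : Mem} {Q : Mem → Prop} {k L σ : ℕ} {tbl str d D : ℕ → ℕ}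

/-- The distance of the letter `q` and the character with number `s`. -/
def letterDist (σ : ℕ) (tbl : ℕ → ℕ) (q s : ℕ) : ℕ := if s = 0 then 0 else tbl (q * σ + (s - 1))

/-- The vector of the distances of the letter `q` and the characters of column `j`, followed by the
sum of these distances. -/
def colVec (k L σ : ℕ) (tbl str : ℕ → ℕ) (j q h : ℕ) : ℕ :=
  if h < k then letterDist σ tbl q (str (h * L + j))
  else if h = k then ∑ i ∈ Finset.range k, letterDist σ tbl q (str (i * L + j)) else 0

/-- The number of column `j`, read in base `σ + 1`. -/
def colKey (k L σ : ℕ) (str : ℕ → ℕ) (j : ℕ) : ℕ := code (σ + 1) k fun h => str (h * L + j)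

/-- A distance to string i enters coordinate i and the total in coordinate k. Weighting it with B^i
+ B^k gives the whole code in one pass over the column. -/
theorem code_colVec (B j q : ℕ) : code B (k + 1) (colVec k L σ tbl str j q) =
    ∑ i ∈ Finset.range k, letterDist σ tbl q (str (i * L + j)) * (B ^ i + B ^ k) := by
  rw [code_succ, code]
  simp only [mul_add, Finset.sum_add_distrib, ← Finset.sum_mul]
  congr 1
  · refine Finset.sum_congr rfl fun i hi => ?_
    simp [colVec, Finset.mem_range.1 hi]
  · simp [colVec]

/-- The characters are digits below σ+1, so columns with the same number are equal. One
representative per number therefore suffices for the tables. -/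
theorem colVec_congr {j j' : ℕ} (hs : ∀ a, str a ≤ σ) (h : colKey k L σ str j = colKey k L σ str j')
    (q : ℕ) : colVec k L σ tbl str j q = colVec k L σ tbl str j' q := by
  have := code_injective (fun i _ => Nat.lt_succ_of_le (hs _)) (fun i _ => Nat.lt_succ_of_le (hs _)) h
  funext i
  unfold colVec
  split_ifs with h1 h2
  · rw [this i h1]
  · exact Finset.sum_congr rfl fun i hi => by rw [this i (Finset.mem_range.1 hi)]
  · rfl

theorem colKey_lt (hs : ∀ a, str a ≤ σ) (j : ℕ) : colKey k L σ str j < (σ + 1) ^ k :=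
  code_lt fun _ _ => Nat.lt_succ_of_le (hs _)

theorem letterDist_le (hs : ∀ a, str a ≤ σ) {q : ℕ} (hq : q < σ) (a : ℕ) :
    letterDist σ tbl q (str a) ≤ ∑ i ∈ Finset.range (σ * σ), tbl i := by
  unfold letterDist
  split_ifs with h
  · exact Nat.zero_le _
  · refine Finset.single_le_sum (f := tbl) (fun _ _ => Nat.zero_le _) (Finset.mem_range.2 ?_)
    have := hs a
    have : (q + 1) * σ ≤ σ * σ := Nat.mul_le_mul_right _ hq
    rw [add_mul, one_mul] at this
    omega

/-- Compute the number of the column in register `52`. -/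
def keyCmd : Cmd :=
  set 53 0 ;; set 54 (reg 52) ;; rep 45 kE (
    mulTo 29 (cell 46 (reg 45)) (cell 4 (reg 54)) ;; set 53 (reg 53 + reg 29) ;;
    set 54 (reg 54 + lenE))

theorem ensures_keyCmd (hI : Input k L σ tbl str d D m) (hs : ∀ a, str a ≤ σ) (hk : k ≤ N)
    (hσ : σ ≤ N) (hp : ∀ i ≤ k, m 46 i = (σ + 1) ^ i) {j : ℕ} (hj : m 52 0 = j)
    (h : ∀ m', Frame [29, 30, 31, 32, 33, 45, 53, 54] m m' → m' 53 0 = colKey k L σ str j → Q m') :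
    Ensures N keyCmd m Q := by
  refine ensures_set_seq (ensures_set_seq (ensures_rep k (fun i m' =>
    Frame [29, 30, 31, 32, 33, 45, 53, 54] m m' ∧
    m' 53 0 = code (σ + 1) i (fun h => str (h * L + j)) ∧ m' 54 0 = i * L + j) (by simp [hI.k_eq])
    hk ?_ ?_ ?_))
  · refine ⟨?_, by simp [code], by simp [hj]⟩
    exact ((((Frame.refl _ m).write (by decide)).write (by decide)).write (by decide)).write
      (by decide)
  · rintro i hi m₁ ⟨hF, h1, h2⟩ h45 h45'
    refine ensures_seq (ensures_mulTo ((σ + 1) ^ i) (str (i * L + j)) ?_ ?_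
      ((hs _).trans hσ) ?_)
    · simp [h45, hF 46 (by decide), hp i hi.le]
    · simp [h2, hF 4 (by decide), hI.str_eq]
    · intro m₂ hF' h29
      have hF₂ := hF.trans hF' (by decide)
      refine ensures_set_seq (ensures_set ⟨?_, ?_, ?_, ?_, ?_⟩)
      · simp [hF' 45 (by decide), h45]
      · simp [hF' 45 (by decide), h45']
      · exact ((hF₂.write (by decide)).write (by decide)).write (by decide)
      · simp [hF' 53 (by decide), h1, h29, code_succ, mul_comm]
      · simp [hF' 54 (by decide), h2, hF₂ 0 (by decide), hI.L_eq]
        ring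
  · rintro m' ⟨hF, h1, -⟩ -
    exact h m' hF h1

/-- Compute the code of the distances of column `j`, in register `52`, from the letter `q`, where
register `61` holds `q * σ`. -/
def valueCmd : Cmd :=
  set 60 0 ;; set 54 (reg 52) ;; rep 45 kE (
    ite (cell 4 (reg 54))
      (mulTo 29 (cell 44 (reg 45) + cell 44 kE) (cell 3 (reg 61 + (cell 4 (reg 54) - 1))) ;;
        set 60 (reg 60 + reg 29)) skip ;;
    set 54 (reg 54 + lenE))

theorem ensures_valueCmd (hI : Input k L σ tbl str d D m) (hs : ∀ a, str a ≤ σ) (hk : k ≤ N)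
    (hS : tblSum σ tbl ≤ N) {B : ℕ} (hp : ∀ i ≤ k, m 44 i = B ^ i) {j q : ℕ} (hj : m 52 0 = j)
    (hq : m 61 0 = q * σ) (hqσ : q < σ)
    (h : ∀ m', Frame [29, 30, 31, 32, 33, 45, 54, 60] m m' →
      m' 60 0 = code B (k + 1) (colVec k L σ tbl str j q) → Q m') :
    Ensures N valueCmd m Q := by
  refine ensures_set_seq (ensures_set_seq (ensures_rep k (fun i m' =>
    Frame [29, 30, 31, 32, 33, 45, 54, 60] m m' ∧
    m' 60 0 = ∑ i ∈ Finset.range i, letterDist σ tbl q (str (i * L + j)) * (B ^ i + B ^ k) ∧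
    m' 54 0 = i * L + j) (by simp [hI.k_eq])
    hk ?_ ?_ ?_))
  · refine ⟨?_, by simp, by simp [hj]⟩
    exact ((((Frame.refl _ m).write (by decide)).write (by decide)).write (by decide)).write
      (by decide)
  · rintro i hi m₁ ⟨hF, h1, h2⟩ h45 h45'
    have e4 : m₁ 4 (i * L + j) = str (i * L + j) := by rw [hF 4 (by decide), hI.str_eq]
    refine ensures_seq (ensures_ite (fun he => ?_) fun he => ?_)
    · have he : str (i * L + j) ≠ 0 := by simpa [h2, e4] using he
      have hd : letterDist σ tbl q (str (i * L + j)) = tbl (q * σ + (str (i * L + j) - 1)) :=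
        if_neg he
      refine ensures_seq (ensures_mulTo (B ^ i + B ^ k) (letterDist σ tbl q (str (i * L + j)))
        ?_ ?_ ?_ ?_)
      · simp [h45, hF 44 (by decide), hp i hi.le, hp k le_rfl, hF 0 (by decide), hI.k_eq]
      · simp [h2, e4, hF 61 (by decide), hq, hF 3 (by decide), hI.tbl_eq, hd]
      · have := letterDist_le (tbl := tbl) hs hqσ (i * L + j)
        unfold tblSum at hS
        omega
      · intro m₂ hF' h29
        have hF₂ := hF.trans hF' (by decide)
        refine ensures_set (ensures_set ⟨?_, ?_, ?_, ?_, ?_⟩)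
        · simp [hF' 45 (by decide), h45]
        · simp [hF' 45 (by decide), h45']
        · exact ((hF₂.write (by decide)).write (by decide)).write (by decide)
        · simp [hF' 60 (by decide), h1, h29, Finset.sum_range_succ, mul_comm]
        · simp [hF' 54 (by decide), h2, hF₂ 0 (by decide), hI.L_eq]
          ring
    · have he : str (i * L + j) = 0 := by simpa [h2, e4] using he
      refine ensures_skip (ensures_set ⟨?_, ?_, ?_, ?_, ?_⟩)
      · simp [h45]
      · simp [h45']
      · exact (hF.write (by decide)).write (by decide)
      · simp [h1, Finset.sum_range_succ, letterDist, he]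
      · simp [h2, hF 0 (by decide), hI.L_eq]
        ring
  · rintro m' ⟨hF, h1, -⟩ -
    exact h m' hF (h1.trans (code_colVec B j q).symm)

/-- Compute the numbers of all columns in bank `55`, a representative of each kind of columns in
bank `56`, and the codes of all distances in bank `57`. -/
def columnsCmd : Cmd :=
  set 58 0 ;; rep 52 lenE (
    keyCmd ;; store 55 (reg 52) (reg 53) ;; store 56 (reg 53) (reg 58) ;; set 61 0 ;;
    rep 59 sigE (
      valueCmd ;; store 57 (reg 58) (reg 60) ;; set 58 (reg 58 + 1) ;; set 61 (reg 61 + sigE)))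

/-- The banks changed by `columnsCmd`. -/
abbrev columnsBanks : List ℕ := [29, 30, 31, 32, 33, 45, 52, 53, 54, 55, 56, 57, 58, 59, 60, 61]

/-- The representative `r p` is the last column with number `p`, or column 0 if there is none. As L
is positive, it always names an actual column, so the tables can be read without a case distinction.
-/
theorem ensures_columnsCmd (hI : Input k L σ tbl str d D m) (hs : ∀ a, str a ≤ σ) (hk : k ≤ N)
    (hσ : σ ≤ N) (hL : L ≤ N) (hL0 : 0 < L)
    (hS : tblSum σ tbl ≤ N) {B : ℕ} (hp : ∀ i ≤ k, m 44 i = B ^ i)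
    (hp' : ∀ i ≤ k, m 46 i = (σ + 1) ^ i) (h56 : ∀ a, m 56 a = 0)
    (h : ∀ m', Frame columnsBanks m m' → (∀ j < L, m' 55 j = colKey k L σ str j) →
      (∀ j < L, ∀ q < σ, m' 57 (j * σ + q) = code B (k + 1) (colVec k L σ tbl str j q)) →
      (∃ r : ℕ → ℕ, (∀ p, r p < L) ∧ (∀ p, m' 56 p = r p * σ) ∧
        ∀ j < L, colKey k L σ str (r (colKey k L σ str j)) = colKey k L σ str j) → Q m') :
    Ensures N columnsCmd m Q := by
  have hdiv : ∀ j q, q < σ → (j * σ + q) / σ = j := fun j q hq => by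
    rw [mul_comm, Nat.mul_add_div (by omega), Nat.div_eq_of_lt hq, add_zero]
  have hmod : ∀ j q, q < σ → (j * σ + q) % σ = q := fun j q hq => by
    rw [mul_comm, Nat.mul_add_mod, Nat.mod_eq_of_lt hq]
  set G : ℕ → ℕ := fun a => code B (k + 1) (colVec k L σ tbl str (a / σ) (a % σ)) with hG
  refine ensures_set_seq (ensures_rep L (fun j m' => Frame columnsBanks m m' ∧
    m' 58 0 = j * σ ∧ (∀ i < j, m' 55 i = colKey k L σ str i) ∧ (∀ a < j * σ, m' 57 a = G a) ∧
    ∃ r : ℕ → ℕ, (∀ p, r p < L) ∧ (∀ p, m' 56 p = r p * σ) ∧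
        ∀ i < j, colKey k L σ str (r (colKey k L σ str i)) = colKey k L σ str i)
    (by simp [hI.L_eq]) hL ?_ ?_ ?_)
  · refine ⟨(((Frame.refl _ m).write (by decide)).write (by decide)).write (by decide),
      by simp, by simp, by simp, fun _ => 0, fun _ => hL0, by simp [h56], by simp⟩
  · rintro j hj m₁ ⟨hF, h1, h2, h3, r, r1, r2, r3⟩ h52 h52'
    refine ensures_seq (ensures_keyCmd (hI.frame hF (by decide)) hs hk hσ
      (by simpa [hF 46 (by decide)] using hp') h52 ?_)
    intro m₂ hF' h53
    have hF₂ := hF.trans hF' (by decide)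
    refine ensures_store_seq (ensures_store_seq (ensures_set_seq ?_))
    have e58 : m₂ 58 0 = j * σ := by rw [hF' 58 (by decide), h1]
    have e52 : m₂ 52 = m₁ 52 := hF' 52 (by decide)
    simp only [eval_reg, eval_zero, Mem.write_apply, Nat.reduceEqDiff, if_false, h53, e58, e52, h52]
    set κ := colKey k L σ str with hκ
    set m₃ := ((m₂.write 55 j (κ j)).write 56 (κ j) (j * σ)).write 61 0 0 with hm₃
    have hF₃ : Frame columnsBanks m m₃ :=
      ((hF₂.write (by decide)).write (by decide)).write (by decide)
    refine ensures_rep σ (fun q m' => Frame columnsBanks m m' ∧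
      Frame [29, 30, 31, 32, 33, 45, 54, 57, 58, 59, 60, 61] m₃ m' ∧
      m' 58 0 = j * σ + q ∧ m' 61 0 = q * σ ∧ ∀ a < j * σ + q, m' 57 a = G a)
      (by simp [hF₃ 0 (by decide), hI.σ_eq]) hσ ?_ ?_ ?_
    · refine ⟨(hF₃.write (by decide)).write (by decide),
        ((Frame.refl _ m₃).write (by decide)).write (by decide), ?_, ?_, ?_⟩
      · simp [hm₃, e58]
      · simp [hm₃]
      · simpa [hm₃, hF' 57 (by decide)] using h3
    · rintro q hq m₄ ⟨hF₄, hF₄', a1, a2, a3⟩ h59 h59'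
      refine ensures_seq (ensures_valueCmd (hI.frame hF₄ (by decide)) hs hk hS (B := B)
        (by simpa [hF₄ 44 (by decide)] using hp) (j := j) ?_ a2 hq ?_)
      · simp [hF₄' 52 (by decide), hm₃, e52, h52]
      intro m₅ hF₅ h60
      refine ensures_store_seq (ensures_set_seq (ensures_set ⟨?_, ?_, ?_, ?_, ?_, ?_, ?_⟩))
      · simp [hF₅ 59 (by decide), h59]
      · simp [hF₅ 59 (by decide), h59']
      · exact ((((hF₄.trans hF₅ (by decide)).write (by decide)).write (by decide)).write
          (by decide)).write (by decide)
      · exact ((((hF₄'.trans hF₅ (by decide)).write (by decide)).write (by decide)).write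
          (by decide)).write (by decide)
      · simp [hF₅ 58 (by decide), a1, add_assoc]
      · simp [hF₅ 61 (by decide), a2, hF₅ 0 (by decide), hF₄ 0 (by decide), hI.σ_eq, add_mul]
      · intro a ha
        rw [← add_assoc] at ha
        rcases Nat.lt_succ_iff_lt_or_eq.1 ha with ha | rfl
        · have : a ≠ j * σ + q := by omega
          simp [hF₅ 58 (by decide), hF₅ 57 (by decide), a1, this, a3 a ha]
        · simp [hF₅ 58 (by decide), a1, h60, hG, hdiv j q hq, hmod j q hq]
    · rintro m₄ ⟨hF₄, hF₄', a1, -, a3⟩ -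
      refine ⟨?_, ?_, hF₄.write (by decide), ?_, ?_, ?_, Function.update r (κ j) j, ?_, ?_, ?_⟩
      · simp [hF₄' 52 (by decide), hm₃, e52, h52]
      · simp [hF₄' 52 (by decide), hm₃, e52, h52']
      · simp [a1, add_mul]
      · intro i hi
        rcases Nat.lt_succ_iff_lt_or_eq.1 hi with hi | rfl
        · have : i ≠ j := by omega
          simp [hF₄' 55 (by decide), hm₃, this, hF' 55 (by decide), h2 i hi]
        · simp [hF₄' 55 (by decide), hm₃]
      · rw [add_mul, one_mul]
        simpa using a3
      · intro p
        by_cases hp : p = κ j <;> simp [hp, hj, r1]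
      · intro p
        by_cases hp : p = κ j <;> simp [hp, hF₄' 56 (by decide), hm₃, hF' 56 (by decide), r2]
      · intro i hi
        by_cases hp : κ i = κ j
        · simp [hp]
        · have : i ≠ j := fun h => hp (by rw [h])
          rw [Function.update_of_ne hp]
          exact r3 i (by omega)
  · rintro m' ⟨hF, h1, h2, h3, h4⟩ -
    refine h m' hF h2 (fun j hj q hq => ?_) h4
    have : (j + 1) * σ ≤ L * σ := Nat.mul_le_mul_right _ hj
    rw [add_mul, one_mul] at this
    rw [h3 _ (by omega), hG]
    simp only [hdiv j q hq, hmod j q hq]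

/-! ### Types with prescribed letters and the table of their vectors -/

/-- The vectors of the types: `p + f * (σ + 1) ^ k` is the type of the columns with number `p` for
`f = 0`, and of such columns with the prescribed letter `f - 1` otherwise. These types are followed
by those of the slacks. -/
def typeVec (k L σ : ℕ) (tbl str r : ℕ → ℕ) (p q h : ℕ) : ℕ :=
  if p < numTypes k σ then
    colVec k L σ tbl str (r (p % (σ + 1) ^ k))
      (if p / (σ + 1) ^ k = 0 then q else p / (σ + 1) ^ k - 1) h
  else if q ≠ 0 ∧ h = p - numTypes k σ then 1 else 0

/-- Write the codes of the vectors of all types to bank `62`. -/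
def rowsCmd : Cmd :=
  set 63 0 ;;
  rep 64 (sigE + 1) (rep 65 (cell 46 kE) (rep 59 sigE (
    ite (reg 64) (set 66 (reg 64 - 1)) (set 66 (reg 59)) ;;
    store 62 (reg 63) (cell 57 (cell 56 (reg 65) + reg 66)) ;; set 63 (reg 63 + 1)))) ;;
  rep 45 kE (rep 59 sigE (
    ite (reg 59) (store 62 (reg 63) (cell 44 (reg 45))) (store 62 (reg 63) 0) ;;
    set 63 (reg 63 + 1)))

/-- The first `n` cells of bank `62` agree with `G`, and register `63` points behind them. -/
def Filled (G : ℕ → ℕ) (n : ℕ) (m : Mem) : Prop := m 63 0 = n ∧ ∀ a < n, m 62 a = G a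

theorem Filled.step {G : ℕ → ℕ} {n v : ℕ} (h : Filled G n m) (hv : v = G n) :
    Filled G (n + 1) ((m.write 62 n v).write 63 0 (n + 1)) := by
  refine ⟨by simp, fun a ha => ?_⟩
  rcases Nat.lt_succ_iff_lt_or_eq.1 ha with ha | rfl
  · have : a ≠ n := by omega
    simp [this, h.2 a ha]
  · simp [hv]

/-- The banks changed by `rowsCmd`. -/
abbrev rowsBanks : List ℕ := [45, 59, 62, 63, 64, 65, 66]

theorem code_unit {B i : ℕ} (hi : i < k) :
    code B (k + 1) (fun h => if h = i then 1 else 0) = B ^ i := by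
  rw [code, Finset.sum_eq_single i]
  · simp
  · intro b _ hb
    simp [hb]
  · intro h
    simp at h
    omega

/-- The nested loops visit the addresses of bank 62 in increasing order, so a single pointer
suffices. Division and remainder occur only in `G`, which describes the finished table, and not in
the program. -/
theorem ensures_rowsCmd (hI : Input k L σ tbl str d D m) (hk : k ≤ N) (hσ : σ + 1 ≤ N)
    {B : ℕ} {r : ℕ → ℕ} (hT : (σ + 1) ^ k ≤ N)
    (hp : ∀ i ≤ k, m 44 i = B ^ i) (hp' : ∀ i ≤ k, m 46 i = (σ + 1) ^ i) (hr : ∀ p, r p < L)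
    (h56 : ∀ p, m 56 p = r p * σ)
    (h57 : ∀ j < L, ∀ q < σ, m 57 (j * σ + q) = code B (k + 1) (colVec k L σ tbl str j q))
    (h : ∀ m', Frame rowsBanks m m' → (∀ p < numTypes k σ + k, ∀ q < σ,
      m' 62 (p * σ + q) = code B (k + 1) (typeVec k L σ tbl str r p q)) → Q m') :
    Ensures N rowsCmd m Q := by
  have hdiv : ∀ j q, q < σ → (j * σ + q) / σ = j := fun j q hq => by
    rw [mul_comm, Nat.mul_add_div (by omega), Nat.div_eq_of_lt hq, add_zero]
  have hmod : ∀ j q, q < σ → (j * σ + q) % σ = q := fun j q hq => by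
    rw [mul_comm, Nat.mul_add_mod, Nat.mod_eq_of_lt hq]
  set G : ℕ → ℕ := fun a => code B (k + 1) (typeVec k L σ tbl str r (a / σ) (a % σ)) with hG
  set T₀ := (σ + 1) ^ k with hT₀
  refine ensures_set_seq (Ensures.seq (R := fun m' => Frame rowsBanks m m' ∧
    Filled G (numTypes k σ * σ) m') ?_ ?_)
  · refine ensures_rep (σ + 1) (fun f m' => Frame rowsBanks m m' ∧ Filled G (f * T₀ * σ) m')
      (by simp [hI.σ_eq]) hσ ?_ ?_ ?_
    · refine ⟨(((Frame.refl _ m).write (by decide)).write (by decide)).write (by decide), ?_⟩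
      simp [Filled]
    · rintro f hf m₁ ⟨hF₁, h1⟩ h64 h64'
      refine ensures_rep T₀ (fun p m' => Frame rowsBanks m m' ∧ m' 64 = m₁ 64 ∧
        Filled G ((f * T₀ + p) * σ) m') ?_ hT ?_ ?_ ?_
      · simp [hF₁ 0 (by decide), hI.k_eq, hF₁ 46 (by decide), hp' k le_rfl, hT₀]
      · refine ⟨(hF₁.write (by decide)).write (by decide), by simp, ?_⟩
        simpa [Filled] using h1
      · rintro p hp m₂ ⟨hF₂, e64, h2⟩ h65 h65'
        refine ensures_rep σ (fun q m' => Frame rowsBanks m m' ∧ m' 64 = m₁ 64 ∧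
          m' 65 = m₂ 65 ∧ Filled G ((f * T₀ + p) * σ + q) m')
          (by simp [hF₂ 0 (by decide), hI.σ_eq]) (by omega) ?_ ?_ ?_
        · refine ⟨(hF₂.write (by decide)).write (by decide), by simp [e64], by simp, ?_⟩
          simpa [Filled] using h2
        · rintro q hq m₃ ⟨hF₃, e64', e65, h3⟩ h59 h59'
          -- For positive f the letter is prescribed, so all σ entries of the row agree.
          set q' := if f = 0 then q else f - 1 with hq'
          refine Ensures.seq (R := fun m' => m' = m₃.write 66 0 q') ?_ ?_
          · refine ensures_ite (fun he => ensures_set ?_) fun he => ensures_set ?_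
            · have : f ≠ 0 := by simpa [e64', h64] using he
              simp [hq', this, e64', h64]
            · have : f = 0 := by simpa [e64', h64] using he
              simp [hq', this, h59]
          rintro _ rfl
          refine ensures_store_seq (ensures_set ?_)
          have ev : (cell 57 (cell 56 (reg 65) + reg 66)).eval (m₃.write 66 0 q') =
              G ((f * T₀ + p) * σ + q) := by
            have hq'σ : q' < σ := by
              rw [hq']
              split_ifs <;> omega
            have hlt : f * T₀ + p < numTypes k σ := by
              have : (f + 1) * T₀ ≤ (σ + 1) * T₀ := Nat.mul_le_mul_right _ hf
              rw [numTypes, ← hT₀, mul_comm T₀]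
              rw [add_mul, one_mul] at this
              omega
            have d1 : (f * T₀ + p) / T₀ = f := by
              rw [mul_comm, Nat.mul_add_div (by omega), Nat.div_eq_of_lt hp, add_zero]
            have d2 : (f * T₀ + p) % T₀ = p := by
              rw [mul_comm, Nat.mul_add_mod, Nat.mod_eq_of_lt hp]
            have : G ((f * T₀ + p) * σ + q) =
                code B (k + 1) (colVec k L σ tbl str (r p) q') := by
              simp only [hG, hdiv _ q hq, hmod _ q hq]
              refine code_congr fun i _ => ?_
              rw [typeVec, if_pos hlt, ← hT₀, d1, d2]
            rw [this, ← h57 _ (hr p) q' hq'σ]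
            simp [e65, h65, hF₃ 56 (by decide), hF₃ 57 (by decide), h56]
          rw [ev]
          have e63 : m₃ 63 0 = (f * T₀ + p) * σ + q := h3.1
          have h3' : Filled G ((f * T₀ + p) * σ + q) (m₃.write 66 0 q') := by
            simpa [Filled] using h3
          have h4 := h3'.step rfl
          refine ⟨by simp [h59], by simp [h59'], ?_, by simp [e64'], by simp [e65], ?_⟩
          · exact (((hF₃.write (by decide)).write (by decide)).write (by decide)).write (by decide)
          · simpa [Filled, e63, add_assoc] using h4
        · rintro m₃ ⟨hF₃, e64', e65, h3⟩ -
          refine ⟨by rw [e65, h65], by rw [e65, h65'], hF₃.write (by decide), by simp [e64'], ?_⟩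
          rw [← add_assoc, add_mul _ 1, one_mul]
          simpa [Filled] using h3
      · rintro m₂ ⟨hF₂, e64, h2⟩ -
        refine ⟨by rw [e64, h64], by rw [e64, h64'], hF₂.write (by decide), ?_⟩
        rw [add_mul, one_mul]
        simpa [Filled] using h2
    · rintro m₁ ⟨hF₁, h1⟩ -
      refine ⟨hF₁, ?_⟩
      rwa [numTypes, ← hT₀, mul_comm T₀]
  · rintro m₁ ⟨hF₁, h1⟩
    refine ensures_rep k (fun i m' => Frame rowsBanks m m' ∧
      Filled G ((numTypes k σ + i) * σ) m') (by simp [hF₁ 0 (by decide), hI.k_eq]) hk ?_ ?_ ?_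
    · refine ⟨(hF₁.write (by decide)).write (by decide), ?_⟩
      simpa [Filled] using h1
    · rintro i hi m₂ ⟨hF₂, h2⟩ h45 h45'
      refine ensures_rep σ (fun q m' => Frame rowsBanks m m' ∧ m' 45 = m₂ 45 ∧
          Filled G ((numTypes k σ + i) * σ + q) m')
          (by simp [hF₂ 0 (by decide), hI.σ_eq]) (by omega) ?_ ?_ ?_
      · refine ⟨(hF₂.write (by decide)).write (by decide), by simp, ?_⟩
        simpa [Filled] using h2
      · rintro q hq m₃ ⟨hF₃, e45, h3⟩ h59 h59'
        have e63 : m₃ 63 0 = (numTypes k σ + i) * σ + q := h3.1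
        have hGv : G ((numTypes k σ + i) * σ + q) = if q = 0 then 0 else B ^ i := by
          simp only [hG, hdiv _ q hq, hmod _ q hq]
          rw [← code_unit (B := B) hi]
          split_ifs with hq0
          · exact Finset.sum_eq_zero fun x _ => by simp [typeVec, hq0]
          · exact code_congr fun x _ => by simp [typeVec, hq0]
        refine Ensures.seq (R := fun m' => m' = m₃.write 62 ((numTypes k σ + i) * σ + q)
          (G ((numTypes k σ + i) * σ + q))) ?_ ?_
        · rw [hGv]
          refine ensures_ite (fun he => ensures_store ?_) fun he => ensures_store ?_
          · have : q ≠ 0 := by simpa [h59] using he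
            simp [this, e63, e45, h45, hF₃ 44 (by decide), hp i hi.le]
          · have : q = 0 := by simpa [h59] using he
            simp [this, e63]
        rintro _ rfl
        have h4 := h3.step rfl
        refine ensures_set ⟨by simp [h59], by simp [h59'], ?_, by simp [e45], ?_⟩
        · exact ((hF₃.write (by decide)).write (by decide)).write (by decide)
        · simpa [Filled, e63, add_assoc] using h4
      · rintro m₃ ⟨hF₃, e45, h3⟩ -
        refine ⟨by rw [e45, h45], by rw [e45, h45'], hF₃.write (by decide), ?_⟩
        rw [← add_assoc, add_mul _ 1, one_mul]
        simpa [Filled] using h3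
    · rintro m₂ ⟨hF₂, h2⟩ -
      refine h m₂ hF₂ fun p hp q hq => ?_
      have : (p + 1) * σ ≤ (numTypes k σ + k) * σ := Nat.mul_le_mul_right _ hp
      rw [add_mul, one_mul] at this
      rw [h2.2 _ (by omega), hG]
      simp only [hdiv p q hq, hmod p q hq]

end RAM


/-! ## The window, and all preparations together -/

namespace RAM

open Cmd LetterSum

variable {N : ℕ} {m : Mem} {Q : Mem → Prop} {k L σ : ℕ} {tbl str d D : ℕ → ℕ}

/-- List the multiples of the power `B ^ h` for the window in bank `73`, where `h` is in register
`72`. -/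
def multiplesCmd : Cmd :=
  set 74 (reg 69 + reg 69 + 1) ;;
  rep 45 (reg 74) (mulTo 29 (cell 44 (reg 72)) (reg 45) ;; store 73 (reg 45) (reg 29))

theorem ensures_multiplesCmd {M x : ℕ} (hM : m 69 0 = M) (hN : 2 * M + 1 ≤ N)
    (hx : m 44 (m 72 0) = x)
    (h : ∀ m', Frame [29, 30, 31, 32, 33, 45, 73, 74] m m' → m' 74 0 = 2 * M + 1 →
      (∀ e < 2 * M + 1, m' 73 e = x * e) → Q m') : Ensures N multiplesCmd m Q := by
  refine ensures_set_seq (ensures_rep (2 * M + 1) (fun e m' =>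
    Frame [29, 30, 31, 32, 33, 45, 73, 74] m m' ∧ m' 74 0 = 2 * M + 1 ∧ ∀ e' < e, m' 73 e' = x * e')
    ?_ hN ?_ ?_ ?_)
  · simp [hM]
    omega
  · refine ⟨(((Frame.refl _ m).write (by decide)).write (by decide)).write (by decide), ?_, by simp⟩
    simp [hM]
    omega
  · rintro e he m₁ ⟨hF, h1, h2⟩ h45 h45'
    refine ensures_seq (ensures_mulTo x e (by simp [hF 44 (by decide), hF 72 (by decide), hx])
      (by simp [h45]) (by omega) ?_)
    intro m₂ hF' h29
    refine ensures_store ⟨by simp [hF' 45 (by decide), h45], by simp [hF' 45 (by decide), h45'],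
      ((hF.trans hF' (by decide)).write (by decide)).write (by decide),
      by simp [hF' 74 (by decide), h1], fun e' he' => ?_⟩
    rcases Nat.lt_succ_iff_lt_or_eq.1 he' with he' | rfl
    · have : e' ≠ e := by omega
      simp [hF' 45 (by decide), h45, this, hF' 73 (by decide), h2 e' he']
    · simp [hF' 45 (by decide), h45, h29]
  · rintro m' ⟨hF, h1, h2⟩ -
    exact h m' hF h1 h2

/-- Mark the members of the window in bank `76`. -/
def windowCmd : Cmd :=
  store 70 0 0 ;; set 71 1 ;; set 79 1 ;;
  rep 72 (kE + 1) (multiplesCmd ;; sumsetCmd) ;;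
  rep 45 (reg 71) (store 76 (cell 70 (reg 45) + 1) 1) ;;
  set 79 0 ;; set 77 1 ;;
  rep 45 (kE + 1) (mulTo 29 (cell 44 (reg 45)) (reg 69) ;; set 77 (reg 77 + reg 29))

/-- The banks changed by `windowCmd`. -/
abbrev windowBanks : List ℕ :=
  [29, 30, 31, 32, 33, 45, 70, 71, 72, 73, 74, 76, 77, 79, 80, 81, 82, 83, 84, 85, 86]

/-- The window is the sum of the segments {0, B^h, …, 2M·B^h}, so the sumset program can produce it
once its test is disabled. -/
theorem sumFilter_windowCodes (B M h : ℕ) : sumFilter (fun _ => True) (windowCodes B M h)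
    ((Finset.range (2 * M + 1)).image fun e => B ^ h * e) = windowCodes B M (h + 1) := by
  ext x
  simp [mem_sumFilter, windowCodes, Finset.mem_image₂]

/-- While the window is being generated, register 79 is 1 and every sum passes the test. Resetting
it to 0 hands the test over to the marks in bank 76. -/
theorem ensures_windowCmd {B M : ℕ} (hk : m 0 0 = k) (hM : m 69 0 = M)
    (hp : ∀ i ≤ k, m 44 i = B ^ i) (hz : ∀ a, m 76 a = 0) (hs : ∀ x, m 82 x ≤ m 83 0)
    (hkN : k + 1 ≤ N) (hW : (2 * M + 1) ^ (k + 1) ≤ N)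
    (h : ∀ m', Frame windowBanks m m' → (∀ x, m' 82 x ≤ m' 83 0) →
      (∀ a, m' 76 a ≠ 0 ↔ ∃ e ∈ windowCodes B M (k + 1), a = e + 1) →
      m' 77 0 = code B (k + 1) (fun _ => M) + 1 → m' 79 0 = 0 → Q m') :
    Ensures N windowCmd m Q := by
  have hpow : ∀ i ≤ k + 1, (2 * M + 1) ^ i ≤ N := fun i hi =>
    (Nat.pow_le_pow_right (by omega) hi).trans hW
  have hMN : 2 * M + 1 ≤ N := by simpa using hpow 1 (by omega)
  refine ensures_store_seq (ensures_set_seq (ensures_set_seq ?_))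
  refine Ensures.seq (R := fun m' => Frame windowBanks m m' ∧ (∀ x, m' 82 x ≤ m' 83 0) ∧
    m' 76 = m 76 ∧ Listed 70 71 (windowCodes B M (k + 1)) m') ?_ ?_
  · refine ensures_rep (k + 1) (fun i m' => Frame windowBanks m m' ∧ (∀ x, m' 82 x ≤ m' 83 0) ∧
      m' 76 = m 76 ∧ Listed 70 71 (windowCodes B M i) m' ∧ m' 79 0 = 1) (by simp [hk]) hkN ?_ ?_ ?_
    · refine ⟨?_, by simpa using hs, by simp, by simp [Listed, windowCodes], by simp⟩
      exact (((((Frame.refl _ m).write (by decide)).write (by decide)).write (by decide)).write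
        (by decide)).write (by decide)
    · rintro i hi m₁ ⟨hF, h1, h2, h3, h4⟩ h72 h72'
      refine ensures_seq (ensures_multiplesCmd (M := M) (x := B ^ i)
        (by rw [hF 69 (by decide), hM]) hMN
        (by rw [h72, hF 44 (by decide), hp i (by omega)]) ?_)
      intro m₂ hF' h74 h73
      have e79 : m₂ 79 0 = 1 := by rw [hF' 79 (by decide), h4]
      refine ensures_sumsetCmd (f := fun _ => True) (A := windowCodes B M i)
        (A' := (Finset.range (2 * M + 1)).image fun e => B ^ i * e) ?_ ?_ ?_ ?_ ?_ ?_ ?_ ?_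
      · simp [e79]
      · simpa [Listed, hF' 70 (by decide), hF' 71 (by decide)] using h3
      · rw [h74]
        exact Finset.image_congr fun e he => h73 e (by simpa using he)
      · simpa [hF' 82 (by decide), hF' 83 (by decide)] using h1
      · exact (card_windowCodes B M i).trans (hpow i (by omega))
      · rw [h74]
        exact hMN
      · rw [sumFilter_windowCodes]
        exact (card_windowCodes B M (i + 1)).trans (hpow (i + 1) (by omega))
      · intro m₃ hF₃ hA hs₃
        rw [sumFilter_windowCodes] at hA
        refine ⟨?_, ?_, ?_, ?_, ?_, ?_, ?_⟩
        · rw [hF₃ 72 (by decide), hF' 72 (by decide), h72]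
        · rw [hF₃ 72 (by decide), hF' 72 (by decide), h72']
        · exact ((hF.trans hF' (by decide)).trans hF₃ (by decide)).write (by decide)
        · simpa using hs₃
        · simp [hF₃ 76 (by decide), hF' 76 (by decide), h2]
        · simpa [Listed] using hA
        · simp [hF₃ 79 (by decide), e79]
    · rintro m' ⟨h1, h2, h3, h4, -⟩ -
      exact ⟨h1, h2, h3, h4⟩
  rintro m₁ ⟨hF₁, h1, h2, h3, h4⟩
  refine Ensures.seq (R := fun m' => Frame [45, 76] m₁ m' ∧
    ∀ a, m' 76 a ≠ 0 ↔ ∃ i < (windowCodes B M (k + 1)).card, a = m₁ 70 i + 1) ?_ ?_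
  · refine ensures_rep (windowCodes B M (k + 1)).card (fun i m' => Frame [45, 76] m₁ m' ∧
      ∀ a, m' 76 a ≠ 0 ↔ ∃ i' < i, a = m₁ 70 i' + 1) (by simp [h3])
      ((card_windowCodes B M (k + 1)).trans hW) ?_ ?_ fun m' h _ => h
    · exact ⟨((Frame.refl _ m₁).write (by decide)).write (by decide), by simp [h2, hz]⟩
    · rintro i hi m₂ ⟨hF, a1⟩ h45 h45'
      refine ensures_store ⟨by simp [h45], by simp [h45'],
        (hF.write (by decide)).write (by decide), fun a => ?_⟩
      by_cases ha : a = m₁ 70 i + 1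
      · have : m₂ 70 (m₂ 45 0) = m₁ 70 i := by rw [h45, hF 70 (by decide)]
        simp only [Mem.write_apply, Nat.reduceEqDiff, if_false, if_true, eval_add, eval_cell,
          eval_reg, eval_one, this, ha, Function.update_self, ne_eq, one_ne_zero,
          not_false_eq_true, true_iff]
        exact ⟨i, by omega, rfl⟩
      · have : m₂ 70 (m₂ 45 0) = m₁ 70 i := by rw [h45, hF 70 (by decide)]
        simp only [Mem.write_apply, Nat.reduceEqDiff, if_false, if_true, eval_add, eval_cell,
          eval_reg, eval_one, this, Function.update_of_ne ha, a1]
        constructor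
        · rintro ⟨i', hi', rfl⟩
          exact ⟨i', by omega, rfl⟩
        · rintro ⟨i', hi', rfl⟩
          refine ⟨i', ?_, rfl⟩
          rcases Nat.lt_succ_iff_lt_or_eq.1 hi' with hi' | rfl
          · exact hi'
          · exact absurd rfl ha
  rintro m₂ ⟨hF₂, h5⟩
  have hF₂' : Frame windowBanks m m₂ := hF₁.trans hF₂ (by decide)
  refine ensures_set_seq (ensures_set_seq (ensures_rep (k + 1) (fun i m' =>
    Frame [29, 30, 31, 32, 33, 45, 77, 79] m₂ m' ∧ m' 79 0 = 0 ∧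
    m' 77 0 = code B i (fun _ => M) + 1) (by simp [hF₂' 0 (by decide), hk]) hkN ?_ ?_ ?_))
  · refine ⟨?_, by simp, by simp [code]⟩
    exact ((((Frame.refl _ m₂).write (by decide)).write (by decide)).write (by decide)).write
      (by decide)
  · rintro i hi m₃ ⟨hF₃, a1, a2⟩ h45 h45'
    have hF₃' := hF₂'.trans hF₃ (by decide)
    refine ensures_seq (ensures_mulTo (B ^ i) M ?_ ?_ (by omega) ?_)
    · simp [h45, hF₃' 44 (by decide), hp i (by omega)]
    · simp [hF₃' 69 (by decide), hM]
    · intro m₄ hF' h29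
      refine ensures_set ⟨by simp [hF' 45 (by decide), h45], by simp [hF' 45 (by decide), h45'],
        ((hF₃.trans hF' (by decide)).write (by decide)).write (by decide),
        by simp [hF' 79 (by decide), a1], ?_⟩
      simp [hF' 77 (by decide), a2, h29, code_succ]
      ring
  · rintro m' ⟨hF₃, a1, a2⟩ -
    refine h m' (hF₂'.trans hF₃ (by decide)) ?_ ?_ a2 a1
    · simpa [hF₃ 82 (by decide), hF₃ 83 (by decide), hF₂ 82 (by decide), hF₂ 83 (by decide)]
        using h1
    · intro a
      rw [hF₃ 76 (by decide), h5]
      generalize windowCodes B M (k + 1) = X at h4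
      constructor
      · rintro ⟨i, hi, rfl⟩
        refine ⟨m₁ 70 i, ?_, rfl⟩
        rw [← h4]
        exact Finset.mem_image_of_mem _ (Finset.mem_range.2 hi)
      · rintro ⟨e, he, rfl⟩
        rw [← h4] at he
        obtain ⟨i, hi, rfl⟩ := Finset.mem_image.1 he
        exact ⟨i, Finset.mem_range.1 hi, rfl⟩

/-- All preparations. -/
def setupCmd : Cmd :=
  paramsCmd ;; powersCmd 44 (reg 43) ;; powersCmd 46 (sigE + 1) ;; halfCmd ;; radiusCmd ;;
  clipCmd ;; columnsCmd ;; rowsCmd ;; windowCmd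

/-- The banks changed by `setupCmd`. -/
abbrev setupBanks : List ℕ :=
  [28, 29, 30, 31, 32, 33, 40, 41, 42, 43, 44, 45, 46, 48, 49, 50, 51, 52, 53, 54, 55, 56, 57, 58,
    59, 60, 61, 62, 63, 64, 65, 66, 68, 69, 70, 71, 72, 73, 74, 76, 77, 79, 80, 81, 82, 83, 84, 85,
    86, 92]

theorem ensures_setupCmd (hI : Input k L σ tbl str d D m) (hz : ∀ b, 5 ≤ b → ∀ a, m b a = 0)
    (hs : ∀ a, str a ≤ σ) (hL0 : 0 < L)
    (hL : Limits N k L σ (baseOf k L σ tbl) (numTypes k σ) (radius k σ tbl))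
    (hσ : σ * σ ≤ N) (hS : tblSum σ tbl ≤ N)
    (h : ∀ m', Frame setupBanks m m' → ∀ r : ℕ → ℕ,
      (∀ p, r p < L) → (∀ j < L, colKey k L σ str (r (colKey k L σ str j)) = colKey k L σ str j) →
      Env k L σ (baseOf k L σ tbl) (numTypes k σ) (radius k σ tbl) (typeVec k L σ tbl str r) m' →
      (∀ x, m' 82 x ≤ m' 83 0) → (∀ j < L, m' 55 j = colKey k L σ str j) →
      (∀ i < k, m' 50 i = min (D i) (distBound k L σ tbl)) →
      (∀ i < k, m' 51 i = min (D i) (distBound k L σ tbl) - d i) →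
      (m' 49 0 ≠ 0 ↔ ∀ i < k, d i ≤ min (D i) (distBound k L σ tbl)) →
      m' 42 0 = distBound k L σ tbl → m' 46 k = (σ + 1) ^ k → Q m') :
    Ensures N setupCmd m Q := by
  have hkN : k ≤ N := (Nat.le_succ k).trans hL.k_le
  have hT0 : 1 ≤ (σ + 1) ^ k := Nat.one_le_pow _ _ (by omega)
  have hT1 : (σ + 1) ^ k ≤ N := by
    have h1 : (σ + 1) ^ k ≤ numTypes k σ := Nat.le_mul_of_pos_right _ (by omega)
    have := hL.T_le
    omega
  have hT2 : σ + 1 ≤ N := by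
    have h1 : σ + 1 ≤ numTypes k σ := Nat.le_mul_of_pos_left _ hT0
    have := hL.T_le
    omega
  refine ensures_seq (ensures_paramsCmd hI hσ hL.σ_le hkN hS ?_)
  intro m₁ F₁ a40 a42 a43
  have G₁ : Frame setupBanks m m₁ := F₁.mono (by decide)
  refine ensures_seq (ensures_powersCmd (hI.frame G₁ (by decide)).k_eq hkN hL.B_le (by decide)
    (x := baseOf k L σ tbl) ?_ ?_)
  · intro m' hF
    simp [hF 43 (by decide), a43]
  intro m₂ F₂ a44
  have G₂ := G₁.trans F₂ (by decide)
  refine ensures_seq (ensures_powersCmd (hI.frame G₂ (by decide)).k_eq hkN hT2 (by decide) ?_ ?_)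
  · intro m' hF
    simp [hF 0 (by decide), (hI.frame G₂ (by decide)).σ_eq]
  intro m₃ F₃ a46
  have G₃ := G₂.trans F₃ (by decide)
  refine ensures_seq (ensures_halfCmd (B := baseOf k L σ tbl) ?_ hL.B_le ?_ ?_)
  · rw [F₃ 43 (by decide), F₂ 43 (by decide), a43]
  · intro a
    rw [F₃ 48 (by decide), F₂ 48 (by decide), F₁ 48 (by decide), hz 48 (by decide)]
  intro m₄ F₄ a48
  have G₄ := G₃.trans F₄ (by decide)
  refine ensures_seq (ensures_radiusCmd (hI.frame G₄ (by decide)) hT2 hkN hS ?_ ?_ ?_)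
  · rw [F₄ 40 (by decide), F₃ 40 (by decide), F₂ 40 (by decide), a40]
  · rw [F₄ 46 (by decide), a46 k le_rfl]
  intro m₅ F₅ a92 a68 a69
  have G₅ := G₄.trans F₅ (by decide)
  refine ensures_seq (ensures_clipCmd (hI.frame G₅ (by decide)) (A := distBound k L σ tbl) ?_ hkN ?_)
  · rw [F₅ 42 (by decide), F₄ 42 (by decide), F₃ 42 (by decide), F₂ 42 (by decide), a42]
  intro m₆ F₆ a50 a51 a49
  have G₆ := G₅.trans F₆ (by decide)
  refine ensures_seq (ensures_columnsCmd (hI.frame G₆ (by decide)) hs hkN hL.σ_le hL.L_le hL0 hS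
    (B := baseOf k L σ tbl) ?_ ?_ ?_ ?_)
  · intro i hi
    rw [F₆ 44 (by decide), F₅ 44 (by decide), F₄ 44 (by decide), F₃ 44 (by decide), a44 i hi]
  · intro i hi
    rw [F₆ 46 (by decide), F₅ 46 (by decide), F₄ 46 (by decide), a46 i hi]
  · intro a
    rw [F₆ 56 (by decide), F₅ 56 (by decide), F₄ 56 (by decide), F₃ 56 (by decide),
      F₂ 56 (by decide), F₁ 56 (by decide), hz 56 (by decide)]
  rintro m₇ F₇ a55 a57 ⟨r, r1, r2, r3⟩
  have G₇ := G₆.trans F₇ (by decide)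
  refine ensures_seq (ensures_rowsCmd (hI.frame G₇ (by decide)) hkN hT2 hT1
    (B := baseOf k L σ tbl) ?_ ?_ r1 r2 a57 ?_)
  · intro i hi
    rw [F₇ 44 (by decide), F₆ 44 (by decide), F₅ 44 (by decide), F₄ 44 (by decide),
      F₃ 44 (by decide), a44 i hi]
  · intro i hi
    rw [F₇ 46 (by decide), F₆ 46 (by decide), F₅ 46 (by decide), F₄ 46 (by decide), a46 i hi]
  intro m₈ F₈ a62
  have G₈ := G₇.trans F₈ (by decide)
  refine ensures_windowCmd (B := baseOf k L σ tbl) (hI.frame G₈ (by decide)).k_eq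
    (M := radius k σ tbl) ?_ ?_ ?_ ?_ hL.k_le hL.W_le ?_
  · rw [F₈ 69 (by decide), F₇ 69 (by decide), F₆ 69 (by decide), a69]
  · intro i hi
    rw [F₈ 44 (by decide), F₇ 44 (by decide), F₆ 44 (by decide), F₅ 44 (by decide),
      F₄ 44 (by decide), F₃ 44 (by decide), a44 i hi]
  · intro a
    rw [F₈ 76 (by decide), F₇ 76 (by decide), F₆ 76 (by decide), F₅ 76 (by decide),
      F₄ 76 (by decide), F₃ 76 (by decide), F₂ 76 (by decide), F₁ 76 (by decide),
      hz 76 (by decide)]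
  · intro x
    rw [F₈ 82 (by decide), F₇ 82 (by decide), F₆ 82 (by decide), F₅ 82 (by decide),
      F₄ 82 (by decide), F₃ 82 (by decide), F₂ 82 (by decide), F₁ 82 (by decide),
      hz 82 (by decide)]
    exact Nat.zero_le _
  intro m₉ F₉ a82 a76 a77 a79
  have G₉ := G₈.trans F₉ (by decide)
  have hI₉ := hI.frame G₉ (by decide)
  refine h m₉ G₉ r r1 r3 ⟨hI₉.k_eq, hI₉.L_eq, hI₉.σ_eq, ?_, ?_, ?_, ?_, ?_, ?_, a76, a77, a79⟩
    a82 ?_ ?_ ?_ ?_ ?_ ?_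
  · rw [F₉ 43 (by decide), F₈ 43 (by decide), F₇ 43 (by decide), F₆ 43 (by decide),
      F₅ 43 (by decide), F₄ 43 (by decide), F₃ 43 (by decide), F₂ 43 (by decide), a43]
  · rw [F₉ 68 (by decide), F₈ 68 (by decide), F₇ 68 (by decide), F₆ 68 (by decide), a68]
  · rw [F₉ 92 (by decide), F₈ 92 (by decide), F₇ 92 (by decide), F₆ 92 (by decide), a92]
  · intro i hi
    rw [F₉ 44 (by decide), F₈ 44 (by decide), F₇ 44 (by decide), F₆ 44 (by decide),
      F₅ 44 (by decide), F₄ 44 (by decide), F₃ 44 (by decide), a44 i hi]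
  · intro a ha
    rw [F₉ 48 (by decide), F₈ 48 (by decide), F₇ 48 (by decide), F₆ 48 (by decide),
      F₅ 48 (by decide), a48 a ha]
  · intro p hp q hq
    rw [F₉ 62 (by decide), a62 p hp q hq]
  · intro j hj
    rw [F₉ 55 (by decide), F₈ 55 (by decide), a55 j hj]
  · intro i hi
    rw [F₉ 50 (by decide), F₈ 50 (by decide), F₇ 50 (by decide), a50 i hi]
  · intro i hi
    rw [F₉ 51 (by decide), F₈ 51 (by decide), F₇ 51 (by decide), a51 i hi]
  · rw [F₉ 49 (by decide), F₈ 49 (by decide), F₇ 49 (by decide), a49]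
  · rw [F₉ 42 (by decide), F₈ 42 (by decide), F₇ 42 (by decide), F₆ 42 (by decide),
      F₅ 42 (by decide), F₄ 42 (by decide), F₃ 42 (by decide), F₂ 42 (by decide), a42]
  · rw [F₉ 46 (by decide), F₈ 46 (by decide), F₇ 46 (by decide), F₆ 46 (by decide),
      F₅ 46 (by decide), F₄ 46 (by decide), a46 k le_rfl]

end RAM


/-! ## Search for the optimum and for a string that attains it -/

namespace RAM

open Cmd LetterSum

variable {N : ℕ} {m : Mem} {Q : Mem → Prop} {k L σ : ℕ} {tbl str d D r : ℕ → ℕ}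

theorem colVec_le (hs : ∀ a, str a ≤ σ) (hk : 1 ≤ k) {q : ℕ} (hq : q < σ) (j h : ℕ) :
    colVec k L σ tbl str j q h ≤ tblSum σ tbl * k := by
  have h1 := letterDist_le (tbl := tbl) hs hq
  have h2 : tblSum σ tbl ≤ tblSum σ tbl * k := Nat.le_mul_of_pos_right _ hk
  unfold colVec
  split_ifs
  · have := h1 (h * L + j)
    unfold tblSum at *
    omega
  · refine (Finset.sum_le_card_nsmul _ _ (tblSum σ tbl) fun i _ => ?_).trans ?_
    · have := h1 (i * L + j)
      unfold tblSum at *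
      omega
    · simp [mul_comm]
  · exact Nat.zero_le _

/-- The factor k is due to the last coordinate, a sum of k distances. The summand 1 in `tblSum`
makes the bound positive, so that it covers the unit vectors of the slacks even if all distances
vanish. -/
theorem typeVec_le (hs : ∀ a, str a ≤ σ) (hk : 1 ≤ k) {q : ℕ} (hq : q < σ) (p h : ℕ) :
    typeVec k L σ tbl str r p q h ≤ tblSum σ tbl * k := by
  unfold typeVec
  split_ifs with h1 h2 h3
  · exact colVec_le hs hk hq _ _
  · refine colVec_le hs hk ?_ _ _
    have : p / (σ + 1) ^ k < σ + 1 := Nat.div_lt_of_lt_mul h1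
    omega
  · exact Nat.mul_pos (by unfold tblSum; omega) hk
  · exact Nat.zero_le _

theorem sum_typeVec_le (hs : ∀ a, str a ≤ σ) (hk : 1 ≤ k) (ty y : ℕ → ℕ) (hy : ∀ j < L, y j < σ)
    (h : ℕ) :
    ∑ j ∈ Finset.range L, typeVec k L σ tbl str r (ty j) (y j) h ≤ distBound k L σ tbl := by
  refine (Finset.sum_le_card_nsmul _ _ (tblSum σ tbl * k) fun j hj =>
    typeVec_le hs hk (hy j (Finset.mem_range.1 hj)) _ _).trans (le_of_eq ?_)
  simp only [Finset.card_range, smul_eq_mul, distBound]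
  ring

theorem sum_sum_typeVec_le (hs : ∀ a, str a ≤ σ) (hk : 1 ≤ k) (h : ℕ) :
    ∑ p ∈ Finset.range (numTypes k σ + k), ∑ q ∈ Finset.range σ, typeVec k L σ tbl str r p q h ≤
      (numTypes k σ + k) * σ * tblSum σ tbl * k := by
  refine (Finset.sum_le_card_nsmul _ _ (σ * (tblSum σ tbl * k)) fun p _ =>
    (Finset.sum_le_card_nsmul _ _ (tblSum σ tbl * k) fun q hq =>
      typeVec_le hs hk (Finset.mem_range.1 hq) _ _).trans ?_).trans (le_of_eq ?_)
  · simp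
  · simp only [Finset.card_range, smul_eq_mul]
    ring

/-- Some choice of letters for columns of types `ty` meets the bounds `d` and `D` and has total
distance `o`. -/
def Solvable (k L σ : ℕ) (tbl str d D r ty : ℕ → ℕ) (o : ℕ) : Prop :=
  ∃ y : ℕ → ℕ, (∀ j < L, y j < σ) ∧
    (∀ h < k, d h ≤ ∑ j ∈ Finset.range L, typeVec k L σ tbl str r (ty j) (y j) h ∧
      ∑ j ∈ Finset.range L, typeVec k L σ tbl str r (ty j) (y j) h ≤ D h) ∧
    ∑ j ∈ Finset.range L, typeVec k L σ tbl str r (ty j) (y j) k = o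

theorem reach_iff_typeVec (hσ : 2 ≤ σ) {ty U : ℕ → ℕ} (hty : ∀ j < L, ty j < numTypes k σ)
    {w : ℕ → ℕ} :
    Reach (numTypes k σ + k) σ (typeVec k L σ tbl str r) (typeCount L (numTypes k σ) ty U) w ↔
      ∃ y u : ℕ → ℕ, (∀ j < L, y j < σ) ∧ (∀ i < k, u i ≤ U i) ∧ ∀ h, w h =
        ∑ j ∈ Finset.range L, typeVec k L σ tbl str r (ty j) (y j) h + if h < k then u h else 0 := by
  refine reach_iff_items hσ hty (fun p hp => if_pos hp) (fun i _ => ?_) fun i _ q h => ?_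
  · simp [typeCount]
  · simp [typeVec]

/-- A coordinate is a sum of distances plus a slack, each at most `distBound`, and the base is one
more than twice this number. -/
theorem reach_lt_base (hσ : 2 ≤ σ) (hs : ∀ a, str a ≤ σ) (hk : 1 ≤ k) {ty U : ℕ → ℕ}
    (hty : ∀ j < L, ty j < numTypes k σ) (hU : ∀ i < k, U i ≤ distBound k L σ tbl) {w : ℕ → ℕ}
    (hw : Reach (numTypes k σ + k) σ (typeVec k L σ tbl str r)
      (typeCount L (numTypes k σ) ty U) w) (h : ℕ) : w h < baseOf k L σ tbl := by
  obtain ⟨y, u, h1, h2, h3⟩ := (reach_iff_typeVec hσ hty).1 hw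
  rw [h3 h, baseOf]
  have := sum_typeVec_le (tbl := tbl) (r := r) hs hk ty y h1 h
  split_ifs with hh
  · have a1 := h2 h hh
    have a2 := hU h hh
    omega
  · omega

/-- For d ≤ D', the inequalities d ≤ x ≤ D' say that x + u = D' for some u between 0 and D' - d.
Here D' is the clipped bound, which is equivalent to D because no distance exceeds `distBound`. The
last coordinate has no slack, since the total must equal `o`. -/
theorem reach_iff_solvable (hσ : 2 ≤ σ) (hs : ∀ a, str a ≤ σ) (hk : 1 ≤ k) {ty U : ℕ → ℕ}
    (hty : ∀ j < L, ty j < numTypes k σ)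
    (hU : ∀ i < k, U i = min (D i) (distBound k L σ tbl) - d i)
    (hd : ∀ i < k, d i ≤ min (D i) (distBound k L σ tbl)) (o : ℕ) :
    (∃ w, Reach (numTypes k σ + k) σ (typeVec k L σ tbl str r)
      (typeCount L (numTypes k σ) ty U) w ∧
      ∀ h < k + 1, w h = if h < k then min (D h) (distBound k L σ tbl) else o) ↔
    Solvable k L σ tbl str d D r ty o := by
  constructor
  · rintro ⟨w, hw, hw'⟩
    obtain ⟨y, u, h1, h2, h3⟩ := (reach_iff_typeVec hσ hty).1 hw
    refine ⟨y, h1, fun h hh => ?_, ?_⟩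
    · have a1 := hw' h (by omega)
      have a2 := h3 h
      have a3 := h2 h hh
      have a4 := hU h hh
      have a5 := hd h hh
      rw [if_pos hh] at a1 a2
      omega
    · have a1 := hw' k (by omega)
      have a2 := h3 k
      simp only [lt_irrefl, if_false] at a1 a2
      omega
  · rintro ⟨y, h1, h2, h3⟩
    refine ⟨_, (reach_iff_typeVec hσ hty).2 ⟨y, fun h => min (D h) (distBound k L σ tbl) -
      ∑ j ∈ Finset.range L, typeVec k L σ tbl str r (ty j) (y j) h, h1, fun i hi => ?_,
      fun h => rfl⟩, fun h hh => ?_⟩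
    · have a1 := (h2 i hi).1
      rw [hU i hi]
      dsimp only
      omega
    · have a0 := sum_typeVec_le (tbl := tbl) (r := r) hs hk ty y h1 h
      dsimp only
      split_ifs with hhk
      · have a1 := (h2 h hhk).2
        omega
      · have : h = k := by omega
        subst this
        rw [h3, add_zero]

/-! ### Search for the least total distance -/

/-- The tables are in place, and so are the targets and slacks for feasible bounds. -/
structure Ready (k L σ : ℕ) (tbl str d D r : ℕ → ℕ) (m : Mem) : Prop where
  env : Env k L σ (baseOf k L σ tbl) (numTypes k σ) (radius k σ tbl) (typeVec k L σ tbl str r) m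
  stamp : ∀ x, m 82 x ≤ m 83 0
  target : ∀ i < k, m 50 i = min (D i) (distBound k L σ tbl)
  slack : ∀ i < k, m 51 i = min (D i) (distBound k L σ tbl) - d i
  power : m 46 k = (σ + 1) ^ k

theorem Ready.frame {m' : Mem} (h : Ready k L σ tbl str d D r m) {S : List ℕ} (hF : Frame S m m')
    (hS : ∀ b ∈ [0, 43, 46, 50, 51, 68, 82, 83, 92, 44, 48, 62, 76, 77, 79], b ∉ S) :
    Ready k L σ tbl str d D r m' := by
  have e : ∀ b ∈ [0, 43, 46, 50, 51, 68, 82, 83, 92, 44, 48, 62, 76, 77, 79], m' b = m b :=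
    fun b hb => hF b (hS b hb)
  refine ⟨h.env.frame hF fun b hb => hS b ?_, ?_, ?_, ?_, ?_⟩
  · revert hb
    revert b
    decide
  · rw [e 82 (by decide), e 83 (by decide)]; exact h.stamp
  · rw [e 50 (by decide)]; exact h.target
  · rw [e 51 (by decide)]; exact h.slack
  · rw [e 46 (by decide)]; exact h.power

/-- What is assumed throughout about the instance and the limit `N`. -/
structure Setting (N k L σ : ℕ) (tbl str : ℕ → ℕ) : Prop where
  two_le : 2 ≤ σ
  one_le : 1 ≤ k
  len_pos : 0 < L
  str_le : ∀ a, str a ≤ σ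
  limits : Limits N k L σ (baseOf k L σ tbl) (numTypes k σ) (radius k σ tbl)
  sq_le : σ * σ ≤ N
  sum_le : tblSum σ tbl ≤ N

theorem ensures_decideCmd_solvable (hT : Setting N k L σ tbl str) (hR : Ready k L σ tbl str d D r m)
    (hd : ∀ i < k, d i ≤ min (D i) (distBound k L σ tbl))
    (hty : ∀ j < L, m 55 j < numTypes k σ) (ho : m 90 0 ≤ distBound k L σ tbl)
    (h : ∀ m', Frame decideBanks m m' → Ready k L σ tbl str d D r m' →
      (m' 99 0 ≠ 0 ↔ Solvable k L σ tbl str d D r (m 55) (m 90 0)) → Q m') :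
    Ensures N decideCmd m Q := by
  obtain ⟨hσ, hk, hL0, hs, hL, -, -⟩ := hT
  have hA : L ≤ distBound k L σ tbl := by
    unfold distBound
    rw [mul_assoc]
    exact Nat.le_mul_of_pos_right _ (Nat.mul_pos hk (by unfold tblSum; omega))
  have hUle : ∀ i < k, m 51 i ≤ distBound k L σ tbl := fun i hi => by
    rw [hR.slack i hi]
    omega
  refine ensures_decideCmd hR.env hL hR.stamp (by unfold baseOf; omega)
    (fun i hi => ?_) (tgt := fun h => if h < k then min (D h) (distBound k L σ tbl) else m 90 0)
    (fun i hi => by rw [if_pos hi, hR.target i hi]) (by simp) (fun i hi => ?_)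
    (fun i _ => sum_sum_typeVec_le hs hk i) le_rfl
    (fun w hw i _ => reach_lt_base hσ hs hk hty hUle hw i) ?_
  · have := hUle i hi
    unfold baseOf
    omega
  · unfold baseOf
    split_ifs <;> omega
  · intro m' hF h1 h2 h3
    rw [reach_iff_solvable hσ hs hk hty hR.slack hd] at h3
    refine h m' hF ⟨hR.env.frame hF (by decide), h2, fun i hi => ?_, ?_, ?_⟩ h3
    · rw [h1 i hi, hR.target i hi]
    · rw [hF 51 (by decide)]; exact hR.slack
    · rw [hF 46 (by decide)]; exact hR.power

/-- Find the least reachable total distance; it is written to register `90`. -/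
def searchCmd : Cmd :=
  set 90 0 ;; set 100 0 ;;
  ite (reg 49) (rep 101 (reg 42 + 1) (
    ite (reg 100) skip (decideCmd ;; ite (reg 99) (set 100 1) (set 90 (reg 90 + 1))))) skip

/-- Every total is at most `distBound`, so the first success among 0, …, `distBound` is the minimum.
The loop has a fixed length; after a success the flag in register 100 makes the remaining rounds
idle. If a lower bound exceeds its clipped upper bound, no string is feasible and nothing is
searched. -/
theorem ensures_searchCmd (hT : Setting N k L σ tbl str) (hR : Ready k L σ tbl str d D r m)
    (h49 : m 49 0 ≠ 0 ↔ ∀ i < k, d i ≤ min (D i) (distBound k L σ tbl))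
    (h42 : m 42 0 = distBound k L σ tbl) (hty : ∀ j < L, m 55 j < numTypes k σ)
    (h : ∀ m', Frame (90 :: 100 :: 101 :: decideBanks) m m' → Ready k L σ tbl str d D r m' →
      (m' 100 0 ≠ 0 → (∀ i < k, d i ≤ min (D i) (distBound k L σ tbl)) ∧
        m' 90 0 ≤ distBound k L σ tbl ∧ Solvable k L σ tbl str d D r (m 55) (m' 90 0) ∧
        ∀ o < m' 90 0, ¬ Solvable k L σ tbl str d D r (m 55) o) →
      (m' 100 0 = 0 → ∀ o, ¬ Solvable k L σ tbl str d D r (m 55) o) → Q m') :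
    Ensures N searchCmd m Q := by
  refine ensures_set_seq (ensures_set_seq ?_)
  set m₀ := (m.write 90 0 (Expr.eval m 0)).write 100 0 (Expr.eval (m.write 90 0 (Expr.eval m 0)) 0)
    with hm₀
  have hF₀ : Frame [90, 100] m m₀ := ((Frame.refl _ m).write (by decide)).write (by decide)
  have hA : ∀ o, Solvable k L σ tbl str d D r (m 55) o → o ≤ distBound k L σ tbl := by
    rintro o ⟨y, h1, -, rfl⟩
    exact sum_typeVec_le hT.str_le hT.one_le _ _ h1 _
  refine ensures_ite (fun he => ?_) fun he => ensures_skip (h m₀ (hF₀.mono (by decide))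
    (hR.frame hF₀ (by decide)) ?_ ?_)
  · have hd := h49.1 (by simpa [hm₀] using he)
    have hBN := hT.limits.B_le
    unfold baseOf at hBN
    refine ensures_rep (distBound k L σ tbl + 1) (fun i m' =>
      Frame (90 :: 100 :: 101 :: decideBanks) m m' ∧ Ready k L σ tbl str d D r m' ∧
      (m' 100 0 ≠ 0 → m' 90 0 ≤ distBound k L σ tbl ∧
        Solvable k L σ tbl str d D r (m 55) (m' 90 0) ∧
        ∀ o < m' 90 0, ¬ Solvable k L σ tbl str d D r (m 55) o) ∧
      (m' 100 0 = 0 → m' 90 0 = i ∧ ∀ o < i, ¬ Solvable k L σ tbl str d D r (m 55) o))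
      (by simp [hm₀, h42]) (by omega) ?_ ?_ ?_
    · refine ⟨((hF₀.mono (by decide)).write (by decide)).write (by decide),
        (hR.frame hF₀ (by decide)).frame (S := [101])
          (((Frame.refl _ _).write (by decide)).write (by decide)) (by decide), ?_, ?_⟩
      · simp [hm₀]
      · simp [hm₀]
    · rintro i hi m₁ ⟨hF₁, hR₁, a1, a2⟩ h101 h101'
      have hskip : Frame [101] m₁ (m₁.write 101 0 (i + 1)) := (Frame.refl _ _).write (by decide)
      refine ensures_ite (fun he => ensures_skip ⟨h101, h101', hF₁.write (by decide),
        hR₁.frame hskip (by decide), ?_, ?_⟩) fun he => ?_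
      · simpa using a1
      · intro hc
        exact absurd (by simpa using hc) he
      · obtain ⟨b1, b2⟩ := a2 he
        have h55 : m₁ 55 = m 55 := hF₁ 55 (by decide)
        refine ensures_seq (ensures_decideCmd_solvable hT hR₁ hd (by rw [h55]; exact hty)
          (by omega) ?_)
        intro m₂ hF' hR₂ h99
        have hF₂ := hF₁.trans hF' (by decide)
        rw [h55, b1] at h99
        have e90 : m₂ 90 0 = i := by rw [hF' 90 (by decide), b1]
        have e100 : m₂ 100 0 = 0 := by rw [hF' 100 (by decide)]; exact he
        refine ensures_ite (fun he' => ensures_set ⟨?_, ?_, ?_, ?_, ?_, ?_⟩)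
          fun he' => ensures_set ⟨?_, ?_, ?_, ?_, ?_, ?_⟩
        · simp [hF' 101 (by decide), h101]
        · simp [hF' 101 (by decide), h101']
        · exact (hF₂.write (by decide)).write (by decide)
        · exact hR₂.frame (S := [100, 101])
            (((Frame.refl _ _).write (by decide)).write (by decide)) (by decide)
        · intro _
          have : i ≤ distBound k L σ tbl := by omega
          simpa [e90, this] using ⟨h99.1 he', b2⟩
        · simp
        · simp [hF' 101 (by decide), h101]
        · simp [hF' 101 (by decide), h101']
        · exact (hF₂.write (by decide)).write (by decide)
        · exact hR₂.frame (S := [90, 101])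
            (((Frame.refl _ _).write (by decide)).write (by decide)) (by decide)
        · simp [e100]
        · intro _
          refine ⟨by simp [e90], fun o ho => ?_⟩
          rcases Nat.lt_succ_iff_lt_or_eq.1 ho with ho | rfl
          · exact b2 o ho
          · exact fun hc => h99.2 hc he'
    · rintro m₁ ⟨hF₁, hR₁, a1, a2⟩ -
      refine h m₁ hF₁ hR₁ (fun hc => ⟨hd, a1 hc⟩) fun hc o ho => ?_
      have := hA o ho
      exact (a2 hc).2 o (by omega) ho
  · simp [hm₀]
  · rintro - o ⟨y, h1, h2, h3⟩
    refine absurd (h49.2 fun i hi => ?_) (not_not.2 ?_)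
    · have a1 := h2 i hi
      have a2 := sum_typeVec_le (tbl := tbl) (r := r) hT.str_le hT.one_le (m 55) y h1 i
      omega
    · simpa [hm₀] using he

end RAM


/-! ## Extraction of a string -/

namespace RAM

open Cmd LetterSum

variable {N : ℕ} {m : Mem} {Q : Mem → Prop} {k L σ : ℕ} {tbl str d D r : ℕ → ℕ}

/-- Fix the letters of the columns one after the other; they are written to bank `6`. -/
def extractCmd : Cmd :=
  ite (reg 100) (
    rep 52 lenE (
      set 102 0 ;; set 105 (cell 55 (reg 52)) ;;
      rep 104 sigE (
        set 105 (reg 105 + cell 46 kE) ;;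
        ite (reg 102) skip (
          store 55 (reg 52) (reg 105) ;; decideCmd ;;
          ite (reg 99) (set 102 1 ;; store 6 (reg 52) (reg 104)) skip))) ;;
    set 5 1) skip

theorem type_lt (hs : ∀ a, str a ≤ σ) (j : ℕ) {f : ℕ} (hf : f ≤ σ) :
    colKey k L σ str j + f * (σ + 1) ^ k < numTypes k σ := by
  have h1 := colKey_lt (k := k) (L := L) hs j
  have h2 : (f + 1) * (σ + 1) ^ k ≤ (σ + 1) * (σ + 1) ^ k :=
    Nat.mul_le_mul_right _ (by omega)
  rw [numTypes, mul_comm ((σ + 1) ^ k)]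
  rw [add_mul f, one_mul] at h2
  omega

/-- Quotient and remainder by (σ+1)^k recover the prescription and the number of the column. The
representative may replace the column because their numbers agree. -/
theorem typeVec_type (hs : ∀ a, str a ≤ σ)
    (hr : ∀ j < L, colKey k L σ str (r (colKey k L σ str j)) = colKey k L σ str j)
    {j : ℕ} (hj : j < L) {f : ℕ} (hf : f ≤ σ) (q : ℕ) :
    typeVec k L σ tbl str r (colKey k L σ str j + f * (σ + 1) ^ k) q =
      colVec k L σ tbl str j (if f = 0 then q else f - 1) := by
  have h1 := colKey_lt (k := k) (L := L) hs j
  have d1 : (colKey k L σ str j + f * (σ + 1) ^ k) / (σ + 1) ^ k = f := by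
    rw [Nat.add_mul_div_right _ _ (by omega), Nat.div_eq_of_lt h1, zero_add]
  have d2 : (colKey k L σ str j + f * (σ + 1) ^ k) % (σ + 1) ^ k = colKey k L σ str j := by
    rw [Nat.add_mul_mod_self_right, Nat.mod_eq_of_lt h1]
  funext h
  rw [typeVec, if_pos (type_lt hs j hf), d1, d2, colVec_congr hs (hr j hj)]

/-- Prescribing for column j the letter that a solution uses there leaves all its contributions
unchanged, so the same solution remains valid. -/
theorem Solvable.fix (hs : ∀ a, str a ≤ σ)
    (hr : ∀ j < L, colKey k L σ str (r (colKey k L σ str j)) = colKey k L σ str j)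
    {ty : ℕ → ℕ} {o j : ℕ} (hj : j < L) (hty : ty j = colKey k L σ str j)
    (h : Solvable k L σ tbl str d D r ty o) : ∃ q < σ, Solvable k L σ tbl str d D r
      (Function.update ty j (colKey k L σ str j + (q + 1) * (σ + 1) ^ k)) o := by
  obtain ⟨y, h1, h2⟩ := h
  refine ⟨y j, h1 j hj, y, h1, ?_⟩
  have e : ∀ h, ∑ i ∈ Finset.range L, typeVec k L σ tbl str r
      (Function.update ty j (colKey k L σ str j + (y j + 1) * (σ + 1) ^ k) i) (y i) h =
      ∑ i ∈ Finset.range L, typeVec k L σ tbl str r (ty i) (y i) h := fun h => by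
    refine Finset.sum_congr rfl fun i hi => ?_
    by_cases hij : i = j
    · subst hij
      have h0 := typeVec_type (tbl := tbl) hs hr hj (Nat.zero_le σ) (y i)
      have h3 := typeVec_type (tbl := tbl) hs hr hj (f := y i + 1) (h1 i hj) (y i)
      simp only [zero_mul, add_zero, if_true] at h0
      rw [Function.update_self, hty, h3, h0]
      simp
    · rw [Function.update_of_ne hij]
  simpa only [e] using h2

/-- The type of column `i` once the letters `c` of the first `j` columns are fixed. -/
def fixedType (k L σ : ℕ) (str c : ℕ → ℕ) (j i : ℕ) : ℕ :=
  colKey k L σ str i + (if i < j then c i + 1 else 0) * (σ + 1) ^ k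

/-- Once every column has a prescribed letter, the contributions no longer depend on the choice of
letters, so solvability says that the letters in bank 6 form a solution. After a failed search the
memory is left as it is, and with it the initial 0 in bank 5. -/
theorem ensures_extractCmd (hT : Setting N k L σ tbl str) (hR : Ready k L σ tbl str d D r m)
    (hr : ∀ j < L, colKey k L σ str (r (colKey k L σ str j)) = colKey k L σ str j)
    (h55 : ∀ j < L, m 55 j = colKey k L σ str j)
    (h100 : m 100 0 ≠ 0 → (∀ i < k, d i ≤ min (D i) (distBound k L σ tbl)) ∧
      m 90 0 ≤ distBound k L σ tbl ∧ Solvable k L σ tbl str d D r (m 55) (m 90 0))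
    (h : ∀ m', (m 100 0 ≠ 0 → m' 5 0 = 1 ∧ (∀ j < L, m' 6 j < σ) ∧
      (∀ h < k, d h ≤ ∑ j ∈ Finset.range L, colVec k L σ tbl str j (m' 6 j) h ∧
        ∑ j ∈ Finset.range L, colVec k L σ tbl str j (m' 6 j) h ≤ D h) ∧
      ∑ j ∈ Finset.range L, colVec k L σ tbl str j (m' 6 j) k = m 90 0) →
      (m 100 0 = 0 → m' = m) → Q m') :
    Ensures N extractCmd m Q := by
  refine ensures_ite (fun he => ?_) fun he => ensures_skip (h m (fun hc => absurd he hc)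
    fun _ => rfl)
  obtain ⟨hd, ho, hsol⟩ := h100 he
  have hs := hT.str_le
  set κ := colKey k L σ str with hκ
  set o := m 90 0 with hodef
  set T₀ := (σ + 1) ^ k with hT₀
  refine Ensures.seq (R := fun m' => (∀ j < L, m' 6 j < σ) ∧
    (∀ i < L, m' 55 i = fixedType k L σ str (m' 6) L i) ∧
    Solvable k L σ tbl str d D r (m' 55) o) ?_ ?_
  · refine ensures_rep L (fun j m' => Ready k L σ tbl str d D r m' ∧ m' 90 0 = o ∧
      (∀ i < j, m' 6 i < σ) ∧ (∀ i < L, m' 55 i = fixedType k L σ str (m' 6) j i) ∧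
      Solvable k L σ tbl str d D r (m' 55) o) (by simp [hR.env.L_eq]) hT.limits.L_le ?_ ?_ ?_
    · refine ⟨hR.frame (S := [52]) (((Frame.refl _ _).write (by decide)).write (by decide))
        (by decide), by simp [hodef], by simp, ?_, ?_⟩
      · simpa [fixedType] using h55
      · simpa using hsol
    · rintro j hj m₁ ⟨hR₁, a90, a6, a55, asol⟩ h52 h52'
      have hj55 : m₁ 55 j = κ j := by
        rw [a55 j hj, fixedType, if_neg (lt_irrefl j), zero_mul, add_zero]
      refine ensures_set_seq (ensures_set_seq ?_)
      set m₂ := (m₁.write 102 0 (Expr.eval m₁ 0)).write 105 0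
        (Expr.eval (m₁.write 102 0 (Expr.eval m₁ 0)) (cell 55 (reg 52))) with hm₂
      have hF₂ : Frame [102, 105] m₁ m₂ := ((Frame.refl _ _).write (by decide)).write (by decide)
      have hR₂ := hR₁.frame hF₂ (by decide)
      -- As long as no letter has been found, cell j of bank 55 may hold the type of a failed trial,
      -- hence the unspecified `x`; the next trial overwrites it.
      refine ensures_rep σ (fun q m' => Ready k L σ tbl str d D r m' ∧ m' 90 0 = o ∧
        m' 52 = m₁ 52 ∧ m' 105 0 = κ j + q * T₀ ∧
        (m' 102 0 ≠ 0 → ∃ q' < σ, m' 55 = Function.update (m₁ 55) j (κ j + (q' + 1) * T₀) ∧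
          Solvable k L σ tbl str d D r (m' 55) o ∧ m' 6 = Function.update (m₁ 6) j q') ∧
        (m' 102 0 = 0 → (∃ x, m' 55 = Function.update (m₁ 55) j x) ∧ m' 6 = m₁ 6 ∧
          ∀ q' < q, ¬ Solvable k L σ tbl str d D r
            (Function.update (m₁ 55) j (κ j + (q' + 1) * T₀)) o))
        (by simp [hR₂.env.σ_eq]) hT.limits.σ_le ?_ ?_ ?_
      · refine ⟨hR₂.frame (S := [104]) (((Frame.refl _ _).write (by decide)).write (by decide))
          (by decide), ?_, ?_, ?_, ?_, ?_⟩
        · simp [hm₂, a90]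
        · simp [hm₂]
        · simp [hm₂, h52, hj55]
        · simp [hm₂]
        · intro _
          refine ⟨⟨m₁ 55 j, ?_⟩, ?_, ?_⟩
          · simp [hm₂]
          · simp [hm₂]
          · simp
      · rintro q hq m₃ ⟨hR₃, b90, b52, b105, bdone, btodo⟩ h104 h104'
        refine ensures_set_seq ?_
        have hev : (reg 105 + cell 46 kE).eval m₃ = κ j + (q + 1) * T₀ := by
          simp only [eval_add, eval_reg, eval_cell, b105, hR₃.env.k_eq, hR₃.power]
          ring
        rw [hev]
        set m₄ := m₃.write 105 0 (κ j + (q + 1) * T₀) with hm₄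
        have hF₄ : Frame [105] m₃ m₄ := (Frame.refl _ _).write (by decide)
        have hR₄ := hR₃.frame hF₄ (by decide)
        have hw : Frame [104] m₄ (m₄.write 104 0 (q + 1)) := (Frame.refl _ _).write (by decide)
        refine ensures_ite (fun hc => ensures_skip ⟨by simp [hm₄, h104], by simp [hm₄, h104'],
          hR₄.frame hw (by decide), by simp [hm₄, b90], by simp [hm₄, b52], by simp [hm₄], ?_, ?_⟩)
          fun hc => ?_
        · simpa [hm₄] using bdone
        · intro hc'
          exact absurd (by simpa using hc') hc
        have hc : m₃ 102 0 = 0 := by simpa [hm₄] using hc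
        obtain ⟨⟨x, bx⟩, b6, bnot⟩ := btodo hc
        refine ensures_store_seq ?_
        have e52 : (reg 52).eval m₄ = j := by simp [hm₄, b52, h52]
        have e105 : (reg 105).eval m₄ = κ j + (q + 1) * T₀ := by simp [hm₄]
        rw [e52, e105]
        set m₅ := m₄.write 55 j (κ j + (q + 1) * T₀) with hm₅
        have hR₅ : Ready k L σ tbl str d D r m₅ := hR₄.frame (S := [55])
          ((Frame.refl _ _).write (by decide)) (by decide)
        have e55 : m₅ 55 = Function.update (m₁ 55) j (κ j + (q + 1) * T₀) := by
          simp [hm₅, hm₄, bx]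
        have hty : ∀ i < L, m₅ 55 i < numTypes k σ := fun i hi => by
          rw [e55]
          by_cases hij : i = j
          · subst hij
            rw [Function.update_self]
            exact type_lt hs i hq
          · rw [Function.update_of_ne hij, a55 i hi, fixedType]
            refine type_lt hs i ?_
            split_ifs with hlt
            · exact a6 i hlt
            · exact Nat.zero_le _
        refine ensures_seq (ensures_decideCmd_solvable hT hR₅ hd hty ?_ ?_)
        · simpa [hm₅, hm₄, b90] using ho
        intro m₆ hF₆ hR₆ h99
        have e90 : m₅ 90 0 = o := by simp [hm₅, hm₄, b90]
        rw [e90, e55] at h99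
        have f90 : m₆ 90 0 = o := by rw [hF₆ 90 (by decide), e90]
        have f52 : m₆ 52 = m₁ 52 := by rw [hF₆ 52 (by decide)]; simp [hm₅, hm₄, b52]
        have f105 : m₆ 105 0 = κ j + (q + 1) * T₀ := by
          rw [hF₆ 105 (by decide)]; simp [hm₅, hm₄]
        have f104 : m₆ 104 = m₃ 104 := by rw [hF₆ 104 (by decide)]; simp [hm₅, hm₄]
        have f102 : m₆ 102 0 = 0 := by rw [hF₆ 102 (by decide)]; simp [hm₅, hm₄, hc]
        have f55 : m₆ 55 = Function.update (m₁ 55) j (κ j + (q + 1) * T₀) := by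
          rw [hF₆ 55 (by decide), e55]
        have f6 : m₆ 6 = m₁ 6 := by rw [hF₆ 6 (by decide)]; simp [hm₅, hm₄, b6]
        refine ensures_ite (fun hc' => ensures_set_seq (ensures_store
          ⟨by simp [f104, h104], by simp [f104, h104'], ?_, by simp [f90], by simp [f52],
            by simp [f105], ?_, ?_⟩)) fun hc' => ensures_skip
          ⟨by simp [f104, h104], by simp [f104, h104'], ?_, by simp [f90], by simp [f52],
            by simp [f105], ?_, ?_⟩
        · exact hR₆.frame (S := [102, 6, 104])
            ((((Frame.refl _ _).write (by decide)).write (by decide)).write (by decide)) (by decide)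
        · intro _
          refine ⟨q, hq, by simp [f55], ?_, ?_⟩
          · simpa [f55] using h99.1 hc'
          · simp [f52, h52, f104, h104, f6]
        · intro hc''
          simp at hc''
        · exact hR₆.frame (S := [104]) ((Frame.refl _ _).write (by decide)) (by decide)
        · intro hc''
          exact absurd f102 (by simpa using hc'')
        · intro _
          refine ⟨⟨κ j + (q + 1) * T₀, by simp [f55]⟩, by simp [f6], fun q' hq' => ?_⟩
          rcases Nat.lt_succ_iff_lt_or_eq.1 hq' with hq' | rfl
          · exact bnot q' hq'
          · exact fun hx => h99.2 hx hc'
      · rintro m₃ ⟨hR₃, b90, b52, -, bdone, btodo⟩ -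
        obtain ⟨q, hq, hqs⟩ := asol.fix hs hr hj hj55
        -- Not all trials can fail, because some letter can be prescribed by `Solvable.fix`.
        have hne : m₃ 102 0 ≠ 0 := fun hc => (btodo hc).2.2 q hq hqs
        obtain ⟨q', hq', c55, csol, c6⟩ := bdone hne
        refine ⟨by rw [b52, h52], by rw [b52, h52'],
          hR₃.frame (S := [52]) ((Frame.refl _ _).write (by decide)) (by decide),
          by simp [b90], fun i hi => ?_, fun i hi => ?_, by simpa using csol⟩
        · by_cases hij : i = j
          · simp [hij, c6, hq']
          · have : i < j := by omega
            simp [c6, hij, a6 i this]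
        · by_cases hij : i = j
          · simp [hij, c6, c55, fixedType, hκ, hT₀]
          · have : i < j + 1 ↔ i < j := by omega
            simp [hij, c6, c55, fixedType, this, a55 i hi]
    · rintro m₁ ⟨-, -, a6, a55, asol⟩ -
      exact ⟨a6, a55, asol⟩
  · rintro m₁ ⟨a6, a55, y, h1, h2, h3⟩
    have e : ∀ h, ∑ j ∈ Finset.range L, typeVec k L σ tbl str r (m₁ 55 j) (y j) h =
        ∑ j ∈ Finset.range L, colVec k L σ tbl str j (m₁ 6 j) h := fun h => by
      refine Finset.sum_congr rfl fun j hj => ?_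
      have hj := Finset.mem_range.1 hj
      rw [a55 j hj, fixedType, if_pos hj, typeVec_type hs hr hj (a6 j hj)]
      simp
    simp only [e] at h2 h3
    refine ensures_set (h _ (fun _ => ⟨by simp, ?_, ?_, ?_⟩) fun hc => absurd hc he)
    · simpa using a6
    · simpa using h2
    · simpa using h3

end RAM


/-! ## The whole algorithm -/

namespace RAM

open Cmd LetterSum

variable {N : ℕ} {m : Mem} {Q : Mem → Prop} {k L σ : ℕ} {tbl str d D : ℕ → ℕ}

/-- Test whether the string of zeros is feasible. -/
def zeroCmd : Cmd :=
  set 54 0 ;; set 5 1 ;; ite sigE skip (ite lenE (set 5 0) skip) ;;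
  rep 45 kE (
    set 60 0 ;;
    rep 52 lenE (ite (cell 4 (reg 54)) (set 60 (reg 60 + cell 3 0)) skip ;;
      set 54 (reg 54 + 1)) ;;
    ite ((cell 1 (reg 45) - reg 60) + (reg 60 - cell 2 (reg 45))) (set 5 0) skip)

/-- The distance of string `h` from the string of zeros, if there is at most one letter. -/
def zeroDist (L : ℕ) (tbl str : ℕ → ℕ) (h : ℕ) : ℕ :=
  ∑ j ∈ Finset.range L, if str (h * L + j) = 0 then 0 else tbl 0

theorem ensures_zeroCmd (hI : Input k L σ tbl str d D m) (hk : k ≤ N) (hL : L ≤ N)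
    (h : ∀ m', Frame [5, 45, 52, 54, 60] m m' → (m' 5 0 = 0 ∨ m' 5 0 = 1) →
      (m' 5 0 ≠ 0 ↔ (σ = 0 → L = 0) ∧
        ∀ i < k, d i ≤ zeroDist L tbl str i ∧ zeroDist L tbl str i ≤ D i) → Q m') :
    Ensures N zeroCmd m Q := by
  refine ensures_set_seq (ensures_set_seq ?_)
  set m₀ := (m.write 54 0 (Expr.eval m 0)).write 5 0 (Expr.eval (m.write 54 0 (Expr.eval m 0)) 1)
    with hm₀
  have hF₀ : Frame [5, 45, 52, 54, 60] m m₀ :=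
    ((Frame.refl _ m).write (by decide)).write (by decide)
  have e0 : m₀ 0 = m 0 := hF₀ 0 (by decide)
  refine Ensures.seq (R := fun m' => Frame [5, 45, 52, 54, 60] m m' ∧ m' 54 0 = 0 ∧
    (m' 5 0 = 0 ∨ m' 5 0 = 1) ∧ (m' 5 0 ≠ 0 ↔ (σ = 0 → L = 0))) ?_ ?_
  · refine ensures_ite (fun he => ensures_skip ⟨hF₀, ?_, ?_, ?_⟩) fun he =>
      ensures_ite (fun he' => ensures_set ⟨hF₀.write (by decide), ?_, ?_, ?_⟩)
      fun he' => ensures_skip ⟨hF₀, ?_, ?_, ?_⟩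
    · simp [hm₀]
    · simp [hm₀]
    · have : σ ≠ 0 := by simpa [e0, hI.σ_eq] using he
      simp [hm₀, this]
    · simp [hm₀]
    · simp
    · have h1 : σ = 0 := by simpa [e0, hI.σ_eq] using he
      have h2 : L ≠ 0 := by simpa [e0, hI.L_eq] using he'
      simp [h1, h2]
    · simp [hm₀]
    · simp [hm₀]
    · have h2 : L = 0 := by simpa [e0, hI.L_eq] using he'
      simp [hm₀, h2]
  rintro m₁ ⟨hF₁, h54, h5, h5'⟩
  refine ensures_rep k (fun i m' => Frame [5, 45, 52, 54, 60] m m' ∧ m' 54 0 = i * L ∧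
    (m' 5 0 = 0 ∨ m' 5 0 = 1) ∧ (m' 5 0 ≠ 0 ↔ (σ = 0 → L = 0) ∧
      ∀ i' < i, d i' ≤ zeroDist L tbl str i' ∧ zeroDist L tbl str i' ≤ D i'))
    (by simp [hF₁ 0 (by decide), hI.k_eq]) hk ?_ ?_ ?_
  · refine ⟨(hF₁.write (by decide)).write (by decide), by simp [h54], by simpa using h5, ?_⟩
    simpa using h5'
  · rintro i hi m₂ ⟨hF₂, a54, a5, a5'⟩ h45 h45'
    refine ensures_set_seq (Ensures.seq (R := fun m' => Frame [52, 54, 60] m₂ m' ∧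
      m' 54 0 = i * L + L ∧ m' 60 0 = zeroDist L tbl str i) ?_ ?_)
    · refine ensures_rep L (fun j m' => Frame [52, 54, 60] m₂ m' ∧ m' 54 0 = i * L + j ∧
        m' 60 0 = ∑ j' ∈ Finset.range j, if str (i * L + j') = 0 then 0 else tbl 0)
        (by simp [hF₂ 0 (by decide), hI.L_eq]) hL ?_ ?_ fun m' h _ => h
      · exact ⟨(((Frame.refl _ _).write (by decide)).write (by decide)).write (by decide),
          by simp [a54], by simp⟩
      · rintro j hj m₃ ⟨hF₃, b54, b60⟩ h52 h52'
        have e4 : m₃ 4 = str := by rw [hF₃ 4 (by decide), hF₂ 4 (by decide), hI.str_eq]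
        have e3 : m₃ 3 = tbl := by rw [hF₃ 3 (by decide), hF₂ 3 (by decide), hI.tbl_eq]
        refine ensures_seq (ensures_ite (fun he => ensures_set (ensures_set
          ⟨by simp [h52], by simp [h52'],
          ((hF₃.write (by decide)).write (by decide)).write (by decide), ?_, ?_⟩))
          fun he => ensures_skip (ensures_set ⟨by simp [h52], by simp [h52'],
          (hF₃.write (by decide)).write (by decide), ?_, ?_⟩))
        · simp [b54, add_assoc]
        · have : str (i * L + j) ≠ 0 := by simpa [e4, b54] using he
          simp [Finset.sum_range_succ, this, b60, e3]
        · simp [b54, add_assoc]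
        · have : str (i * L + j) = 0 := by simpa [e4, b54] using he
          simp [Finset.sum_range_succ, this, b60]
    · rintro m₃ ⟨hF₃, b54, b60⟩
      have hF₃' := hF₂.trans hF₃ (by decide)
      have ev : ((cell 1 (reg 45) - reg 60) + (reg 60 - cell 2 (reg 45))).eval m₃ = 0 ↔
          d i ≤ zeroDist L tbl str i ∧ zeroDist L tbl str i ≤ D i := by
        simp only [eval_add, eval_sub, eval_cell, eval_reg, hF₃ 45 (by decide), h45,
          hF₃' 1 (by decide), hF₃' 2 (by decide), hI.d_eq, hI.D_eq, b60]
        omega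
      have e45 : m₃ 45 = m₂ 45 := hF₃ 45 (by decide)
      have e5 : m₃ 5 = m₂ 5 := hF₃ 5 (by decide)
      refine ensures_ite (fun he => ensures_set ⟨by simp [e45, h45], by simp [e45, h45'],
        (hF₃'.write (by decide)).write (by decide), ?_, ?_, ?_⟩)
        fun he => ensures_skip ⟨by simp [e45, h45], by simp [e45, h45'],
        hF₃'.write (by decide), ?_, ?_, ?_⟩
      · simp [b54, add_mul]
      · simp
      · have : ¬ ((σ = 0 → L = 0) ∧ ∀ i' < i + 1, d i' ≤ zeroDist L tbl str i' ∧
            zeroDist L tbl str i' ≤ D i') := fun hc => he (ev.2 (hc.2 i (by omega)))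
        simp only [this, iff_false]
        simp
      · simp [b54, add_mul]
      · simpa [e5] using a5
      · have e : (m₃.write 45 0 (i + 1)) 5 0 = m₂ 5 0 := by simp [e5]
        rw [e, a5']
        refine and_congr_right fun _ => ⟨fun hc i' hi' => ?_, fun hc i' hi' => hc i' (by omega)⟩
        rcases Nat.lt_succ_iff_lt_or_eq.1 hi' with hi' | rfl
        · exact hc i' hi'
        · exact ev.1 he
  · rintro m₂ ⟨hF₂, -, a5, a5'⟩ -
    exact h m₂ hF₂ a5 a5'

/-! ### Correctness of the complete program -/

/-- The algorithm. -/
def solveCmd : Cmd :=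
  ite kE (ite (sigE - 1) (ite lenE (setupCmd ;; searchCmd ;; extractCmd) zeroCmd) zeroCmd) zeroCmd

/-- The letters `y` meet the bounds `d` and `D` and have total distance `o`. -/
def Attains (k L σ : ℕ) (tbl str d D y : ℕ → ℕ) (o : ℕ) : Prop :=
  (∀ j < L, y j < σ) ∧
  (∀ h < k, d h ≤ ∑ j ∈ Finset.range L, letterDist σ tbl (y j) (str (h * L + j)) ∧
    ∑ j ∈ Finset.range L, letterDist σ tbl (y j) (str (h * L + j)) ≤ D h) ∧
  ∑ h ∈ Finset.range k, ∑ j ∈ Finset.range L, letterDist σ tbl (y j) (str (h * L + j)) = o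

/-- The memory holds an optimal solution or the information that there is none. -/
def Solved (k L σ : ℕ) (tbl str d D : ℕ → ℕ) (m : Mem) : Prop :=
  (m 5 0 = 1 ∧ ∃ o, Attains k L σ tbl str d D (m 6) o ∧
    ∀ y o', Attains k L σ tbl str d D y o' → o ≤ o') ∨
  (m 5 0 = 0 ∧ ∀ y o, ¬ Attains k L σ tbl str d D y o)

/-- The last coordinates sum the distances column by column, the definition string by string; the
two double sums agree. -/
theorem attains_iff {y : ℕ → ℕ} {o : ℕ} : Attains k L σ tbl str d D y o ↔ (∀ j < L, y j < σ) ∧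
    (∀ h < k, d h ≤ ∑ j ∈ Finset.range L, colVec k L σ tbl str j (y j) h ∧
      ∑ j ∈ Finset.range L, colVec k L σ tbl str j (y j) h ≤ D h) ∧
    ∑ j ∈ Finset.range L, colVec k L σ tbl str j (y j) k = o := by
  unfold Attains
  rw [Finset.sum_comm]
  have e : ∀ h < k, ∑ j ∈ Finset.range L, colVec k L σ tbl str j (y j) h =
      ∑ j ∈ Finset.range L, letterDist σ tbl (y j) (str (h * L + j)) := fun h hh =>
    Finset.sum_congr rfl fun j _ => by rw [colVec, if_pos hh]
  have e' : ∑ j ∈ Finset.range L, colVec k L σ tbl str j (y j) k = ∑ j ∈ Finset.range L,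
      ∑ h ∈ Finset.range k, letterDist σ tbl (y j) (str (h * L + j)) :=
    Finset.sum_congr rfl fun j _ => by simp [colVec]
  rw [e']
  refine and_congr_right fun _ => and_congr_left fun _ => forall₂_congr fun h hh => ?_
  rw [e h hh]

theorem solvable_iff_attains (hs : ∀ a, str a ≤ σ) {r ty : ℕ → ℕ}
    (hr : ∀ j < L, colKey k L σ str (r (colKey k L σ str j)) = colKey k L σ str j)
    (hty : ∀ j < L, ty j = colKey k L σ str j) {o : ℕ} :
    Solvable k L σ tbl str d D r ty o ↔ ∃ y, Attains k L σ tbl str d D y o := by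
  have e : ∀ y : ℕ → ℕ, ∀ h, ∑ j ∈ Finset.range L, typeVec k L σ tbl str r (ty j) (y j) h =
      ∑ j ∈ Finset.range L, colVec k L σ tbl str j (y j) h := fun y h =>
    Finset.sum_congr rfl fun j hj => by
      have hj := Finset.mem_range.1 hj
      have := typeVec_type (tbl := tbl) hs hr hj (Nat.zero_le σ) (y j)
      simp only [zero_mul, add_zero, if_true] at this
      rw [hty j hj, this]
  simp only [Solvable, attains_iff, e]

/-- The main branch of the algorithm is correct. -/
theorem ensures_search_extract (hI : Input k L σ tbl str d D m)
    (hz : ∀ b, 5 ≤ b → ∀ a, m b a = 0) (hT : Setting N k L σ tbl str) :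
    Ensures N (setupCmd ;; searchCmd ;; extractCmd) m (Solved k L σ tbl str d D) := by
  have hs := hT.str_le
  refine ensures_seq (ensures_setupCmd hI hz hs hT.len_pos hT.limits hT.sq_le hT.sum_le ?_)
  intro m₁ hF₁ r r1 r2 hE h82 h55 h50 h51 h49 h42 h46
  have hR : Ready k L σ tbl str d D r m₁ := ⟨hE, h82, h50, h51, h46⟩
  have hty : ∀ j < L, m₁ 55 j < numTypes k σ := fun j hj => by
    rw [h55 j hj]
    simpa using type_lt (k := k) (L := L) hs j (Nat.zero_le σ)
  refine ensures_seq (ensures_searchCmd hT hR h49 h42 hty ?_)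
  intro m₂ hF₂ hR₂ a1 a2
  have e55 : m₂ 55 = m₁ 55 := hF₂ 55 (by decide)
  simp only [solvable_iff_attains hs r2 h55] at a1 a2
  refine ensures_extractCmd hT hR₂ r2 (by rw [e55]; exact h55) (fun hc => ?_) ?_
  · obtain ⟨b1, b2, b3, -⟩ := a1 hc
    rw [e55, solvable_iff_attains hs r2 h55]
    exact ⟨b1, b2, b3⟩
  · intro m₃ c1 c2
    by_cases hc : m₂ 100 0 = 0
    · right
      rw [c2 hc, hF₂ 5 (by decide), hF₁ 5 (by decide), hz 5 le_rfl]
      exact ⟨rfl, fun y o hy => a2 hc o ⟨y, hy⟩⟩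
    · left
      obtain ⟨b1, b2⟩ := c1 hc
      refine ⟨b1, m₂ 90 0, attains_iff.2 b2, fun y o' hy => ?_⟩
      by_contra hlt
      exact (a1 hc).2.2.2 o' (by omega) ⟨y, hy⟩

/-- The branch for at most one letter is correct. -/
theorem ensures_zeroCmd_solved (hI : Input k L σ tbl str d D m)
    (hz : ∀ b, 5 ≤ b → ∀ a, m b a = 0) (hs : ∀ a, str a ≤ σ) (hk : k ≤ N) (hL : L ≤ N)
    (hdeg : k = 0 ∨ σ ≤ 1 ∨ L = 0) :
    Ensures N zeroCmd m (Solved k L σ tbl str d D) := by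
  -- A string and a column to compare exclude k = 0 and L = 0, and the presence of a letter excludes
  -- σ = 0. So σ = 1, every letter is 0, and the only nonzero character code is 1.
  have hy0 : ∀ y : ℕ → ℕ, (∀ j < L, y j < σ) → ∀ h < k,
      ∑ j ∈ Finset.range L, letterDist σ tbl (y j) (str (h * L + j)) = zeroDist L tbl str h := by
    intro y hy h hh
    refine Finset.sum_congr rfl fun j hj => ?_
    have hj := Finset.mem_range.1 hj
    have h1 := hy j hj
    have h2 := hs (h * L + j)
    have : σ = 1 := by omega
    subst this
    have h3 : y j = 0 := by omega
    unfold letterDist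
    split_ifs with h4
    · rfl
    · have h5 : str (h * L + j) = 1 := by omega
      simp [h3, h5]
  refine ensures_zeroCmd hI hk hL fun m' hF h1 h2 => ?_
  by_cases hc : m' 5 0 = 0
  · refine Or.inr ⟨hc, fun y o hy => absurd hc (h2.2 ⟨fun h0 => ?_, fun i hi => ?_⟩)⟩
    · by_contra hL
      have := hy.1 0 (by omega)
      omega
    · rw [← hy0 y hy.1 i hi]
      exact hy.2.1 i hi
  · obtain ⟨g1, g2⟩ := h2.1 hc
    have hm : ∀ j < L, m' 6 j < σ := fun j hj => by
      rw [hF 6 (by decide), hz 6 (by decide)]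
      by_contra hσ
      have := g1 (by omega)
      omega
    refine Or.inl ⟨h1.resolve_left hc, _, ⟨hm, fun i hi => ?_, rfl⟩, fun y o' hy => ?_⟩
    · rw [hy0 _ hm i hi]
      exact g2 i hi
    · rw [← hy.2.2]
      refine le_of_eq (Finset.sum_congr rfl fun i hi => ?_)
      rw [hy0 _ hm i (Finset.mem_range.1 hi), hy0 y hy.1 i (Finset.mem_range.1 hi)]

theorem ensures_solveCmd (hI : Input k L σ tbl str d D m)
    (hz : ∀ b, 5 ≤ b → ∀ a, m b a = 0) (hs : ∀ a, str a ≤ σ) (hk : k ≤ N) (hL : L ≤ N)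
    (hT : 2 ≤ σ → 1 ≤ k → 0 < L → Setting N k L σ tbl str) :
    Ensures N solveCmd m (Solved k L σ tbl str d D) := by
  refine ensures_ite (fun h1 => ensures_ite (fun h2 => ensures_ite (fun h3 => ?_) fun h3 => ?_)
    fun h2 => ?_) fun h1 => ?_
  · have h1 : k ≠ 0 := by simpa [hI.k_eq] using h1
    have h2 : σ - 1 ≠ 0 := by simpa only [eval_sub, eval_cell, eval_lit, eval_one, hI.σ_eq] using h2
    have h3 : L ≠ 0 := by simpa [hI.L_eq] using h3
    exact ensures_search_extract hI hz (hT (by omega) (by omega) (by omega))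
  · exact ensures_zeroCmd_solved hI hz hs hk hL (Or.inr (Or.inr (by simpa [hI.L_eq] using h3)))
  · have h2 : σ - 1 = 0 := by simpa only [eval_sub, eval_cell, eval_lit, eval_one, hI.σ_eq] using h2
    exact ensures_zeroCmd_solved hI hz hs hk hL (Or.inr (Or.inl (by omega)))
  · exact ensures_zeroCmd_solved hI hz hs hk hL (Or.inl (by simpa [hI.k_eq] using h1))

/-! ### Running time -/

/-- A bound for all loop limits in the main branch. -/
def loopLimit (k L σ : ℕ) (tbl : ℕ → ℕ) : ℕ := 4 * L * (2 * radius k σ tbl + 1) ^ (k + 1)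

/-- The radius is so large that `numTypes k σ + k`, σ² and k·`tblSum` are at most M, hence at most
W. The base depends on L as well: `distBound` is at most L·W, so twice it plus 1 is at most 4·L·W.
-/
theorem setting_loopLimit (hσ : 2 ≤ σ) (hk : 1 ≤ k) (hL : 0 < L) (hs : ∀ a, str a ≤ σ) :
    Setting (loopLimit k L σ tbl) k L σ tbl str := by
  set M := radius k σ tbl with hM
  set W := (2 * M + 1) ^ (k + 1) with hW
  have hS : 1 ≤ tblSum σ tbl := by unfold tblSum; omega
  have hMW : 2 * M + 1 ≤ W := Nat.le_self_pow (by omega) _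
  have hW1 : 1 ≤ W := by omega
  have hN : loopLimit k L σ tbl = 4 * (L * W) := by rw [loopLimit, mul_assoc]
  have hLW : W ≤ L * W := Nat.le_mul_of_pos_left _ hL
  have hLW' : L ≤ L * W := Nat.le_mul_of_pos_right _ hW1
  have hT : σ + 1 ≤ numTypes k σ := Nat.le_mul_of_pos_left _ (Nat.one_le_pow _ _ (by omega))
  have a1 : numTypes k σ + k ≤ M := by
    have : (numTypes k σ + k) * 1 ≤ (numTypes k σ + k) * (σ * tblSum σ tbl * k) :=
      Nat.mul_le_mul_left _ (Nat.mul_pos (Nat.mul_pos (by omega) hS) hk)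
    rw [hM, radius]
    simp only [mul_assoc] at this ⊢
    omega
  have a2 : σ * σ ≤ M := by
    have h1 : σ * σ ≤ (numTypes k σ + k) * σ := Nat.mul_le_mul_right _ (by omega)
    have h2 : (numTypes k σ + k) * σ * 1 ≤ (numTypes k σ + k) * σ * (tblSum σ tbl * k) :=
      Nat.mul_le_mul_left _ (Nat.mul_pos hS hk)
    rw [hM, radius]
    simp only [mul_assoc, mul_one] at h1 h2 ⊢
    omega
  have a3 : tblSum σ tbl * k ≤ M := by
    have : 1 * (tblSum σ tbl * k) ≤ (numTypes k σ + k) * σ * (tblSum σ tbl * k) :=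
      Nat.mul_le_mul_right _ (Nat.mul_pos (by omega) (by omega))
    rw [hM, radius]
    simp only [mul_assoc] at this ⊢
    omega
  have a4 : tblSum σ tbl ≤ tblSum σ tbl * k := Nat.le_mul_of_pos_right _ hk
  have hkW : k + 1 < W := Nat.lt_pow_self (by omega)
  have a5 : distBound k L σ tbl ≤ L * W := by
    rw [distBound, mul_assoc]
    refine Nat.mul_le_mul_left _ ?_
    rw [mul_comm]
    omega
  have a6 : σ ≤ σ * σ := Nat.le_mul_of_pos_left _ (by omega)
  refine ⟨hσ, hk, hL, hs, ⟨?_, ?_, ?_, ?_, ?_, ?_⟩, ?_, ?_⟩ <;> rw [hN]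
  · omega
  · omega
  · omega
  · unfold baseOf
    omega
  · omega
  · change W ≤ _
    omega
  · omega
  · omega

/-- Since σ ≥ 2, all constants are absorbed into powers of σ. The number of types is at most σ^(4k)
and `tblSum` at most σ³Δ, so the side of the window is at most σ^(13k)·(Δk)². Its exponent k+1 is at
most 2k, and the factor 4 costs another σ^(2k²). -/
theorem loopLimit_le {Δ : ℕ} (hσ : 2 ≤ σ) (hk : 1 ≤ k) (hΔ : 1 ≤ Δ)
    (htbl : ∀ i < σ * σ, tbl i ≤ Δ) :
    loopLimit k L σ tbl ≤ (Δ * k) ^ (4 * k) * σ ^ (28 * k ^ 2) * L := by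
  have b1 : tblSum σ tbl ≤ σ ^ 3 * Δ := by
    have h1 : ∑ i ∈ Finset.range (σ * σ), tbl i ≤ σ * σ * Δ := by
      refine (Finset.sum_le_card_nsmul _ _ Δ fun i hi => htbl i (Finset.mem_range.1 hi)).trans ?_
      simp
    have h2 : 1 ≤ σ * σ * Δ := Nat.mul_pos (Nat.mul_pos (by omega) (by omega)) hΔ
    have h3 : 2 * (σ * σ * Δ) ≤ σ * (σ * σ * Δ) := Nat.mul_le_mul_right _ hσ
    calc tblSum σ tbl ≤ 2 * (σ * σ * Δ) := by unfold tblSum; omega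
      _ ≤ σ * (σ * σ * Δ) := h3
      _ = _ := by ring
  have b2 : numTypes k σ ≤ σ ^ (4 * k) := by
    have h1 : σ + 1 ≤ σ ^ 2 := by nlinarith
    calc numTypes k σ = (σ + 1) ^ (k + 1) := (pow_succ _ _).symm
      _ ≤ (σ ^ 2) ^ (k + 1) := Nat.pow_le_pow_left h1 _
      _ = σ ^ (2 * (k + 1)) := by rw [pow_mul]
      _ ≤ σ ^ (4 * k) := Nat.pow_le_pow_right (by omega) (by omega)
  have b3 : numTypes k σ + k ≤ σ ^ (4 * k + 1) * k := by
    have h1 : 1 ≤ σ ^ (4 * k) := Nat.one_le_pow _ _ (by omega)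
    have h2 : σ ^ (4 * k) ≤ σ ^ (4 * k) * k := Nat.le_mul_of_pos_right _ hk
    have h3 : k ≤ σ ^ (4 * k) * k := Nat.le_mul_of_pos_left _ h1
    calc numTypes k σ + k ≤ 2 * (σ ^ (4 * k) * k) := by omega
      _ ≤ σ * (σ ^ (4 * k) * k) := Nat.mul_le_mul_right _ hσ
      _ = _ := by ring
  have b4 : (numTypes k σ + k) * σ * tblSum σ tbl * k ≤ σ ^ (4 * k + 5) * (Δ * k ^ 2) := by
    calc (numTypes k σ + k) * σ * tblSum σ tbl * k
        ≤ (σ ^ (4 * k + 1) * k) * σ * (σ ^ 3 * Δ) * k := by gcongr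
      _ = _ := by ring
  have b5 : 2 * radius k σ tbl + 1 ≤ (σ ^ (13 * k)) * (Δ * k) ^ 2 := by
    have h1 : 1 ≤ σ ^ (4 * k + 5) * (Δ * k ^ 2) :=
      Nat.mul_pos (Nat.one_le_pow _ _ (by omega)) (Nat.mul_pos hΔ (Nat.one_le_pow _ _ hk))
    have h2 : 16 ≤ σ ^ 4 := by
      calc 16 = 2 ^ 4 := by norm_num
        _ ≤ σ ^ 4 := Nat.pow_le_pow_left hσ _
    have h3 : Δ ≤ Δ ^ 2 := Nat.le_self_pow (by norm_num) _
    calc 2 * radius k σ tbl + 1 ≤ 16 * (σ ^ (4 * k + 5) * (Δ * k ^ 2)) := by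
          unfold radius
          omega
      _ ≤ σ ^ 4 * (σ ^ (4 * k + 5) * (Δ ^ 2 * k ^ 2)) := by gcongr
      _ = σ ^ (4 * k + 9) * (Δ * k) ^ 2 := by ring
      _ ≤ σ ^ (13 * k) * (Δ * k) ^ 2 :=
          Nat.mul_le_mul_right _ (Nat.pow_le_pow_right (by omega) (by omega))
  have b6 : (2 * radius k σ tbl + 1) ^ (k + 1) ≤ σ ^ (26 * k ^ 2) * (Δ * k) ^ (4 * k) := by
    calc (2 * radius k σ tbl + 1) ^ (k + 1) ≤ (2 * radius k σ tbl + 1) ^ (2 * k) :=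
          Nat.pow_le_pow_right (by omega) (by omega)
      _ ≤ ((σ ^ (13 * k)) * (Δ * k) ^ 2) ^ (2 * k) := Nat.pow_le_pow_left b5 _
      _ = _ := by rw [mul_pow, ← pow_mul, ← pow_mul]; ring_nf
  have b7 : 4 ≤ σ ^ (2 * k ^ 2) := by
    have : 1 ≤ k ^ 2 := Nat.one_le_pow _ _ hk
    calc 4 = 2 ^ 2 := by norm_num
      _ ≤ σ ^ 2 := Nat.pow_le_pow_left hσ _
      _ ≤ σ ^ (2 * k ^ 2) := Nat.pow_le_pow_right (by omega) (by omega)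
  calc loopLimit k L σ tbl
      ≤ σ ^ (2 * k ^ 2) * L * (σ ^ (26 * k ^ 2) * (Δ * k) ^ (4 * k)) := by
        unfold loopLimit
        gcongr
    _ = _ := by
        rw [show 28 * k ^ 2 = 2 * k ^ 2 + 26 * k ^ 2 by ring, pow_add]
        ring

/-- The factor and the exponent in the bound for the running time. -/
def timeConst : ℕ := solveCmd.size + 28 * solveCmd.depth

theorem bound_loopLimit_le {Δ : ℕ} (hσ : 2 ≤ σ) (hk : 1 ≤ k) (hL : 1 ≤ L) (hΔ : 1 ≤ Δ)
    (htbl : ∀ i < σ * σ, tbl i ≤ Δ) :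
    solveCmd.bound (loopLimit k L σ tbl) ≤
      timeConst * (Δ * k) ^ (timeConst * k) * σ ^ (timeConst * k ^ 2) * L ^ timeConst := by
  have h1 : 1 ≤ loopLimit k L σ tbl :=
    Nat.mul_pos (by omega) (Nat.one_le_pow _ _ (by omega))
  have hΔk : 1 ≤ Δ * k := Nat.mul_pos hΔ hk
  set e := solveCmd.depth with he
  have hC : 28 * e ≤ timeConst := Nat.le_add_left _ _
  calc solveCmd.bound (loopLimit k L σ tbl)
      ≤ solveCmd.size * loopLimit k L σ tbl ^ e := bound_le h1 _
    _ ≤ timeConst * ((Δ * k) ^ (4 * k) * σ ^ (28 * k ^ 2) * L) ^ e :=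
        Nat.mul_le_mul (Nat.le_add_right _ _) (Nat.pow_le_pow_left (loopLimit_le hσ hk hΔ htbl) _)
    _ = timeConst * (Δ * k) ^ (4 * e * k) * σ ^ (28 * e * k ^ 2) * L ^ e := by
        rw [mul_pow, mul_pow, ← pow_mul, ← pow_mul]
        ring_nf
    _ ≤ _ := by
        gcongr <;> omega

/-- For k = 0 the power of Δk is 0^0 = 1, so the loop limit contains max 1 k instead of k. For k ≥ 1
the power of k is covered by that of Δk. -/
theorem bound_le_of_degenerate {Δ : ℕ} (hΔ : 1 ≤ Δ) (σ' : ℕ) (hσ : 1 ≤ σ') (hL : 1 ≤ L) :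
    solveCmd.bound (max 1 k * L) ≤
      timeConst * (Δ * k) ^ (timeConst * k) * σ' ^ (timeConst * k ^ 2) * L ^ timeConst := by
  set e := solveCmd.depth with he
  have hC : e ≤ timeConst := by unfold timeConst; omega
  have h1 : max 1 k ^ e ≤ (Δ * k) ^ (timeConst * k) := by
    rcases Nat.eq_zero_or_pos k with rfl | hk
    · simp
    · rw [max_eq_right hk]
      refine (Nat.pow_le_pow_left (Nat.le_mul_of_pos_left k hΔ) e).trans
        (Nat.pow_le_pow_right (Nat.mul_pos hΔ hk) ?_)
      exact hC.trans (Nat.le_mul_of_pos_right _ hk)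
  calc solveCmd.bound (max 1 k * L)
      ≤ solveCmd.size * (max 1 k * L) ^ e := bound_le (Nat.mul_pos (by omega) hL) _
    _ = solveCmd.size * max 1 k ^ e * 1 * L ^ e := by rw [mul_pow]; ring
    _ ≤ _ := by
        gcongr
        · exact Nat.le_add_right _ _
        · exact Nat.one_le_pow _ _ hσ

end RAM

/-! ## Instances of `δ`-Multi Strings -/

namespace MultiStrings

open RAM

variable (I : MultiStrings)

theorem bankOf_apply {n : ℕ} (f : Fin n → ℕ) (i : Fin n) : bankOf f i = f i := by
  simp [bankOf]

theorem bankOf_le {n c : ℕ} (f : Fin n → ℕ) (hf : ∀ i, f i ≤ c) (a : ℕ) : bankOf f a ≤ c := by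
  unfold bankOf
  split_ifs
  · exact hf _
  · exact Nat.zero_le _

theorem encode_input :
    Input I.k I.L I.σ (I.encode 3) (I.encode 4) (I.encode 1) (I.encode 2) I.encode :=
  ⟨rfl, rfl, rfl, rfl, rfl, rfl, rfl⟩

theorem encode_zero (b : ℕ) (hb : 5 ≤ b) (a : ℕ) : I.encode b a = 0 := by
  match b, hb with
  | b + 5, _ => rfl

theorem encode_str_le (a : ℕ) : I.encode 4 a ≤ I.σ := by
  change bankOf (fun p : Fin (I.k * I.L) => I.charCode (I.s p.divNat p.modNat)) a ≤ I.σ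
  refine bankOf_le _ (fun i => ?_) a
  unfold charCode
  split <;> omega

theorem encode_tbl_le (a : ℕ) : I.encode 3 a ≤ I.maxDist :=
  bankOf_le _ (fun i => Finset.le_sup (f := fun c : Fin I.σ × Fin I.σ => I.δ [some c.1] [some c.2])
    (Finset.mem_univ (i.divNat, i.modNat))) a

/-- Both banks are stored row by row, so quotient and remainder of the address return the indices.
The wildcard has code 0, for which `letterDist` is 0; this is where wildcard compatibility enters.
-/
theorem letterDist_encode (hI : I.CharwiseWildcardCompatible) (q : Fin I.σ) (h : Fin I.k)
    (j : Fin I.L) :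
    letterDist I.σ (I.encode 3) q (I.encode 4 (h * I.L + j)) = I.δ [some q] [I.s h j] := by
  have key : ∀ (a b : ℕ) (x : Fin a) (y : Fin b) (hlt : (x : ℕ) * b + y < a * b),
      (⟨(x : ℕ) * b + y, hlt⟩ : Fin (a * b)).divNat = x ∧
      (⟨(x : ℕ) * b + y, hlt⟩ : Fin (a * b)).modNat = y := by
    intro a b x y hlt
    have hb : 0 < b := y.pos
    constructor
    · ext
      simp only [Fin.coe_divNat]
      rw [mul_comm, Nat.mul_add_div hb, Nat.div_eq_of_lt y.2, add_zero]
    · ext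
      simp only [Fin.coe_modNat]
      rw [mul_comm, Nat.mul_add_mod, Nat.mod_eq_of_lt y.2]
  have bound : ∀ (a b : ℕ) (x : Fin a) (y : Fin b), (x : ℕ) * b + y < a * b := by
    intro a b x y
    have : ((x : ℕ) + 1) * b ≤ a * b := Nat.mul_le_mul_right _ x.2
    rw [add_mul, one_mul] at this
    omega
  have h4 : I.encode 4 (h * I.L + j) = I.charCode (I.s h j) := by
    have hlt := bound I.k I.L h j
    have := bankOf_apply (fun p : Fin (I.k * I.L) => I.charCode (I.s p.divNat p.modNat))
      ⟨h * I.L + j, hlt⟩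
    simp only [(key _ _ h j hlt).1, (key _ _ h j hlt).2] at this
    exact this
  rw [h4, letterDist]
  rcases hs : I.s h j with _ | a
  · simp [charCode, hI.2 q]
  · have hlt := bound I.σ I.σ q a
    have := bankOf_apply (fun p : Fin (I.σ * I.σ) => I.δ [some p.divNat] [some p.modNat])
      ⟨q * I.σ + a, hlt⟩
    simp only [(key _ _ q a hlt).1, (key _ _ q a hlt).2] at this
    have h3 : I.encode 3 (q * I.σ + a) = I.δ [some q] [some a] := this
    simpa [charCode] using h3

theorem dist_eq (hI : I.CharwiseWildcardCompatible) (y : Fin I.L → Fin I.σ) (z : ℕ → ℕ)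
    (hz : ∀ j : Fin I.L, z j = y j) (h : Fin I.k) :
    I.dist y h = ∑ j ∈ Finset.range I.L,
      letterDist I.σ (I.encode 3) (z j) (I.encode 4 (h * I.L + j)) := by
  rw [dist, hI.1, Finset.sum_range]
  refine Finset.sum_congr rfl fun j _ => ?_
  rw [hz j, letterDist_encode I hI]

theorem attains_iff (hI : I.CharwiseWildcardCompatible) (y : Fin I.L → Fin I.σ) (z : ℕ → ℕ)
    (hz : ∀ j : Fin I.L, z j = y j) (o : ℕ) :
    Attains I.k I.L I.σ (I.encode 3) (I.encode 4) (I.encode 1) (I.encode 2) z o ↔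
      I.Feasible y ∧ ∑ h, I.dist y h = o := by
  have h1 : ∀ h : Fin I.k, I.encode 1 h = I.d h := bankOf_apply I.d
  have h2 : ∀ h : Fin I.k, I.encode 2 h = I.D h := bankOf_apply I.D
  have e := dist_eq I hI y z hz
  have hlt : ∀ j < I.L, z j < I.σ := fun j hj => by
    have := hz ⟨j, hj⟩
    simp only at this
    rw [this]
    exact (y ⟨j, hj⟩).2
  unfold Attains Feasible
  rw [Finset.sum_range]
  simp only [← e]
  constructor
  · rintro ⟨-, a1, a2⟩
    refine ⟨fun h => ?_, a2⟩
    have := a1 h h.2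
    rwa [← e, h1, h2] at this
  · rintro ⟨a1, a2⟩
    refine ⟨hlt, fun h hh => ?_, a2⟩
    have := a1 ⟨h, hh⟩
    rwa [e, ← h1, ← h2] at this

/-- A string minimizing the sum of the distances also minimizes β times it, so both values of β are
treated alike. -/
theorem correctOutput_of_solved (hI : I.CharwiseWildcardCompatible) {m : Mem}
    (h : Solved I.k I.L I.σ (I.encode 3) (I.encode 4) (I.encode 1) (I.encode 2) m) :
    I.CorrectOutput m := by
  have ext : ∀ y : Fin I.L → Fin I.σ, ∃ z : ℕ → ℕ, ∀ j : Fin I.L, z j = y j := fun y =>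
    ⟨fun j => if hj : j < I.L then y ⟨j, hj⟩ else 0, fun j => by simp⟩
  rcases h with ⟨h1, o, h2, h3⟩ | ⟨h1, h2⟩
  · refine Or.inl ⟨h1, fun j => ⟨m 6 j, h2.1 j j.2⟩, ⟨?_, fun y hy => ?_⟩, fun j => rfl⟩
    · exact ((attains_iff I hI _ (m 6) (fun j => rfl) o).1 h2).1
    · obtain ⟨z, hz⟩ := ext y
      have := h3 z _ ((attains_iff I hI y z hz _).2 ⟨hy, rfl⟩)
      rw [← ((attains_iff I hI (fun j => ⟨m 6 j, h2.1 j j.2⟩) (m 6) (fun j => rfl) o).1 h2).2]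
        at this
      exact Nat.mul_le_mul_left _ this
  · refine Or.inr ⟨h1, ?_⟩
    rintro ⟨y, hy⟩
    obtain ⟨z, hz⟩ := ext y
    exact h2 z _ ((attains_iff I hI y z hz _).2 ⟨hy, rfl⟩)

theorem solvedWithin_of_ensures (hI : I.CharwiseWildcardCompatible) {N T : ℕ}
    (h : Cmd.Ensures N solveCmd I.encode
      (Solved I.k I.L I.σ (I.encode 3) (I.encode 4) (I.encode 1) (I.encode 2)))
    (hT : solveCmd.bound N ≤ T) : I.SolvedWithin solveCmd.compile T := by
  obtain ⟨t, m, h1, h2, h3⟩ := h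
  exact ⟨t, m, h1, h2.trans hT, correctOutput_of_solved I hI h3⟩

end MultiStrings

open RAM MultiStrings

theorem mainTheorem6 :
    ∃ (p : RAM.Prog) (C : ℕ), ∀ I : MultiStrings, I.CharwiseWildcardCompatible →
      I.SolvedWithin p
        (C * (max 1 I.maxDist * I.k) ^ (C * I.k) * (max 1 I.σ) ^ (C * I.k ^ 2) *
          (max 1 I.L) ^ C) := by
  refine ⟨solveCmd.compile, timeConst, fun I hI => ?_⟩
  have hin := I.encode_input
  have hz := I.encode_zero
  have hs := I.encode_str_le
  -- Outside this case only the test of the string of zeros runs, whose loop limits are k and L.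
  by_cases hc : 2 ≤ I.σ ∧ 1 ≤ I.k ∧ 0 < I.L
  · obtain ⟨h1, h2, h3⟩ := hc
    have hS := setting_loopLimit (tbl := I.encode 3) h1 h2 h3 hs
    refine I.solvedWithin_of_ensures hI (ensures_solveCmd hin hz hs
      ((Nat.le_succ _).trans hS.limits.k_le) hS.limits.L_le fun _ _ _ => hS) ?_
    rw [max_eq_right (show 1 ≤ I.σ by omega), max_eq_right (show 1 ≤ I.L from h3)]
    exact bound_loopLimit_le h1 h2 h3 (le_max_left _ _)
      fun i _ => (I.encode_tbl_le i).trans (le_max_right _ _)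
  · refine I.solvedWithin_of_ensures hI (N := max 1 I.k * max 1 I.L)
      (ensures_solveCmd hin hz hs ?_ ?_ fun h1 h2 h3 => absurd ⟨h1, h2, h3⟩ hc)
      (bound_le_of_degenerate (le_max_left _ _) _ (le_max_left _ _) (le_max_left _ _))
    · exact (le_max_right _ _).trans (Nat.le_mul_of_pos_right _ (by omega))
    · exact (le_max_right _ _).trans (Nat.le_mul_of_pos_left _ (by omega))
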